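/- Let $\mathfrak g$ be a compact simple real Lie algebra with bracket $[T^a,T^b]=f^{ab}{}_c\,T^c$ in a basis $(T^a)$. Let $v^{\mathfrak g}$ be its dual Coxeter number and $\langle\cdot,\cdot\rangle_{\mathfrak g}$ (Gram matrix $g_{\mathfrak g}^{ab}$, inverse $g^{\mathfrak g}_{ab}$) the positive multiple $-\frac1{2v^{\mathfrak g}}\times$(Killing form), i.e. the invariant scalar product for which long roots have squared length $2$. Let $\iota:\mathfrak h\hookrightarrow\mathfrak g$ be an injective homomorphism of a reductive Lie algebra $\mathfrak h=\bigoplus_\alpha\mathfrak h_\alpha$, where the $\mathfrak h_\alpha$ are finitely many simple ideals and one abelian ideal (possibly $0$). For a simple ideal let $g_\alpha^{ab}$ be its metric normalized in the same way, $v^\alpha$ its dual Coxeter number and $I_\alpha$ its Dynkin index, $\langle\iota X,\iota Y\rangle_{\mathfrak g}=I_\alpha\, g_\alpha(X,Y)$; for the abelian ideal put $I_\alpha=1$, $v^\alpha=0$ and let $g_\alpha$ be the restriction of $\langle\cdot,\cdot\rangle_{\mathfrak g}$. Write $g^\alpha_{ab}$ for the inverse matrix of $g_\alpha^{ab}$.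 Let $k\ge1$ be an integer and consider a vacuum representation of the current algebra of $\mathfrak g$ at level $k$: on a Hilbert space with a dense invariant domain, symmetric operator-valued distributions $j^X(x)$ on the (compactified) light ray, real-linear in the colour $X\in\mathfrak g$, $j^a:=j^{T^a}$, with $$[j^a(x),j^b(y)]=i f^{ab}{}_c\,j^c(x)\,\delta(x-y)+k\,g_{\mathfrak g}^{ab}\,\tfrac{i}{2\pi}\,\delta'(x-y),$$ a symmetric, positive conformal Hamiltonian $L_0$ on that domain with $[L_0,j^a(g)]=i\,j^a\big(\tfrac12(1+x^2)g'\big)$, and a unit vector $\Omega$, cyclic for the currents, that spans the kernel of $L_0$. Let $:\ :$ be the normal ordering of the currents with respect to the modes $j^a(e_n)$, $e_n(x)=\big(\tfrac{1+ix}{1-ix}\big)^n$, and set $$\Theta^{\mathfrak g}=\frac{\pi}{k+v^{\mathfrak g}}\,g^{\mathfrak g}_{ab}:j^aj^b:,\qquad \Theta^{\mathfrak h}=\sum_\alpha\frac{\pi}{I_\alpha k+v^\alpha}\,g^\alpha_{ab}:j^{\iota(a)}j^{\iota(b)}:,$$ $$\widetilde C_2=\sum_\alpha\frac{2I_\alpha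 k\,P_\alpha+C_2^\alpha}{2(I_\alpha k+v^\alpha)},\qquad C_2^\alpha T=-\,g^\alpha_{ab}\,[T^{\iota(b)},[T^{\iota(a)},T]],$$ where $P_\alpha$ is the orthogonal projection of $\mathfrak g$ onto $\iota(\mathfrak h_\alpha)$. For a colour $T^c\in\mathfrak g$ let $$\Phi^c=\sum_\alpha\frac{1}{2(I_\alpha k+v^\alpha)}\,g^\alpha_{ab}\,f^{\iota(b)c}{}_d:j^{\iota(a)}j^d+j^dj^{\iota(a)}:,\qquad\text{where } f^{\iota(b)c}{}_d\,T^d=[T^{\iota(b)},T^c].$$ For $n=2,4$ let $$\widetilde\Delta^n(u,v)=\lim_{\varepsilon\downarrow0}(2\pi)^{-n}\int\!\!\int dx\,dy\,\big(i[(x-y)-i\varepsilon]\big)^{-n}u(x)v(y).$$ Smeared currents and smeared normal products are taken as closed operators. Then for every $T^c\in\mathfrak g$ the following hold. (i) Let $f$ and $g$ be complex test functions such that $f$ is a smooth vector field and $g$ a smooth function on the compactified light ray (e.g. Schwartz functions). Then $\Omega$ is in the domain of the commutator $[(\Theta^{\mathfrak g}-\Theta^{\mathfrak h})(f),j^c(g)]$,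 the limits below exist, and $$\big\|[(\Theta^{\mathfrak g}-\Theta^{\mathfrak h})(f),j^c(g)]\Omega\big\|^2=8k\pi^2\,\langle(1-\widetilde C_2)T^c,\widetilde C_2T^c\rangle_{\mathfrak g}\,\widetilde\Delta^4(\overline{fg},fg)+k\,\langle(1-\widetilde C_2)T^c,(1-\widetilde C_2)T^c\rangle_{\mathfrak g}\,\widetilde\Delta^2(\overline{fg'},fg').$$ (ii) Let $u$ and $v$ be complex test functions that are smooth vector fields on the compactified light ray. Then $\Omega$ is in the domain of $\Phi^c(u)\Phi^c(v)$, the limit below exists, and $$\langle\Omega,\Phi^c(u)\Phi^c(v)\Omega\rangle=2k\,\widetilde\Delta^4(u,v)\,\langle(1-\widetilde C_2)T^c,\widetilde C_2T^c\rangle_{\mathfrak g},$$ i.e. $\langle\Omega,\Phi^c(x)\Phi^c(y)\Omega\rangle=2k\,\widetilde\Delta^4(x-y)\,\langle(1-\widetilde C_2)T^c,\widetilde C_2T^c\rangle_{\mathfrak g}$ as distributions. -/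

import Mathlib

open scoped ContDiff ComplexConjugate TensorProduct InnerProductSpace

noncomputable section

/-! ### Lie-algebraic data

Colours are elements of a real Lie algebra; in a basis `T^a` the structure constants are
`⁅T^a, T^b⁆ = f^{ab}_c T^c`, so that all metrics and Casimir operators below are real. -/

namespace CurrentAlg

/-- A real Lie algebra with negative definite Killing form. -/
def IsCompactLie (L : Type*) [LieRing L] [LieAlgebra ℝ L] : Prop :=
  ∀ X : L, X ≠ 0 → killingForm ℝ L X X < 0

/-- The values `κ(h_α, h_α)` of the Killing form on the coroots of the complexification, where
`(h_α, e_α, f_α)` is the `sl₂`-triple of a root `α` of a Cartan subalgebra. In terms of the squared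
length of the root, `κ(h_α, h_α) = 4 / κ(α, α)`. -/
def corootKillingSquares (L : Type*) [LieRing L] [LieAlgebra ℝ L] : Set ℝ :=
  {r | ∃ (C : LieSubalgebra ℂ (ℂ ⊗[ℝ] L)) (_ : C.IsCartanSubalgebra) (α : C → ℂ)
      (h e f : ℂ ⊗[ℝ] L), α ≠ 0 ∧ e ∈ LieAlgebra.rootSpace C α ∧
      f ∈ LieAlgebra.rootSpace C (-α) ∧ IsSl2Triple h e f ∧
      r = (killingForm ℂ (ℂ ⊗[ℝ] L) h h).re}

/-- The dual Coxeter number `v` of a simple Lie algebra: the Killing form is `2 v` times the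
invariant form for which long roots have squared length two. As `κ(h_α, h_α)` is smallest for long
roots `α`, and is then equal to `4 v`, this is a quarter of the minimum. -/
def dualCoxeter (L : Type*) [LieRing L] [LieAlgebra ℝ L] : ℝ :=
  sInf (corootKillingSquares L) / 4

/-- The (positive) Killing metric of a compact simple Lie algebra, normalized such that long roots
have squared length two; the Casimir operator of the adjoint representation is then `2 v`. -/
def metric (L : Type*) [LieRing L] [LieAlgebra ℝ L] (X Y : L) : ℝ :=
  -(killingForm ℝ L X Y) / (2 * dualCoxeter L)

open Classical in
/-- The Dynkin index of a map `i` from a simple Lie algebra into `𝔤`: the factor between the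
pulled back metric of `𝔤` and the metric of the simple Lie algebra. -/
def dynkinIndex {L 𝔤 : Type*} [LieRing L] [LieAlgebra ℝ L] [LieRing 𝔤] [LieAlgebra ℝ 𝔤]
    (i : L → 𝔤) : ℝ :=
  if h : ∃ I : ℝ, ∀ X Y : L, metric 𝔤 (i X) (i Y) = I * metric L X Y then h.choose else 0

/-- The inverse of the Gram matrix `B(T^a, T^b)`: the metric with lower indices. -/
def lowerMetric {V : Type*} {n : ℕ} (B : V → V → ℝ) (t : Fin n → V) : Matrix (Fin n) (Fin n) ℝ :=
  (Matrix.of fun a b => B (t a) (t b))⁻¹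

section Reductive

variable {𝔥 𝔤 : Type*} [LieRing 𝔥] [LieAlgebra ℝ 𝔥] [LieRing 𝔤] [LieAlgebra ℝ 𝔤] {A : Type*}

/-- The ideals `𝔥_α`: `some α` labels the simple ones and `none` the abelian one. -/
def part (s : A → LieIdeal ℝ 𝔥) (z : LieIdeal ℝ 𝔥) : Option A → LieIdeal ℝ 𝔥
  | none => z
  | some α => s α

/-- `𝔥` is the direct sum of the simple ideals `s α` and the abelian ideal `z` (possibly zero). -/
structure IsReductiveDecomposition (s : A → LieIdeal ℝ 𝔥) (z : LieIdeal ℝ 𝔥) : Prop where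
  simple : ∀ α, LieAlgebra.IsSimple ℝ (s α)
  abelian : IsLieAbelian z
  indep : iSupIndep fun o => (part s z o).toSubmodule
  span : ⨆ o, (part s z o).toSubmodule = ⊤

variable (ι : 𝔥 →ₗ⁅ℝ⁆ 𝔤) (s : A → LieIdeal ℝ 𝔥) (z : LieIdeal ℝ 𝔥)

/-- The metric `g^α`: normalized Killing metric on a simple ideal, restriction of the metric of
`𝔤` on the abelian ideal. -/
def partMetric : (o : Option A) → part s z o → part s z o → ℝ
  | none => fun X Y => metric 𝔤 (ι X) (ι Y)
  | some α => fun X Y => metric (s α) X Y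

/-- `I_α`: the Dynkin index on a simple ideal, one on the abelian ideal. -/
def partIndex : Option A → ℝ
  | none => 1
  | some α => dynkinIndex fun X : s α => ι X

/-- `v^α`: the dual Coxeter number of a simple ideal, zero for the abelian ideal. -/
def partCoxeter : Option A → ℝ
  | none => 0
  | some α => dualCoxeter (s α)

variable {s z} {n : Option A → ℕ} (b : ∀ o, Module.Basis (Fin (n o)) ℝ (part s z o))

/-- `T^{ι(a)}` for the `a`-th basis element of `𝔥_α`. -/
def colour (o : Option A) (a : Fin (n o)) : 𝔤 := ι (b o a)

/-- `g^α_{ab}`, the inverse of `g_α^{ab}`. -/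
def partLower (o : Option A) : Matrix (Fin (n o)) (Fin (n o)) ℝ :=
  lowerMetric (partMetric ι s z o) (b o)

/-- `C_2^α = g^α_{ab} Ad_{T^{ι(b)}} Ad_{T^{ι(a)}}` with `Ad_{T^a} T^c = i f^{ac}_d T^d`, which
gives the sign in terms of the real Lie bracket. -/
def casimir (o : Option A) (T : 𝔤) : 𝔤 :=
  -∑ a, ∑ a', partLower ι b o a a' • ⁅colour ι b o a', ⁅colour ι b o a, T⁆⁆

/-- `P_α`, the orthogonal projection of `𝔤` onto `ι(𝔥_α)`. -/
def proj (o : Option A) (T : 𝔤) : 𝔤 :=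
  ∑ a, ∑ a', (lowerMetric (metric 𝔤) (colour ι b o) a a' *
    metric 𝔤 (colour ι b o a') T) • colour ι b o a

/-- The weighted Casimir element
`∑_α (2 I_α k P_α + C_2^α) / (2 (I_α k + v^α))`. -/
def weightedCasimir [Fintype A] (k : ℕ) (T : 𝔤) : 𝔤 :=
  ∑ o : Option A, (2 * (partIndex ι s o * k + partCoxeter s o))⁻¹ •
    ((2 * partIndex ι s o * k) • proj ι b o T + casimir ι b o T)

end Reductive

/-! ### Test functions on the compactified light ray -/

/-- `f` is smooth on the light ray and behaves, for `w = 0`, like a smooth function at the point at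
infinity of the compactified light ray, and for `w = 2` like a smooth vector field there. Schwartz
functions are of this kind for every `w`. Currents are smeared with `w = 0`, fields of scaling
dimension two with `w = 2`. -/
def IsTest (w : ℕ) (f : ℝ → ℂ) : Prop :=
  ContDiff ℝ ∞ f ∧ ∃ F : ℝ → ℂ, ContDiff ℝ ∞ F ∧ ∀ x : ℝ, x ≠ 0 → F x = (x : ℂ) ^ w * f (-x⁻¹)

/-- The algebra of test functions for currents. -/
def TestFun : Subalgebra ℂ (ℝ → ℂ) where
  carrier := {f | IsTest 0 f}
  mul_mem' := by
    rintro f g ⟨hf, F, hF, hFf⟩ ⟨hg, G, hG, hGg⟩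
    refine ⟨hf.mul hg, F * G, hF.mul hG, fun x hx => ?_⟩
    simp [hFf x hx, hGg x hx]
  add_mem' := by
    rintro f g ⟨hf, F, hF, hFf⟩ ⟨hg, G, hG, hGg⟩
    refine ⟨hf.add hg, F + G, hF.add hG, fun x hx => ?_⟩
    simp [hFf x hx, hGg x hx]
  algebraMap_mem' := fun c => ⟨contDiff_const, fun _ => c, contDiff_const, fun x _ => by simp⟩

/-- Complex conjugation of test functions. -/
def TestFun.conj (f : TestFun) : TestFun :=
  ⟨fun x => starRingEnd ℂ (f.1 x), by
    obtain ⟨f, hf, F, hF, hFf⟩ := f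
    refine ⟨Complex.conjCLE.contDiff.comp hf, fun x => starRingEnd ℂ (F x),
      Complex.conjCLE.contDiff.comp hF, fun x hx => ?_⟩
    simp [hFf x hx]⟩

/-- `l₀ f = ½ (1 + x²) f'`, the action of the conformal Hamiltonian on test functions. -/
def TestFun.l₀ (f : TestFun) : TestFun :=
  ⟨fun x => (((1 + x ^ 2) / 2 : ℝ) : ℂ) * deriv f.1 x, by
    obtain ⟨f, hf, F, hF, hFf⟩ := f
    have hd : ∀ {u : ℝ → ℂ}, ContDiff ℝ ∞ u →
        ContDiff ℝ ∞ fun x : ℝ => (((1 + x ^ 2) / 2 : ℝ) : ℂ) * deriv u x := fun {u} hu =>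
      (Complex.ofRealCLM.contDiff.comp
        ((contDiff_const.add (contDiff_id.pow 2)).div_const 2)).mul (contDiff_infty_iff_deriv.1 hu).2
    refine ⟨hd hf, _, hd hF, fun x hx => ?_⟩
    have h1 : HasDerivAt (fun y : ℝ => -y⁻¹) ((x ^ 2)⁻¹) x := by
      have h := (hasDerivAt_inv hx).neg
      rw [neg_neg] at h
      exact h
    have h2 : HasDerivAt (fun y : ℝ => f (-y⁻¹)) ((x ^ 2)⁻¹ • deriv f (-x⁻¹)) x :=
      HasDerivAt.scomp x ((hf.differentiable (by simp)) _).hasDerivAt h1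
    have h3 : F =ᶠ[nhds x] fun y : ℝ => f (-y⁻¹) := by
      filter_upwards [isOpen_ne.mem_nhds hx] with y hy
      simpa using hFf y hy
    have hx' : (x : ℂ) ≠ 0 := by exact_mod_cast hx
    rw [h3.deriv_eq, h2.deriv]
    simp only [pow_zero, one_mul, Complex.real_smul]
    push_cast
    field_simp
    ring⟩

/-- The function `x ↦ ((1 + i x) / (1 - i x))ⁿ`, i.e. `e^{inθ}` with `x = tan (θ / 2)`. -/
def TestFun.mode (n : ℤ) : TestFun :=
  ⟨fun x => ((1 + Complex.I * x) / (1 - Complex.I * x)) ^ n, by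
    have hp : ∀ x : ℝ, (1 + Complex.I * x : ℂ) ≠ 0 := fun x h => by
      simpa using congrArg Complex.re h
    have hm : ∀ x : ℝ, (1 - Complex.I * x : ℂ) ≠ 0 := fun x h => by
      simpa using congrArg Complex.re h
    have hc : ContDiff ℝ ∞ fun x : ℝ => (x : ℂ) := Complex.ofRealCLM.contDiff
    have hcp : ContDiff ℝ ∞ fun x : ℝ => (1 + Complex.I * x : ℂ) :=
      contDiff_const.add (contDiff_const.mul hc)
    have hcm : ContDiff ℝ ∞ fun x : ℝ => (1 - Complex.I * x : ℂ) :=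
      contDiff_const.sub (contDiff_const.mul hc)
    have hu : ContDiff ℝ ∞ fun x : ℝ => ((1 + Complex.I * x) / (1 - Complex.I * x) : ℂ) :=
      by simp only [div_eq_mul_inv]; exact hcp.mul (hcm.inv hm)
    have hv : ContDiff ℝ ∞ fun x : ℝ => ((1 - Complex.I * x) / (1 + Complex.I * x) : ℂ) :=
      by simp only [div_eq_mul_inv]; exact hcm.mul (hcp.inv hp)
    have key : ∀ m : ℤ, ContDiff ℝ ∞ fun x : ℝ =>
        (((1 + Complex.I * x) / (1 - Complex.I * x)) ^ m : ℂ) := by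
      intro m
      obtain ⟨p, rfl | rfl⟩ := m.eq_nat_or_neg
      · simpa using hu.pow p
      · simpa [← inv_pow] using hv.pow p
    refine ⟨key n, fun x => (-1) ^ n * ((1 + Complex.I * x) / (1 - Complex.I * x)) ^ n,
      contDiff_const.mul (key n), fun x hx => ?_⟩
    have hx' : (x : ℂ) ≠ 0 := by exact_mod_cast hx
    beta_reduce
    rw [← mul_zpow, pow_zero, one_mul]
    congr 1
    have h1 := hm x
    have h2 := hm (-x⁻¹)
    push_cast at h2 ⊢
    rw [eq_div_iff h2]
    field_simp
    ring_nf
    simp only [Complex.I_sq]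
    ring⟩

/-! ### The current algebra -/

/-- The current algebra of `𝔤` at level `k` in its vacuum representation on the Hilbert space `H`:
currents are symmetric operator-valued distributions on an invariant dense domain that obey
`[j^a(x), j^b(y)] = i f^{ab}_c j^c(x) δ(x-y) + k g^{ab} (i/2π) δ'(x-y)`, together with a conformal
Hamiltonian of positive energy and a unique, cyclic vacuum. -/
structure Currents (𝔤 : Type*) [LieRing 𝔤] [LieAlgebra ℝ 𝔤] (k : ℕ) (H : Type*)
    [NormedAddCommGroup H] [InnerProductSpace ℂ H] where
  /-- The common invariant domain. -/
  D : Submodule ℂ H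
  dense : Dense (D : Set H)
  /-- The vacuum vector. -/
  Ω : D
  norm_vacuum : ‖Ω‖ = 1
  /-- The current `j^X(f)` of colour `X`, smeared with `f`. -/
  j : 𝔤 →ₗ[ℝ] TestFun →ₗ[ℂ] D →ₗ[ℂ] D
  symmetric : ∀ X f φ ψ, inner ℂ φ (j X f ψ) = inner ℂ (j X (TestFun.conj f) φ) ψ
  /-- Continuity in the topology of smooth functions on the compactified light ray. -/
  distribution : ∀ X ψ, ∃ (C : ℝ) (N : ℕ), ∀ (f : TestFun) (B : ℝ),
    (∀ m ≤ N, ∀ x : ℝ, ‖(TestFun.l₀^[m] f).1 x‖ ≤ B) → ‖j X f ψ‖ ≤ C * B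
  commutator : ∀ X Y f g ψ, j X f (j Y g ψ) - j Y g (j X f ψ) =
    Complex.I • j ⁅X, Y⁆ (f * g) ψ +
      (k * metric 𝔤 X Y * (Complex.I / (2 * Real.pi)) * ∫ x : ℝ, f.1 x * deriv g.1 x) • ψ
  /-- The conformal Hamiltonian. -/
  L₀ : D →ₗ[ℂ] D
  L₀_symmetric : ∀ φ ψ, inner ℂ φ (L₀ ψ) = inner ℂ (L₀ φ) ψ
  L₀_nonneg : ∀ ψ, 0 ≤ (inner ℂ ψ (L₀ ψ)).re
  L₀_covariant : ∀ X g ψ, L₀ (j X g ψ) - j X g (L₀ ψ) = Complex.I • j X (TestFun.l₀ g) ψ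
  vacuum_unique : ∀ ψ, L₀ ψ = 0 ↔ ∃ c : ℂ, ψ = c • Ω
  cyclic : ∀ W : Submodule ℂ D, Ω ∈ W → (∀ X f, ∀ ψ ∈ W, j X f ψ ∈ W) →
    Dense (W.map D.subtype : Set H)

namespace Currents

variable {𝔤 : Type*} [LieRing 𝔤] [LieAlgebra ℝ 𝔤] {k : ℕ} {H : Type*}
  [NormedAddCommGroup H] [InnerProductSpace ℂ H] (𝒥 : Currents 𝔤 k H)

/-- The modes `J^X_n`. -/
def J (X : 𝔤) (n : ℤ) : 𝒥.D →ₗ[ℂ] 𝒥.D := 𝒥.j X (TestFun.mode n)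

/-- The vectors of finite energy: the span of all `J^{X₁}_{n₁} ⋯ J^{X_r}_{n_r} Ω`. -/
def finiteEnergy : Submodule ℂ 𝒥.D :=
  sInf {W | 𝒥.Ω ∈ W ∧ ∀ X n, ∀ ψ ∈ W, 𝒥.J X n ψ ∈ W}

/-- The `n`-th mode of the normal ordered product `:j^X j^Y:`, with annihilation parts of `j^X` to
the right. On vectors of finite energy the sum over `m` is finite. Below only combinations
symmetric in the two colours occur. -/
def normalMode (X Y : 𝔤) (n : ℤ) (ψ : 𝒥.D) : 𝒥.D :=
  ∑ᶠ m : ℤ, if m < 0 then 𝒥.J X m (𝒥.J Y (n - m) ψ) else 𝒥.J Y (n - m) (𝒥.J X m ψ)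

/-- With `θ = 2 arctan x`, currents are `j(x) = (2π)⁻¹ θ'(x) ∑_n e^{-inθ} J_n` and their normal
ordered products `:j^X j^Y:(x) = (2π)⁻² θ'(x)² ∑_n e^{-inθ} (:j^X j^Y:)_n`. This is the coefficient
of the `n`-th mode after smearing the latter with `h`. -/
def coeff (h : ℝ → ℂ) (n : ℤ) : ℂ :=
  ((2 * Real.pi : ℝ) : ℂ)⁻¹ ^ 2 *
    ∫ x : ℝ, h x * ((2 / (1 + x ^ 2) : ℝ) : ℂ) ^ 2 * (TestFun.mode (-n)).1 x

/-- The graph of the smeared current `j^X(g)`. -/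
def currentGraph (X : 𝔤) (g : TestFun) : Set (H × H) :=
  {p | ∃ ψ : 𝒥.D, p = (↑ψ, ↑(𝒥.j X g ψ))}

/-- The graph, over the vectors of finite energy, of the field with modes `F n` that is bilinear in
the currents, smeared with `h`. -/
def fieldGraph (F : ℤ → 𝒥.D → 𝒥.D) (h : ℝ → ℂ) : Set (H × H) :=
  {p | ∃ ψ ∈ 𝒥.finiteEnergy, p.1 = ↑ψ ∧ HasSum (fun n : ℤ => coeff h n • (F n ψ : H)) p.2}

/-- Modes of the Sugawara stress-energy tensor
`Θ^𝔤 = π / (k + v) g_{ab} :j^a j^b:`. -/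
def sugawara {m : ℕ} (e : Module.Basis (Fin m) ℝ 𝔤) (n : ℤ) (ψ : 𝒥.D) : 𝒥.D :=
  (Real.pi / (k + dualCoxeter 𝔤)) • ∑ a, ∑ b, lowerMetric (metric 𝔤) e a b •
    𝒥.normalMode (e a) (e b) n ψ

section Sub

variable {𝔥 : Type*} [LieRing 𝔥] [LieAlgebra ℝ 𝔥] {A : Type*} [Fintype A] (ι : 𝔥 →ₗ⁅ℝ⁆ 𝔤)
  {s : A → LieIdeal ℝ 𝔥} {z : LieIdeal ℝ 𝔥} {d : Option A → ℕ}
  (b : ∀ o, Module.Basis (Fin (d o)) ℝ (part s z o))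

/-- Modes of
`Θ^𝔥 = ∑_α Θ^α`, `Θ^α = π / (I_α k + v^α) g^α_{ab} :j^{ι(a)} j^{ι(b)}:`. -/
def subSugawara (n : ℤ) (ψ : 𝒥.D) : 𝒥.D :=
  ∑ o : Option A, (Real.pi / (partIndex ι s o * k + partCoxeter s o)) •
    ∑ a, ∑ a', partLower ι b o a a' • 𝒥.normalMode (colour ι b o a) (colour ι b o a') n ψ

/-- Modes of the covariance field of the colour `T = T^c`,
`Φ^c = ∑_α (2 (I_α k + v^α))⁻¹ g^α_{ab} f^{ι(b)c}_d :j^{ι(a)} j^d + j^d j^{ι(a)}:`. -/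
def covarianceField (T : 𝔤) (n : ℤ) (ψ : 𝒥.D) : 𝒥.D :=
  ∑ o : Option A, (2 * (partIndex ι s o * k + partCoxeter s o))⁻¹ •
    ∑ a, ∑ a', partLower ι b o a a' •
      (𝒥.normalMode (colour ι b o a) ⁅colour ι b o a', T⁆ n ψ +
        𝒥.normalMode ⁅colour ι b o a', T⁆ (colour ι b o a) n ψ)

end Sub

end Currents

/-! ### Products of unbounded operators, and the two-point distributions -/

/-- `w = A B ψ`, where `A` and `B` are the closures of the operators with graphs `GA` and `GB`
(and `ψ` is in the domain of the product). -/
def IsProduct {H : Type*} [TopologicalSpace H] (GA GB : Set (H × H)) (ψ w : H) : Prop :=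
  ∃ v, (ψ, v) ∈ closure GB ∧ (v, w) ∈ closure GA

/-- `w = [A, B] ψ`, in the same sense. -/
def IsCommutator {H : Type*} [TopologicalSpace H] [Sub H] (GA GB : Set (H × H)) (ψ w : H) : Prop :=
  ∃ w₁ w₂, IsProduct GA GB ψ w₁ ∧ IsProduct GB GA ψ w₂ ∧ w = w₁ - w₂

/-- `c` is the value of the distribution
`(2π)⁻ⁿ ∫∫ dx dy (i [(x - y) - iε])⁻ⁿ u(x) v(y)`, `ε ↓ 0`. -/
def IsDelta (n : ℕ) (u v : ℝ → ℂ) (c : ℂ) : Prop :=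
  Filter.Tendsto (fun ε : ℝ => ((2 * Real.pi : ℝ) : ℂ)⁻¹ ^ n *
      ∫ x : ℝ, ∫ y : ℝ, (Complex.I * (((x - y : ℝ) : ℂ) - Complex.I * ε))⁻¹ ^ n * u x * v y)
    (nhdsWithin 0 (Set.Ioi 0)) (nhds c)

end CurrentAlg

end

/-! The theorem reduces to the commutation relations of the modes `J^X_n`, supplemented by estimates
that make all series of modes converge.

Algebra. Orthonormal bases of the ideals, mapped into `𝔤`, give frames `u_a` of squared length
`I_α`; every contraction with an inverse metric becomes a sum over `u_a ⊗ u_a`, and different ideals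
are orthogonal and commute. With `w = 1 / (2 (I k + v))` one has `Θ^𝔥 = 2π L`, where `L = ∑ w :j^u
j^u:`. Commuting a current through `L` (`normalMode_comm`, `frameSugawara_comm`) gives `[L_n, J^T_m]
= i Φ^T_{n+m} - m J^{CT}_{n+m}`. The brackets assemble to the covariance field `Φ`; the central
terms, together with the reordering caused by a shift of the mode number, assemble to the weighted
Casimir operator `C`. For `𝔤` itself the same formula holds with `C = 1` and `Φ = 0`. On the vacuum
the coset commutator is therefore `2π (-m J^{(1-C)T}_{n+m} - i Φ^T_{n+m}) Ω`.

Two-point functions. The two summands are orthogonal, because `⟨[S,X],Y⟩` is antisymmetric in `X`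
and `Y` while `Φ` is a symmetrized product. The current part has norm square `k p ⟨S,S⟩`. No
four-point function is needed for `Φ`: the commutator formula expresses `Φ^T_{-p} Ω` through `L_0
J^T_{-p} Ω` and a current; the frame vectors satisfy `C u = u` and `Φ^u = 0`, so `J^u_m` obeys a
simple commutation relation with `L_0`, and `J^u_m Φ^T_{-p} Ω = i Φ^{[u,T]}_{m-p} Ω + m
J^{[u,(1-C)T]}_{m-p} Ω` (`J_frameField_vacuum`). Pairing this with the remaining current leaves a
sum of `-m (p + m)`, which is `binom(p+1, 3)`, times `∑ w ⟨[u,(1-C)T],[u,T]⟩`. The last sum is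
`⟨(1-C)T, CT⟩`, since `(1-C)T` is orthogonal to all frame vectors (`metric_casimir`). The Cayley
transform turns the kernels `(i(x-y-iε))^{-n}` into power series whose binomial coefficients match
these norms (`isDelta_fc`).

Analysis. Vacuum expectation values of words in the modes grow at most polynomially in the mode
numbers (`vev_bound`), and this survives the formation of normal products (`Tame.normal`). Fourier
coefficients of test functions decay rapidly, so the double series for products on the vacuum
converge absolutely. Symmetry on dense domains makes all the operators closable, hence these series
are the only possible values of the products. -/

noncomputable section

namespace CurrentAlg

open MeasureTheory Filter Topology

/-! ### Fourier analysis on the compactified light ray -/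

/-- The derivative of `θ = 2 arctan x`. -/
def angDensity (x : ℝ) : ℝ := 2 / (1 + x ^ 2)

lemma angDensity_pos (x : ℝ) : 0 < angDensity x := by
  unfold angDensity; positivity

lemma angDensity_eq (x : ℝ) : angDensity x = 2 * (1 + x ^ 2)⁻¹ := by
  rw [angDensity, div_eq_mul_inv]

lemma integrable_angDensity : Integrable angDensity := by
  have h := integrable_inv_one_add_sq.const_mul 2
  exact h.congr (Eventually.of_forall fun x => (angDensity_eq x).symm)

lemma integral_angDensity : ∫ x, angDensity x = 2 * Real.pi := by
  simp_rw [angDensity_eq]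
  rw [integral_const_mul, integral_univ_inv_one_add_sq]

lemma continuous_angDensity : Continuous angDensity := by
  unfold angDensity
  refine continuous_const.div (by fun_prop) fun x => by positivity

lemma one_add_I_mul_ne (x : ℝ) : (1 + Complex.I * x : ℂ) ≠ 0 := fun h => by
  simpa using congrArg Complex.re h

lemma one_sub_I_mul_ne (x : ℝ) : (1 - Complex.I * x : ℂ) ≠ 0 := fun h => by
  simpa using congrArg Complex.re h

namespace TestFun

lemma mode_apply (n : ℤ) (x : ℝ) :
    (mode n).1 x = ((1 + Complex.I * x) / (1 - Complex.I * x)) ^ n := rfl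

lemma cayley_ne (x : ℝ) : ((1 + Complex.I * x) / (1 - Complex.I * x) : ℂ) ≠ 0 :=
  div_ne_zero (one_add_I_mul_ne x) (one_sub_I_mul_ne x)

lemma norm_cayley (x : ℝ) : ‖((1 + Complex.I * x) / (1 - Complex.I * x) : ℂ)‖ = 1 := by
  have h : (1 - Complex.I * x : ℂ) = conj (1 + Complex.I * x : ℂ) := by simp [sub_eq_add_neg]
  rw [norm_div, h, Complex.norm_conj, div_self]
  exact norm_ne_zero_iff.2 (one_add_I_mul_ne x)

lemma norm_mode (n : ℤ) (x : ℝ) : ‖(mode n).1 x‖ = 1 := by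
  rw [mode_apply, norm_zpow, norm_cayley, one_zpow]

lemma mode_zero : mode 0 = 1 := by
  ext x; simp [mode_apply]

lemma mode_mul (m n : ℤ) : mode m * mode n = mode (m + n) := by
  ext x
  change (mode m).1 x * (mode n).1 x = (mode (m + n)).1 x
  rw [mode_apply, mode_apply, mode_apply, zpow_add₀ (cayley_ne x)]

lemma mode_mul_apply (m n : ℤ) (x : ℝ) :
    (mode m).1 x * (mode n).1 x = (mode (m + n)).1 x := by
  rw [← mode_mul]; rfl

lemma conj_cayley (x : ℝ) : conj ((1 + Complex.I * x) / (1 - Complex.I * x) : ℂ) =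
    ((1 + Complex.I * x) / (1 - Complex.I * x) : ℂ)⁻¹ := by
  simp [sub_eq_add_neg]

lemma conj_mode_apply (n : ℤ) (x : ℝ) : conj ((mode n).1 x) = (mode (-n)).1 x := by
  rw [mode_apply, mode_apply, map_zpow₀, conj_cayley, inv_zpow']

lemma conj_mode (n : ℤ) : TestFun.conj (mode n) = mode (-n) := by
  ext x; exact conj_mode_apply n x

lemma contDiff (f : TestFun) : ContDiff ℝ ∞ f.1 := f.2.1

lemma continuous (f : TestFun) : Continuous f.1 := (contDiff f).continuous

lemma differentiable (f : TestFun) : Differentiable ℝ f.1 := (contDiff f).differentiable (by simp)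

/-- The value of a test function at the point at infinity is its limit in both directions. -/
lemma exists_limit (f : TestFun) : ∃ c : ℂ, Tendsto f.1 atTop (𝓝 c) ∧ Tendsto f.1 atBot (𝓝 c) := by
  obtain ⟨f, hf, F, hF, hFf⟩ := f
  have key : ∀ y : ℝ, y ≠ 0 → f y = F (-y⁻¹) := fun y hy => by
    have := hFf (-y⁻¹) (by simpa using hy)
    simpa using this.symm
  have hc : Tendsto F (𝓝 0) (𝓝 (F 0)) := hF.continuous.tendsto 0
  refine ⟨F 0, ?_, ?_⟩
  · have h1 : Tendsto (fun y : ℝ => -y⁻¹) atTop (𝓝 0) := by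
      simpa using (tendsto_inv_atTop_zero (𝕜 := ℝ)).neg
    refine (hc.comp h1).congr' ?_
    filter_upwards [eventually_ne_atTop 0] with y hy
    exact (key y hy).symm
  · have h1 : Tendsto (fun y : ℝ => -y⁻¹) atBot (𝓝 0) := by
      simpa using (tendsto_inv_atBot_zero (𝕜 := ℝ)).neg
    refine (hc.comp h1).congr' ?_
    filter_upwards [eventually_ne_atBot 0] with y hy
    exact (key y hy).symm

lemma exists_bound (f : TestFun) : ∃ B : ℝ, 0 ≤ B ∧ ∀ x, ‖f.1 x‖ ≤ B := by
  obtain ⟨f, hf, F, hF, hFf⟩ := f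
  obtain ⟨B₁, h₁⟩ := (isCompact_Icc (a := (-1 : ℝ)) (b := 1)).exists_bound_of_continuousOn
    hf.continuous.continuousOn
  obtain ⟨B₂, h₂⟩ := (isCompact_Icc (a := (-1 : ℝ)) (b := 1)).exists_bound_of_continuousOn
    hF.continuous.continuousOn
  refine ⟨max B₁ B₂, ((norm_nonneg _).trans (h₁ 0 (by simp))).trans (le_max_left _ _), fun x => ?_⟩
  by_cases hx : |x| ≤ 1
  · exact (h₁ x (by rwa [Set.mem_Icc, ← abs_le])).trans (le_max_left _ _)
  · push Not at hx
    have hx0 : x ≠ 0 := by rintro rfl; simp at hx; linarith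
    have := hFf (-x⁻¹) (by simpa using hx0)
    simp only [inv_neg, inv_inv, neg_neg, pow_zero, one_mul] at this
    change ‖f x‖ ≤ _
    rw [← this]
    refine (h₂ _ ?_).trans (le_max_right _ _)
    rw [Set.mem_Icc, ← abs_le, abs_neg, abs_inv]
    exact inv_le_one_of_one_le₀ hx.le

lemma l₀_apply (f : TestFun) (x : ℝ) :
    (l₀ f).1 x = (((1 + x ^ 2) / 2 : ℝ) : ℂ) * deriv f.1 x := rfl

lemma angDensity_mul_l₀ (f : TestFun) (x : ℝ) :
    (angDensity x : ℂ) * (l₀ f).1 x = deriv f.1 x := by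
  have h : (1 + (x : ℂ) ^ 2) ≠ 0 := by
    have : (1 + x ^ 2 : ℝ) ≠ 0 := by positivity
    exact_mod_cast this
  rw [l₀_apply, angDensity]
  push_cast
  field_simp

lemma l₀_add (f g : TestFun) : l₀ (f + g) = l₀ f + l₀ g := by
  ext x
  change (l₀ (f + g)).1 x = (l₀ f).1 x + (l₀ g).1 x
  rw [l₀_apply, l₀_apply, l₀_apply]
  have : deriv (f + g).1 x = deriv f.1 x + deriv g.1 x :=
    deriv_add (differentiable f x) (differentiable g x)
  rw [this]; ring

lemma l₀_smul (c : ℂ) (f : TestFun) : l₀ (c • f) = c • l₀ f := by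
  ext x
  change (l₀ (c • f)).1 x = c * (l₀ f).1 x
  rw [l₀_apply, l₀_apply]
  have : deriv (c • f).1 x = c * deriv f.1 x := deriv_const_mul c (differentiable f x)
  rw [this]; ring

/-- `l₀` as a linear map. -/
def l₀Lin : TestFun →ₗ[ℂ] TestFun where
  toFun := l₀
  map_add' := l₀_add
  map_smul' := l₀_smul

lemma l₀_mul (f g : TestFun) : l₀ (f * g) = l₀ f * g + f * l₀ g := by
  ext x
  change (l₀ (f * g)).1 x = (l₀ f).1 x * g.1 x + f.1 x * (l₀ g).1 x
  rw [l₀_apply, l₀_apply, l₀_apply]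
  have : deriv (f * g).1 x = deriv f.1 x * g.1 x + f.1 x * deriv g.1 x :=
    deriv_mul (differentiable f x) (differentiable g x)
  rw [this]; ring

lemma deriv_mode (n : ℤ) (x : ℝ) :
    deriv (mode n).1 x = Complex.I * n * angDensity x * (mode n).1 x := by
  have hp := one_add_I_mul_ne x
  have hm := one_sub_I_mul_ne x
  have h1 : HasDerivAt (fun x : ℝ => (1 + Complex.I * x : ℂ)) Complex.I x := by
    simpa using ((Complex.ofRealCLM.hasDerivAt (x := x)).const_mul Complex.I).const_add 1
  have h2 : HasDerivAt (fun x : ℝ => (1 - Complex.I * x : ℂ)) (-Complex.I) x := by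
    simpa using ((Complex.ofRealCLM.hasDerivAt (x := x)).const_mul Complex.I).const_sub 1
  have h3 := h1.div h2 hm
  have h4 := (hasDerivAt_zpow n _ (Or.inl (cayley_ne x))).comp x h3
  have h5 : deriv (mode n).1 x = _ := h4.deriv
  rw [h5, mode_apply, zpow_sub_one₀ (cayley_ne x), angDensity]
  have hx : (1 + (x : ℂ) ^ 2) = (1 + Complex.I * x) * (1 - Complex.I * x) := by
    ring_nf; simp
  push_cast
  rw [hx]
  field_simp
  ring

lemma l₀_mode (n : ℤ) : l₀ (mode n) = (Complex.I * n) • mode n := by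
  ext x
  have h : (angDensity x : ℂ) ≠ 0 := by exact_mod_cast (angDensity_pos x).ne'
  apply mul_left_cancel₀ h
  rw [angDensity_mul_l₀, deriv_mode]
  change _ = (angDensity x : ℂ) * (Complex.I * n * (mode n).1 x)
  ring

lemma integrable_mul_angDensity (f : TestFun) :
    Integrable fun x => f.1 x * (angDensity x : ℂ) := by
  obtain ⟨B, -, hB⟩ := exists_bound f
  exact (integrable_angDensity.ofReal (𝕜 := ℂ)).bdd_mul (continuous f).aestronglyMeasurable
    (Eventually.of_forall hB)

/-- As `θ' l₀ f = f'`, this is the fundamental theorem of calculus on the line; the boundary terms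
cancel because `f` has the same limit at both ends. -/
lemma integral_l₀ (f : TestFun) : ∫ x, (l₀ f).1 x * (angDensity x : ℂ) = 0 := by
  obtain ⟨c, ht, hb⟩ := exists_limit f
  have hi := integrable_mul_angDensity (l₀ f)
  have he : (fun x => (l₀ f).1 x * (angDensity x : ℂ)) = deriv f.1 := by
    funext x; rw [mul_comm, angDensity_mul_l₀]
  rw [he] at hi ⊢
  rw [integral_of_hasDerivAt_of_tendsto (fun x => (differentiable f x).hasDerivAt) hi hb ht,
    sub_self]

end TestFun

open TestFun

/-- The Fourier coefficients with respect to the angle `θ = 2 arctan x`. -/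
def fc (f : ℝ → ℂ) (n : ℤ) : ℂ :=
  ((2 * Real.pi : ℝ) : ℂ)⁻¹ * ∫ x : ℝ, f x * (angDensity x : ℂ) * (mode (-n)).1 x

lemma fc_eq_mul (f : TestFun) (n : ℤ) : fc f.1 n =
    ((2 * Real.pi : ℝ) : ℂ)⁻¹ * ∫ x : ℝ, (f * mode (-n)).1 x * (angDensity x : ℂ) := by
  rw [fc]; congr 2; funext x
  change f.1 x * _ * (mode (-n)).1 x = f.1 x * (mode (-n)).1 x * _
  ring

/-- Integration by parts: `integral_l₀` applied to `f * mode (-n)`, with `l₀` a derivation that has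
the modes as eigenvectors. -/
lemma fc_l₀ (f : TestFun) (n : ℤ) : fc (l₀ f).1 n = Complex.I * n * fc f.1 n := by
  have h := integral_l₀ (f * mode (-n))
  rw [l₀_mul, l₀_mode] at h
  have h2 : ∀ x, (l₀ f * mode (-n) + f * (Complex.I * ((-n : ℤ) : ℂ)) • mode (-n)).1 x *
      (angDensity x : ℂ) = (l₀ f * mode (-n)).1 x * (angDensity x : ℂ) -
        Complex.I * n * ((f * mode (-n)).1 x * (angDensity x : ℂ)) := fun x => by
    change ((l₀ f).1 x * (mode (-n)).1 x + f.1 x * ((Complex.I * ((-n : ℤ) : ℂ)) *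
      (mode (-n)).1 x)) * _ = (l₀ f).1 x * (mode (-n)).1 x * _ - _ * (f.1 x * (mode (-n)).1 x * _)
    push_cast; ring
  simp_rw [h2] at h
  rw [integral_sub (integrable_mul_angDensity _) ((integrable_mul_angDensity _).const_mul _),
    integral_const_mul, sub_eq_zero] at h
  rw [fc_eq_mul, fc_eq_mul, h]; ring

lemma fc_iterate_l₀ (f : TestFun) (n : ℤ) (r : ℕ) :
    fc (l₀^[r] f).1 n = (Complex.I * n) ^ r * fc f.1 n := by
  induction r with
  | zero => simp
  | succ r ih => rw [Function.iterate_succ_apply', fc_l₀, ih, pow_succ]; ring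

lemma integral_mode (n : ℤ) : ∫ x, (mode n).1 x * (angDensity x : ℂ) =
    if n = 0 then ((2 * Real.pi : ℝ) : ℂ) else 0 := by
  split_ifs with h
  · subst h
    rw [mode_zero]
    have : ∀ x, (1 : TestFun).1 x * (angDensity x : ℂ) = (angDensity x : ℂ) := fun x => one_mul _
    simp_rw [this]
    rw [integral_complex_ofReal, integral_angDensity]
  · have h2 := integral_l₀ (mode n)
    rw [l₀_mode] at h2
    have : ∀ x, ((Complex.I * n) • mode n).1 x * (angDensity x : ℂ) =
        Complex.I * n * ((mode n).1 x * (angDensity x : ℂ)) := fun x => by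
      change Complex.I * n * (mode n).1 x * _ = _
      ring
    simp_rw [this] at h2
    rw [integral_const_mul] at h2
    simpa [h] using h2

lemma norm_fc_le (f : TestFun) {B : ℝ} (hB : ∀ x, ‖f.1 x‖ ≤ B) (n : ℤ) : ‖fc f.1 n‖ ≤ B := by
  have hpi : 0 < 2 * Real.pi := by positivity
  have h : ‖∫ x : ℝ, f.1 x * (angDensity x : ℂ) * (mode (-n)).1 x‖ ≤ ∫ x, B * angDensity x := by
    refine norm_integral_le_of_norm_le (integrable_angDensity.const_mul B)
      (Eventually.of_forall fun x => ?_)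
    rw [norm_mul, norm_mode, mul_one, norm_mul, Complex.norm_real, Real.norm_eq_abs,
      abs_of_pos (angDensity_pos x)]
    exact mul_le_mul_of_nonneg_right (hB x) (angDensity_pos x).le
  rw [integral_const_mul, integral_angDensity] at h
  rw [fc, norm_mul, norm_inv, Complex.norm_real, Real.norm_eq_abs, abs_of_pos hpi,
    inv_mul_le_iff₀ hpi]
  linarith

/-- Fourier coefficients of test functions decay rapidly. -/
lemma fc_decay (f : TestFun) (N : ℕ) : ∃ C : ℝ, 0 ≤ C ∧ ∀ n : ℤ,
    ‖fc f.1 n‖ * (1 + |(n : ℝ)|) ^ N ≤ C := by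
  obtain ⟨B₀, hB₀, h₀⟩ := exists_bound f
  obtain ⟨B₁, hB₁, h₁⟩ := exists_bound (l₀^[N] f)
  -- `B₀` bounds the coefficient itself and `B₁` its product with `|n|^N`, which is a coefficient of
  -- `l₀^[N] f`; the factor comes from `(1 + x)^N ≤ 2^N (1 + x^N)`.
  refine ⟨2 ^ N * (B₀ + B₁), by positivity, fun n => ?_⟩
  have e0 := norm_fc_le f h₀ n
  have e1 := norm_fc_le _ h₁ n
  rw [fc_iterate_l₀, norm_mul, norm_pow, norm_mul, Complex.norm_I, one_mul,
    Complex.norm_intCast] at e1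
  have h3 : (1 + |(n : ℝ)|) ^ N ≤ 2 ^ N * (1 + |(n : ℝ)| ^ N) := by
    rcases le_total 1 |(n : ℝ)| with h | h
    · calc (1 + |(n : ℝ)|) ^ N ≤ (2 * |(n : ℝ)|) ^ N := by gcongr; linarith
        _ = 2 ^ N * |(n : ℝ)| ^ N := mul_pow _ _ _
        _ ≤ _ := by gcongr; linarith
    · calc (1 + |(n : ℝ)|) ^ N ≤ 2 ^ N := by gcongr; linarith
        _ ≤ _ := le_mul_of_one_le_right (by positivity) (by
          have : 0 ≤ |(n : ℝ)| ^ N := by positivity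
          linarith)
  calc ‖fc f.1 n‖ * (1 + |(n : ℝ)|) ^ N ≤ ‖fc f.1 n‖ * (2 ^ N * (1 + |(n : ℝ)| ^ N)) := by gcongr
    _ = 2 ^ N * (‖fc f.1 n‖ + |(n : ℝ)| ^ N * ‖fc f.1 n‖) := by ring
    _ ≤ _ := by gcongr

lemma summable_one_add_abs_sq : Summable fun n : ℤ => ((1 + |(n : ℝ)|) ^ 2)⁻¹ := by
  refine Summable.of_nonneg_of_le (fun n => by positivity) (fun n => ?_)
    ((summable_of_ne_finset_zero (f := fun n : ℤ => if n = 0 then (1 : ℝ) else 0) (s := {0})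
      (by intro b hb; simp at hb; simp [hb])).add
      (Real.summable_one_div_int_pow.2 (by norm_num : 1 < 2)))
  by_cases h : n = 0
  · simp [h]
  · have : (0 : ℝ) < |(n : ℝ)| := by positivity
    simp only [h, if_false, zero_add, one_div]
    rw [← sq_abs (n : ℝ)]
    exact inv_anti₀ (by positivity) (by gcongr; linarith)

/-- Rapid decay with two spare powers reduces the series to the sum of `(1 + |n|)^{-2}`. -/
lemma summable_of_poly {E : Type*} [NormedAddCommGroup E] [CompleteSpace E] (f : TestFun)
    (N : ℕ) (C : ℝ) (a : ℤ → E) (ha : ∀ n, ‖a n‖ ≤ ‖fc f.1 n‖ * (C * (1 + |(n : ℝ)|) ^ N)) :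
    Summable a := by
  obtain ⟨B, hB, h⟩ := fc_decay f (N + 2)
  refine Summable.of_norm_bounded (g := fun n : ℤ => |C| * B * ((1 + |(n : ℝ)|) ^ 2)⁻¹)
    (summable_one_add_abs_sq.mul_left _) fun n => (ha n).trans ?_
  have h1 : 0 < (1 + |(n : ℝ)|) ^ 2 := by positivity
  have h2 := h n
  rw [← div_eq_mul_inv, le_div_iff₀ h1]
  calc ‖fc f.1 n‖ * (C * (1 + |(n : ℝ)|) ^ N) * (1 + |(n : ℝ)|) ^ 2
      ≤ ‖fc f.1 n‖ * (|C| * (1 + |(n : ℝ)|) ^ N) * (1 + |(n : ℝ)|) ^ 2 := by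
        gcongr; exact le_abs_self C
    _ = |C| * (‖fc f.1 n‖ * (1 + |(n : ℝ)|) ^ (N + 2)) := by ring
    _ ≤ |C| * B := by gcongr

lemma summable_fc_poly (f : TestFun) (N : ℕ) :
    Summable fun n : ℤ => ‖fc f.1 n‖ * (1 + |(n : ℝ)|) ^ N :=
  summable_of_poly f N 1 _ fun n => by
    rw [one_mul, norm_mul, norm_norm, norm_pow, Real.norm_eq_abs,
      abs_of_nonneg (by positivity : 0 ≤ 1 + |(n : ℝ)|)]

lemma summable_fc (f : TestFun) : Summable fun n : ℤ => ‖fc f.1 n‖ := by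
  simpa using summable_fc_poly f 0

end CurrentAlg
end

noncomputable section

namespace CurrentAlg

open MeasureTheory Filter Topology TestFun

/-! ### Pointwise convergence of Fourier series, convolution, and vector fields as functions -/

lemma mode_eq_exp (n : ℤ) (x : ℝ) :
    (mode n).1 x = Complex.exp (Complex.I * n * ((2 * Real.arctan x : ℝ) : ℂ)) := by
  obtain ⟨φ, hφ⟩ : ∃ φ, φ = Real.arctan x := ⟨_, rfl⟩
  have hc : Real.cos φ ≠ 0 := hφ ▸ (Real.cos_arctan_pos x).ne'
  have hx : Real.cos φ * x = Real.sin φ := by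
    have : x = Real.tan φ := by rw [hφ, Real.tan_arctan]
    rw [this, Real.tan_eq_sin_div_cos]
    field_simp
  have hc' : (Real.cos φ : ℂ) ≠ 0 := by exact_mod_cast hc
  have hx' : (Real.cos φ : ℂ) * x = Real.sin φ := by exact_mod_cast hx
  have e1 : Complex.exp (Complex.I * φ) = Real.cos φ * (1 + Complex.I * x) := by
    rw [mul_comm, Complex.exp_mul_I, ← Complex.ofReal_cos, ← Complex.ofReal_sin, ← hx']
    ring
  have e2 : Complex.exp (-(Complex.I * φ)) = Real.cos φ * (1 - Complex.I * x) := by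
    have : -(Complex.I * φ) = conj (Complex.I * φ : ℂ) := by simp
    rw [this, Complex.exp_conj, e1, map_mul, Complex.conj_ofReal]
    simp [sub_eq_add_neg]
  have h1 : (1 + Complex.I * x) / (1 - Complex.I * x) =
      Complex.exp (Complex.I * ((2 * φ : ℝ) : ℂ)) := by
    have e3 : Complex.exp (Complex.I * ((2 * φ : ℝ) : ℂ)) =
        Complex.exp (Complex.I * φ) / Complex.exp (-(Complex.I * φ)) := by
      rw [← Complex.exp_sub]; congr 1; push_cast; ring
    rw [e3, e1, e2, mul_div_mul_left _ _ hc']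
  rw [← hφ, mode_apply, h1, ← Complex.exp_int_mul]
  congr 1; ring

/-- A function on the compactified light ray as a function of the angle. -/
def angFun (f F : ℝ → ℂ) (θ : ℝ) : ℂ :=
  open Classical in if Real.cos (θ / 2) = 0 then F 0 else f (Real.tan (θ / 2))

/-- Near the point at infinity, `f (tan (θ/2)) = F (-cot (θ/2))`, and the right-hand side extends
continuously to `cos (θ/2) = 0`. -/
lemma continuous_angFun {f F : ℝ → ℂ} (hf : Continuous f) (hF : Continuous F)
    (h : ∀ x : ℝ, x ≠ 0 → F x = f (-x⁻¹)) : Continuous (angFun f F) := by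
  refine continuous_iff_continuousAt.2 fun θ => ?_
  by_cases hc : Real.cos (θ / 2) = 0
  · have hs : Real.sin (θ / 2) ≠ 0 := fun hs => by
      have := Real.sin_sq_add_cos_sq (θ / 2)
      simp [hc, hs] at this
    have hev : ∀ᶠ y in 𝓝 θ, Real.sin (y / 2) ≠ 0 :=
      ContinuousAt.eventually_ne (g := fun y => Real.sin (y / 2)) (by fun_prop) hs
    have h1 : ContinuousAt (fun y => F (-(Real.cos (y / 2) / Real.sin (y / 2)))) θ := by
      refine ContinuousAt.comp (g := F) (f := fun y => -(Real.cos (y / 2) / Real.sin (y / 2)))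
        hF.continuousAt ?_
      exact (ContinuousAt.div (f := fun y => Real.cos (y / 2)) (g := fun y => Real.sin (y / 2))
        (by fun_prop) (by fun_prop) hs).neg
    refine h1.congr ?_
    filter_upwards [hev] with y hy
    unfold angFun
    split_ifs with h0
    · simp [h0]
    · rw [h _ (by simp [h0, hy])]
      congr 1
      rw [Real.tan_eq_sin_div_cos]
      field_simp
  · have hev : ∀ᶠ y in 𝓝 θ, Real.cos (y / 2) ≠ 0 :=
      ContinuousAt.eventually_ne (g := fun y => Real.cos (y / 2)) (by fun_prop) hc
    have h1 : ContinuousAt (fun y => f (Real.tan (y / 2))) θ := by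
      refine ContinuousAt.comp (g := f) hf.continuousAt ?_
      exact ContinuousAt.comp (g := Real.tan) (Real.continuousAt_tan.2 hc)
        (continuousAt_id.div_const 2)
    refine h1.congr ?_
    filter_upwards [hev] with y hy
    rw [angFun, if_neg hy]

lemma angFun_two_arctan (f F : ℝ → ℂ) (x : ℝ) : angFun f F (2 * Real.arctan x) = f x := by
  rw [angFun, mul_div_cancel_left₀ _ (two_ne_zero), if_neg (Real.cos_arctan_pos x).ne',
    Real.tan_arctan]

lemma image_two_arctan :
    (fun x : ℝ => 2 * Real.arctan x) '' Set.univ = Set.Ioo (-Real.pi) Real.pi := by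
  ext θ
  constructor
  · rintro ⟨x, -, rfl⟩
    have h1 := Real.neg_pi_div_two_lt_arctan x
    have h2 := Real.arctan_lt_pi_div_two x
    constructor <;> simp only <;> linarith
  · rintro ⟨h1, h2⟩
    refine ⟨Real.tan (θ / 2), trivial, ?_⟩
    simp only
    rw [Real.arctan_tan (by linarith) (by linarith)]
    ring

lemma hasDerivAt_two_arctan (x : ℝ) :
    HasDerivAt (fun x : ℝ => 2 * Real.arctan x) (angDensity x) x := by
  have h := (Real.hasDerivAt_arctan x).const_mul 2
  rwa [← mul_div_assoc, mul_one] at h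

lemma integral_two_arctan (g : ℝ → ℂ) :
    ∫ θ in -Real.pi..Real.pi, g θ = ∫ x, g (2 * Real.arctan x) * (angDensity x : ℂ) := by
  have hpi := Real.pi_pos
  have h := integral_image_eq_integral_abs_deriv_smul (f := fun x : ℝ => 2 * Real.arctan x)
    (f' := angDensity) (s := Set.univ) MeasurableSet.univ
    (fun x _ => (hasDerivAt_two_arctan x).hasDerivWithinAt)
    (fun x _ y _ hxy => Real.arctan_injective (by simpa using hxy)) g
  rw [image_two_arctan, setIntegral_univ] at h
  rw [intervalIntegral.integral_of_le (by linarith), integral_Ioc_eq_integral_Ioo, h]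
  congr 1; funext x
  rw [abs_of_pos (angDensity_pos x), Complex.real_smul, mul_comm]

instance : Fact (0 < 2 * Real.pi) := ⟨by positivity⟩

/-- The Fourier series of a test function converges. -/
lemma hasSum_fc (f : TestFun) (x : ℝ) : HasSum (fun n : ℤ => fc f.1 n * (mode n).1 x) (f.1 x) := by
  have hpi := Real.pi_pos
  obtain ⟨F, hF, hFf⟩ := f.2.2
  simp only [pow_zero, one_mul] at hFf
  have hc := continuous_angFun (continuous f) hF.continuous hFf
  -- Both endpoints represent the point at infinity, where `angFun` has the value `F 0`.
  have hper : angFun f.1 F (-Real.pi) = angFun f.1 F (-Real.pi + 2 * Real.pi) := by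
    have h1 : Real.cos (-Real.pi / 2) = 0 := by rw [neg_div, Real.cos_neg, Real.cos_pi_div_two]
    have h2 : Real.cos ((-Real.pi + 2 * Real.pi) / 2) = 0 := by
      rw [show (-Real.pi + 2 * Real.pi) / 2 = Real.pi / 2 by ring, Real.cos_pi_div_two]
    rw [angFun, angFun, if_pos h1, if_pos h2]
  let G : C(AddCircle (2 * Real.pi), ℂ) :=
    ⟨AddCircle.liftIco (2 * Real.pi) (-Real.pi) (angFun f.1 F),
      AddCircle.liftIco_continuous hper hc.continuousOn⟩
  have hG : ∀ n, fourierCoeff G n = fc f.1 n := fun n => by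
    change fourierCoeff (AddCircle.liftIco (2 * Real.pi) (-Real.pi) (angFun f.1 F)) n = _
    rw [fourierCoeff_liftIco_eq, fourierCoeffOn_eq_integral]
    have e : -Real.pi + 2 * Real.pi = Real.pi := by ring
    rw [fc]
    simp only [fourier_coe_apply, e]
    rw [integral_two_arctan, Complex.real_smul]
    congr 1
    · push_cast; ring
    · congr 1; funext y
      rw [angFun_two_arctan, mode_eq_exp, smul_eq_mul, mul_assoc, mul_comm]
      congr 1
      rw [show (Real.pi - -Real.pi : ℝ) = 2 * Real.pi by ring]
      have : (Real.pi : ℂ) ≠ 0 := by exact_mod_cast hpi.ne'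
      congr 1
      push_cast
      field_simp
  have hs : Summable (fourierCoeff G) := by
    rw [show fourierCoeff G = fun n => fc f.1 n from funext hG]
    exact (summable_fc f).of_norm
  have h := has_pointwise_sum_fourier_series_of_summable hs
    ((2 * Real.arctan x : ℝ) : AddCircle (2 * Real.pi))
  have h1 := Real.neg_pi_div_two_lt_arctan x
  have h2 := Real.arctan_lt_pi_div_two x
  have hv : G ((2 * Real.arctan x : ℝ) : AddCircle (2 * Real.pi)) = f.1 x := by
    change AddCircle.liftIco (2 * Real.pi) (-Real.pi) (angFun f.1 F) _ = _
    rw [AddCircle.liftIco_coe_apply ⟨by linarith, by linarith⟩, angFun_two_arctan]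
  rw [hv] at h
  refine h.congr_fun ?_
  intro n
  rw [hG, smul_eq_mul, fourier_coe_apply, mode_eq_exp]
  have : (Real.pi : ℂ) ≠ 0 := by exact_mod_cast hpi.ne'
  congr 2
  push_cast
  field_simp

lemma fc_mul_mode (f : TestFun) (m n : ℤ) : fc (mode m * f).1 n = fc f.1 (n - m) := by
  rw [fc_eq_mul, fc_eq_mul, mul_comm (mode m), mul_assoc, mode_mul]
  congr 6; ring_nf

/-- Fourier coefficients of a product are convolutions. -/
lemma hasSum_fc_mul (f g : TestFun) (p : ℤ) :
    HasSum (fun n : ℤ => fc f.1 n * fc g.1 (p - n)) (fc (f * g).1 p) := by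
  obtain ⟨B, hB0, hB⟩ := exists_bound (g * mode (-p))
  let a : ℤ → ℝ → ℂ := fun n x => fc f.1 n * ((mode n * (g * mode (-p))).1 x * (angDensity x : ℂ))
  have hint : ∀ n, Integrable (a n) := fun n => (integrable_mul_angDensity _).const_mul _
  have hle : ∀ n, ∫ x, ‖a n x‖ ≤ ‖fc f.1 n‖ * (B * (2 * Real.pi)) := fun n => by
    rw [← integral_angDensity, ← integral_const_mul, ← integral_const_mul]
    refine integral_mono (hint n).norm ((integrable_angDensity.const_mul _).const_mul _) fun x => ?_
    have : ‖(mode n * (g * mode (-p))).1 x‖ ≤ B := by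
      change ‖(mode n).1 x * (g * mode (-p)).1 x‖ ≤ B
      rw [norm_mul, norm_mode, one_mul]; exact hB x
    simp only [a, norm_mul, Complex.norm_real, Real.norm_eq_abs, abs_of_pos (angDensity_pos x)]
    have hx := (angDensity_pos x).le
    gcongr
  have hsum : Summable fun n => ∫ x, ‖a n x‖ :=
    Summable.of_nonneg_of_le (fun n => integral_nonneg fun x => norm_nonneg _) hle
      ((summable_fc f).mul_right _)
  have h := hasSum_integral_of_summable_integral_norm hint hsum
  have h2 : ∀ x, ∑' n, a n x = (f * g * mode (-p)).1 x * (angDensity x : ℂ) := fun x => by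
    have := (hasSum_fc f x).mul_right ((g * mode (-p)).1 x * (angDensity x : ℂ))
    rw [show (f * g * mode (-p)).1 x = f.1 x * (g * mode (-p)).1 x by
      rw [mul_assoc]; rfl, mul_assoc, ← this.tsum_eq]
    congr 1; funext n
    change fc f.1 n * ((mode n).1 x * (g * mode (-p)).1 x * _) = _
    ring
  simp_rw [h2] at h
  rw [fc_eq_mul]
  refine (h.mul_left _).congr_fun ?_
  intro n
  simp only [a]
  rw [integral_const_mul, ← fc_mul_mode, fc_eq_mul (mode n * g), mul_assoc (mode n)]
  ring

lemma fc_conj (f : ℝ → ℂ) (n : ℤ) : fc (fun x => conj (f x)) n = conj (fc f (-n)) := by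
  rw [fc, fc, map_mul, ← integral_conj]
  congr 1
  · rw [map_inv₀, Complex.conj_ofReal]
  · congr 1; funext x
    simp [conj_mode_apply]

/-- Multiplication by `θ'` turns vector fields into functions. -/
def TestFun.ofVector (h : ℝ → ℂ) (hh : IsTest 2 h) : TestFun :=
  ⟨fun x => h x * (angDensity x : ℂ), by
    obtain ⟨hc, F, hF, hFh⟩ := hh
    have hd : ContDiff ℝ ∞ fun x : ℝ => (angDensity x : ℂ) := by
      refine Complex.ofRealCLM.contDiff.comp ?_
      exact contDiff_const.div (contDiff_const.add (contDiff_id.pow 2)) fun x => by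
        positivity
    refine ⟨hc.mul hd, fun x => F x * (angDensity x : ℂ), hF.mul hd, fun x hx => ?_⟩
    have hx' : (x : ℂ) ≠ 0 := by exact_mod_cast hx
    have h1 : (1 + (x : ℂ) ^ 2) ≠ 0 := by
      have : (1 + x ^ 2 : ℝ) ≠ 0 := by positivity
      exact_mod_cast this
    beta_reduce
    rw [hFh x hx, angDensity, angDensity]
    push_cast
    have h2 : (1 + (-(x : ℂ)⁻¹) ^ 2) = (1 + (x : ℂ) ^ 2) / x ^ 2 := by field_simp; ring
    rw [h2]
    field_simp⟩

lemma TestFun.ofVector_apply (h : ℝ → ℂ) (hh : IsTest 2 h) (x : ℝ) :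
    (ofVector h hh).1 x = h x * (angDensity x : ℂ) := rfl

lemma coeff_eq (h : ℝ → ℂ) (hh : IsTest 2 h) (n : ℤ) :
    Currents.coeff h n = ((2 * Real.pi : ℝ) : ℂ)⁻¹ * fc (ofVector h hh).1 n := by
  rw [Currents.coeff, fc, sq, mul_assoc]
  congr 3; funext x
  rw [ofVector_apply, sq, angDensity]
  ring

end CurrentAlg
end

noncomputable section

namespace CurrentAlg

open MeasureTheory Filter Topology TestFun

/-! ### The two-point distributions in terms of Fourier coefficients -/

section Delta

variable (r : ℕ) (U V : TestFun)

/-- The binomial coefficient is a polynomial in `l` of degree `2r + 1`, which the rapid decay of the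
Fourier coefficients absorbs. -/
lemma summable_choose_fc : Summable fun l : ℕ =>
    ((l + (2 * r + 1)).choose (2 * r + 1) : ℝ) * ‖fc V.1 (-(l + r + 1 : ℤ))‖ := by
  have hinj : Function.Injective fun l : ℕ => -(l + r + 1 : ℤ) := fun a b h => by
    simp only at h; omega
  have h := ((summable_fc_poly V (2 * r + 1)).comp_injective hinj).mul_left
    ((2 * r + 2 : ℝ) ^ (2 * r + 1))
  refine Summable.of_nonneg_of_le (fun l => by positivity) (fun l => ?_) h
  have h1 : ((l + (2 * r + 1)).choose (2 * r + 1) : ℝ) ≤ ((l + (2 * r + 1) : ℕ) : ℝ) ^ (2 * r + 1) := by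
    exact_mod_cast Nat.choose_le_pow _ _
  have h2 : ((l + (2 * r + 1) : ℕ) : ℝ) ≤ (2 * r + 2) * (1 + |((-(l + r + 1 : ℤ) : ℤ) : ℝ)|) := by
    push_cast
    rw [abs_neg, abs_of_nonneg (by positivity)]
    nlinarith [(Nat.cast_nonneg l : (0 : ℝ) ≤ l), (Nat.cast_nonneg r : (0 : ℝ) ≤ r),
      mul_nonneg (Nat.cast_nonneg l : (0 : ℝ) ≤ l) (Nat.cast_nonneg r : (0 : ℝ) ≤ r)]
  simp only [Function.comp]
  calc _ ≤ ((2 * r + 2) * (1 + |((-(l + r + 1 : ℤ) : ℤ) : ℝ)|)) ^ (2 * r + 1) *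
        ‖fc V.1 (-(l + r + 1 : ℤ))‖ := by
        gcongr
        exact h1.trans (by gcongr)
    _ = _ := by rw [mul_pow]; ring

/-- The numerator `1 + i z` of the Cayley transform, at `z = x - i ε`. -/
def cayP (ε x : ℝ) : ℂ := 1 + ε + Complex.I * x

/-- The denominator `1 - i z` of the Cayley transform, at `z = x - i ε`. -/
def cayM (ε x : ℝ) : ℂ := 1 - ε - Complex.I * x

lemma normSq_cayP (ε x : ℝ) : ‖cayP ε x‖ ^ 2 = (1 + ε) ^ 2 + x ^ 2 := by
  rw [← Complex.normSq_eq_norm_sq, Complex.normSq_apply]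
  simp [cayP]; ring

lemma normSq_cayM (ε x : ℝ) : ‖cayM ε x‖ ^ 2 = (1 - ε) ^ 2 + x ^ 2 := by
  rw [← Complex.normSq_eq_norm_sq, Complex.normSq_apply]
  simp [cayM]; ring

lemma cayP_ne {ε : ℝ} (hε : 0 ≤ ε) (x : ℝ) : cayP ε x ≠ 0 := by
  rw [← norm_ne_zero_iff]
  intro h
  have := normSq_cayP ε x
  rw [h] at this
  nlinarith [sq_nonneg x]

lemma norm_cayM_div_le {ε : ℝ} (hε : 0 ≤ ε) (x : ℝ) : ‖cayM ε x / cayP ε x‖ ≤ 1 := by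
  rw [norm_div]
  refine div_le_one_of_le₀ ?_ (norm_nonneg _)
  refine le_of_sq_le_sq ?_ (norm_nonneg _)
  rw [normSq_cayP, normSq_cayM]; nlinarith

lemma norm_cayM_div_lt {ε : ℝ} (hε : 0 < ε) (x : ℝ) : ‖cayM ε x / cayP ε x‖ < 1 := by
  rw [norm_div, div_lt_one (norm_pos_iff.2 (cayP_ne hε.le x))]
  refine lt_of_pow_lt_pow_left₀ 2 (norm_nonneg _) ?_
  rw [normSq_cayP, normSq_cayM]; nlinarith

/-- With `z = x - iε` this is `2i(z - y) = (1 - iy)(1 + iz) - (1 - iz)(1 + iy)`. The ratio `(1 -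
iz)/(1 + iz)` has modulus below one for `ε > 0`, which opens the way to a power series in the Cayley
transform of `y`. -/
lemma kernel_eq {ε : ℝ} (hε : 0 ≤ ε) (x y : ℝ) :
    Complex.I * (((x - y : ℝ) : ℂ) - Complex.I * ε) =
      (1 - Complex.I * y) * cayP ε x * (1 - cayM ε x / cayP ε x * (mode 1).1 y) / 2 := by
  have h1 := cayP_ne hε x
  have h2 := one_sub_I_mul_ne y
  rw [mode_apply, zpow_one]
  field_simp
  rw [cayP, cayM]
  push_cast
  ring_nf
  simp only [Complex.I_sq]
  ring

lemma mode_half (y : ℝ) : ((1 - Complex.I * y : ℂ)⁻¹) ^ 2 * (angDensity y : ℂ)⁻¹ =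
    (mode 1).1 y / 2 := by
  have h1 := one_add_I_mul_ne y
  have h2 := one_sub_I_mul_ne y
  have hx : (1 + (y : ℂ) ^ 2) = (1 + Complex.I * y) * (1 - Complex.I * y) := by
    ring_nf; simp
  rw [mode_apply, zpow_one, angDensity]
  push_cast
  rw [hx]
  field_simp

lemma mode_neg_half (y : ℝ) : ((1 + Complex.I * y : ℂ)⁻¹) ^ 2 * (angDensity y : ℂ)⁻¹ =
    (mode (-1)).1 y / 2 := by
  have h1 := one_add_I_mul_ne y
  have h2 := one_sub_I_mul_ne y
  have hx : (1 + (y : ℂ) ^ 2) = (1 + Complex.I * y) * (1 - Complex.I * y) := by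
    ring_nf; simp
  rw [mode_apply, zpow_neg_one, angDensity]
  push_cast
  rw [hx]
  field_simp

lemma mode_pow (n : ℤ) (l : ℕ) (y : ℝ) : ((mode n).1 y) ^ l = (mode (l * n)).1 y := by
  rw [mode_apply, mode_apply, ← zpow_natCast, ← zpow_mul, mul_comm n]

/-- The binomial series of `(1 - ρ ζ)^{-(2r+2)}`, with `ζ` the Cayley transform of `y`. By
`mode_half`, the prefactor `(1 - iy)^{-2(r+1)}` combines with `θ'^{-r}` to `ζ^{r+1}` and one factor
`θ'`, so that integration over `y` produces Fourier coefficients of `V`. -/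
lemma kernel_expand {ε : ℝ} (hε : 0 < ε) (x y : ℝ) :
    HasSum (fun l : ℕ => 2 ^ (r + 1) * (cayP ε x)⁻¹ ^ (2 * (r + 1)) *
      (((l + (2 * r + 1)).choose (2 * r + 1) : ℂ) * (cayM ε x / cayP ε x) ^ l *
        ((mode (l + r + 1)).1 y * V.1 y * (angDensity y : ℂ))))
      ((Complex.I * (((x - y : ℝ) : ℂ) - Complex.I * ε))⁻¹ ^ (2 * (r + 1)) *
        (V.1 y * (angDensity y : ℂ)⁻¹ ^ r)) := by
  set ρ := cayM ε x / cayP ε x with hρ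
  have hlt : ‖ρ * (mode 1).1 y‖ < 1 := by
    rw [norm_mul, norm_mode, mul_one]; exact norm_cayM_div_lt hε x
  have hd : (angDensity y : ℂ) ≠ 0 := by exact_mod_cast (angDensity_pos y).ne'
  have h := (hasSum_choose_mul_geometric_of_norm_lt_one (2 * r + 1) hlt).mul_left
    (2 ^ (r + 1) * (cayP ε x)⁻¹ ^ (2 * (r + 1)) * ((mode 1).1 y ^ (r + 1)) *
      V.1 y * (angDensity y : ℂ))
  have hval : (Complex.I * (((x - y : ℝ) : ℂ) - Complex.I * ε))⁻¹ ^ (2 * (r + 1)) *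
        (V.1 y * (angDensity y : ℂ)⁻¹ ^ r) = 2 ^ (r + 1) * (cayP ε x)⁻¹ ^ (2 * (r + 1)) *
        ((mode 1).1 y ^ (r + 1)) * V.1 y * (angDensity y : ℂ) *
        (1 / (1 - ρ * (mode 1).1 y) ^ (2 * r + 1 + 1)) := by
    rw [kernel_eq hε.le, ← hρ]
    have e : (mode 1).1 y ^ (r + 1) =
        2 ^ (r + 1) * (((1 - Complex.I * y : ℂ)⁻¹) ^ 2 * (angDensity y : ℂ)⁻¹) ^ (r + 1) := by
      rw [mode_half, ← mul_pow]; congr 1; ring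
    rw [e, show 2 * r + 1 + 1 = 2 * (r + 1) by ring, one_div]
    simp only [mul_pow, inv_pow, mul_inv, div_eq_mul_inv, inv_inv, ← pow_mul]
    have : (2 : ℂ) ^ (2 * (r + 1)) = 2 ^ (r + 1) * 2 ^ (r + 1) := by rw [← pow_add]; congr 1; ring
    rw [this, pow_succ ((angDensity y : ℂ))]
    rw [mul_inv]
    field_simp
  rw [hval]
  refine h.congr_fun fun l => ?_
  have : (mode (l + r + 1)).1 y = (mode 1).1 y ^ l * (mode 1).1 y ^ (r + 1) := by
    rw [← pow_add, mode_pow]; push_cast; ring_nf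
  rw [this, mul_pow]; ring

/-- The inner integral of the two-point distributions. -/
lemma integral_kernel {ε : ℝ} (hε : 0 < ε) (x : ℝ) :
    ∫ y : ℝ, (Complex.I * (((x - y : ℝ) : ℂ) - Complex.I * ε))⁻¹ ^ (2 * (r + 1)) *
        (V.1 y * (angDensity y : ℂ)⁻¹ ^ r) =
      2 ^ (r + 1) * ((2 * Real.pi : ℝ) : ℂ) * ∑' l : ℕ, ((cayP ε x)⁻¹ ^ (2 * (r + 1)) *
        (((l + (2 * r + 1)).choose (2 * r + 1) : ℂ) * (cayM ε x / cayP ε x) ^ l *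
          fc V.1 (-(l + r + 1 : ℤ)))) := by
  have hpi : ((2 * Real.pi : ℝ) : ℂ) ≠ 0 := by
    have : (2 * Real.pi : ℝ) ≠ 0 := by positivity
    exact_mod_cast this
  obtain ⟨B, hB0, hB⟩ := exists_bound V
  let c : ℕ → ℂ := fun l => 2 ^ (r + 1) * (cayP ε x)⁻¹ ^ (2 * (r + 1)) *
      (((l + (2 * r + 1)).choose (2 * r + 1) : ℂ) * (cayM ε x / cayP ε x) ^ l)
  let a : ℕ → ℝ → ℂ := fun l y => c l * ((mode (l + r + 1) * V).1 y * (angDensity y : ℂ))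
  have hint : ∀ l, Integrable (a l) := fun l => (integrable_mul_angDensity _).const_mul _
  have hle : ∀ l, ∫ y, ‖a l y‖ ≤ ‖c l‖ * (B * (2 * Real.pi)) := fun l => by
    rw [← integral_angDensity, ← integral_const_mul, ← integral_const_mul]
    refine integral_mono (hint l).norm ((integrable_angDensity.const_mul _).const_mul _) fun y => ?_
    have : ‖(mode (l + r + 1) * V).1 y‖ ≤ B := by
      change ‖(mode (l + r + 1)).1 y * V.1 y‖ ≤ B
      rw [norm_mul, norm_mode, one_mul]; exact hB y
    simp only [a, norm_mul, Complex.norm_real, Real.norm_eq_abs, abs_of_pos (angDensity_pos y)]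
    have hx := (angDensity_pos y).le
    gcongr
  have hc : Summable fun l => ‖c l‖ :=
    ((summable_choose_mul_geometric_of_norm_lt_one (2 * r + 1) (norm_cayM_div_lt hε x)).mul_left
      (2 ^ (r + 1) * (cayP ε x)⁻¹ ^ (2 * (r + 1)))).norm
  have hsum : Summable fun l => ∫ y, ‖a l y‖ :=
    Summable.of_nonneg_of_le (fun n => integral_nonneg fun x => norm_nonneg _) hle
      (hc.mul_right _)
  have h := hasSum_integral_of_summable_integral_norm hint hsum
  have h2 : ∀ y, ∑' l, a l y =
      (Complex.I * (((x - y : ℝ) : ℂ) - Complex.I * ε))⁻¹ ^ (2 * (r + 1)) *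
        (V.1 y * (angDensity y : ℂ)⁻¹ ^ r) := fun y => by
    rw [← (kernel_expand r V hε x y).tsum_eq]
    congr 1; funext l
    change c l * ((mode (l + r + 1)).1 y * V.1 y * _) = _
    simp only [c]; ring
  simp_rw [h2] at h
  rw [← h.tsum_eq, ← tsum_mul_left]
  congr 1; funext l
  have h3 : fc V.1 (-(l + r + 1 : ℤ)) =
      ((2 * Real.pi : ℝ) : ℂ)⁻¹ * ∫ y, (mode (l + r + 1) * V).1 y * (angDensity y : ℂ) := by
    rw [fc_eq_mul, neg_neg, mul_comm V]
  simp only [a]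
  rw [integral_const_mul, h3]
  simp only [c]
  field_simp

/-- The two-point distributions as sums over Fourier coefficients. -/
lemma isDelta_fc (u v : ℝ → ℂ) (hu : ∀ x, u x = U.1 x * (angDensity x : ℂ)⁻¹ ^ r)
    (hv : ∀ x, v x = V.1 x * (angDensity x : ℂ)⁻¹ ^ r) :
    IsDelta (2 * (r + 1)) u v (((2 * Real.pi : ℝ) : ℂ)⁻¹ ^ (2 * r) *
      ∑' l : ℕ, ((l + (2 * r + 1)).choose (2 * r + 1) : ℂ) * fc U.1 (l + r + 1) *
        fc V.1 (-(l + r + 1 : ℤ))) := by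
  have hpi : ((2 * Real.pi : ℝ) : ℂ) ≠ 0 := by
    have : (2 * Real.pi : ℝ) ≠ 0 := by positivity
    exact_mod_cast this
  set b : ℕ → ℂ := fun l => ((l + (2 * r + 1)).choose (2 * r + 1) : ℂ) * fc V.1 (-(l + r + 1 : ℤ))
    with hb
  have hbs : Summable fun l => ‖b l‖ := by
    refine (summable_choose_fc r V).congr fun l => ?_
    simp [hb]
  obtain ⟨B, hB0, hB⟩ := exists_bound U
  set G : ℝ → ℝ → ℂ := fun ε x => U.1 x * (angDensity x : ℂ)⁻¹ ^ r * ∑' l : ℕ,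
    (cayP ε x)⁻¹ ^ (2 * (r + 1)) * (b l * (cayM ε x / cayP ε x) ^ l) with hG
  -- This bound is uniform in `ε ≥ 0`, because `|1 + iz|² = (1 + ε)² + x² ≥ 1 + x²` and the ratio
  -- has modulus at most one.
  have hterm : ∀ ε x, 0 ≤ ε → ∀ l, ‖(cayP ε x)⁻¹ ^ (2 * (r + 1)) *
      (b l * (cayM ε x / cayP ε x) ^ l)‖ ≤ ((1 + x ^ 2)⁻¹) ^ (r + 1) * ‖b l‖ := by
    intro ε x hε l
    rw [norm_mul, norm_mul, norm_pow, norm_pow, norm_inv]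
    have e1 : (‖cayP ε x‖⁻¹) ^ (2 * (r + 1)) ≤ ((1 + x ^ 2)⁻¹) ^ (r + 1) := by
      rw [pow_mul, inv_pow, normSq_cayP]
      gcongr
      nlinarith
    have e2 : ‖cayM ε x / cayP ε x‖ ^ l ≤ 1 := pow_le_one₀ (norm_nonneg _) (norm_cayM_div_le hε x)
    calc _ ≤ ((1 + x ^ 2)⁻¹) ^ (r + 1) * (‖b l‖ * 1) := by gcongr
      _ = _ := by rw [mul_one]
  have hcont : ∀ ε, 0 ≤ ε → Continuous (G ε) := fun ε hε => by
    have c1 : Continuous (cayP ε) := by unfold cayP; fun_prop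
    have c2 : Continuous (cayM ε) := by unfold cayM; fun_prop
    have c1' : Continuous fun x => (cayP ε x)⁻¹ := c1.inv₀ (cayP_ne hε)
    have c3 : Continuous fun x => cayM ε x / cayP ε x := c2.div c1 (cayP_ne hε)
    have c4 : Continuous fun x => (angDensity x : ℂ)⁻¹ :=
      (Complex.continuous_ofReal.comp continuous_angDensity).inv₀ fun x =>
        Complex.ofReal_ne_zero.2 (angDensity_pos x).ne'
    refine ((continuous U).mul (c4.pow r)).mul (continuous_tsum (fun l => ?_) hbs fun l x => ?_)
    · exact (c1'.pow _).mul (continuous_const.mul (c3.pow l))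
    · refine (hterm ε x hε l).trans (mul_le_of_le_one_left (norm_nonneg _) (pow_le_one₀
        (by positivity) (inv_le_one_of_one_le₀ (by nlinarith))))
  -- The decay `(1 + x²)^{-(r+1)}` outweighs the growth `(1 + x²)^r` of `θ'^{-r}` by one integrable
  -- factor, which gives the majorant for the limit `ε ↓ 0`.
  have hbound : ∀ ε x, 0 ≤ ε → ‖G ε x‖ ≤ B * (∑' l, ‖b l‖) * angDensity x := by
    intro ε x hε
    have h1 : ‖∑' l : ℕ, (cayP ε x)⁻¹ ^ (2 * (r + 1)) * (b l * (cayM ε x / cayP ε x) ^ l)‖ ≤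
        ((1 + x ^ 2)⁻¹) ^ (r + 1) * ∑' l, ‖b l‖ := by
      rw [← tsum_mul_left]
      exact tsum_of_norm_bounded (hbs.mul_left _).hasSum (hterm ε x hε)
    have hS : 0 ≤ ∑' l, ‖b l‖ := tsum_nonneg fun l => norm_nonneg _
    have hA : ‖(angDensity x : ℂ)⁻¹ ^ r‖ = ((1 + x ^ 2) / 2) ^ r := by
      rw [norm_pow, norm_inv, Complex.norm_real, Real.norm_eq_abs, abs_of_pos (angDensity_pos x),
        angDensity, inv_div]
    simp only [hG]
    rw [norm_mul, norm_mul, hA]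
    have hx : 0 < 1 + x ^ 2 := by positivity
    calc _ ≤ B * ((1 + x ^ 2) / 2) ^ r * (((1 + x ^ 2)⁻¹) ^ (r + 1) * ∑' l, ‖b l‖) := by
          gcongr; exact hB x
      _ = B * (∑' l, ‖b l‖) * ((1 / 2) ^ r * (1 + x ^ 2)⁻¹) := by
          rw [inv_pow, div_pow, div_pow, one_pow]
          field_simp
          rw [pow_succ]
          ring
      _ ≤ _ := by
          gcongr
          rw [angDensity_eq]
          gcongr
          calc (1 / 2 : ℝ) ^ r ≤ 1 := pow_le_one₀ (by norm_num) (by norm_num)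
            _ ≤ 2 := by norm_num
  have hptw : ∀ x, Tendsto (fun ε => G ε x) (𝓝[>] 0) (𝓝 (G 0 x)) := fun x => by
    refine Tendsto.const_mul _ ?_
    refine tendsto_tsum_of_dominated_convergence (bound := fun l =>
      ((1 + x ^ 2)⁻¹) ^ (r + 1) * ‖b l‖) (hbs.mul_left _) (fun l => ?_) ?_
    · have hP : ContinuousAt (fun ε => cayP ε x) 0 := by unfold cayP; fun_prop
      have hM : ContinuousAt (fun ε => cayM ε x) 0 := by unfold cayM; fun_prop
      have hne := cayP_ne le_rfl x
      have : ContinuousAt (fun ε => (cayP ε x)⁻¹ ^ (2 * (r + 1)) *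
          (b l * (cayM ε x / cayP ε x) ^ l)) 0 :=
        ((hP.inv₀ hne).pow _).mul (continuousAt_const.mul ((hM.div hP hne).pow l))
      exact this.tendsto.mono_left nhdsWithin_le_nhds
    · filter_upwards [self_mem_nhdsWithin] with ε hε l
      exact hterm ε x (le_of_lt hε) l
  have hlim : Tendsto (fun ε => ∫ x, G ε x) (𝓝[>] 0) (𝓝 (∫ x, G 0 x)) := by
    refine tendsto_integral_filter_of_dominated_convergence
      (fun x => B * (∑' l, ‖b l‖) * angDensity x) ?_ ?_ (integrable_angDensity.const_mul _)
      (Eventually.of_forall hptw)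
    · filter_upwards [self_mem_nhdsWithin] with ε hε
      exact (hcont ε (le_of_lt hε)).aestronglyMeasurable
    · filter_upwards [self_mem_nhdsWithin] with ε hε
      exact Eventually.of_forall fun x => hbound ε x (le_of_lt hε)
  -- At `ε = 0` the ratio becomes the inverse Cayley transform of `x`, so each term of the series
  -- integrates to a Fourier coefficient of `U`.
  have hG0 : 2 ^ (r + 1) * ∫ x, G 0 x =
      ((2 * Real.pi : ℝ) : ℂ) * ∑' l : ℕ, b l * fc U.1 (l + r + 1) := by
    let a : ℕ → ℝ → ℂ := fun l x => b l * ((U * mode (-(l + r + 1))).1 x * (angDensity x : ℂ))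
    have hint : ∀ l, Integrable (a l) := fun l => (integrable_mul_angDensity _).const_mul _
    have hle : ∀ l, ∫ y, ‖a l y‖ ≤ ‖b l‖ * (B * (2 * Real.pi)) := fun l => by
      rw [← integral_angDensity, ← integral_const_mul, ← integral_const_mul]
      refine integral_mono (hint l).norm ((integrable_angDensity.const_mul _).const_mul _)
        fun y => ?_
      have : ‖(U * mode (-(l + r + 1))).1 y‖ ≤ B := by
        change ‖U.1 y * (mode (-(l + r + 1))).1 y‖ ≤ B
        rw [norm_mul, norm_mode, mul_one]; exact hB y
      simp only [a, norm_mul, Complex.norm_real, Real.norm_eq_abs, abs_of_pos (angDensity_pos y)]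
      have hx := (angDensity_pos y).le
      gcongr
    have hsum : Summable fun l => ∫ y, ‖a l y‖ :=
      Summable.of_nonneg_of_le (fun n => integral_nonneg fun x => norm_nonneg _) hle
        (hbs.mul_right _)
    have h := hasSum_integral_of_summable_integral_norm hint hsum
    have h2 : ∀ x, ∑' l, a l x = 2 ^ (r + 1) * G 0 x := fun x => by
      simp only [hG]
      rw [← tsum_mul_left, ← tsum_mul_left]
      congr 1; funext l
      change b l * (U.1 x * (mode (-(l + r + 1))).1 x * (angDensity x : ℂ)) = _
      have e1 : (mode (-(l + r + 1 : ℤ))).1 x = (mode (-1)).1 x ^ (r + 1) * (mode (-1)).1 x ^ l := by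
        rw [← pow_add, mode_pow]; push_cast; ring_nf
      have e2 : (mode (-1)).1 x ^ (r + 1) =
          2 ^ (r + 1) * (((1 + Complex.I * x : ℂ)⁻¹) ^ 2 * (angDensity x : ℂ)⁻¹) ^ (r + 1) := by
        rw [mode_neg_half, ← mul_pow]; congr 1; ring
      have e3 : cayP 0 x = 1 + Complex.I * x := by simp [cayP]
      have e4 : cayM 0 x / cayP 0 x = (mode (-1)).1 x := by
        rw [e3, mode_apply, zpow_neg_one, inv_div]; simp [cayM]
      have hd : (angDensity x : ℂ) ≠ 0 := by exact_mod_cast (angDensity_pos x).ne'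
      rw [e4, e3, e1, e2]
      simp only [mul_pow, inv_pow, ← pow_mul]
      rw [pow_succ ((angDensity x : ℂ))]
      field_simp
    simp_rw [h2] at h
    rw [← integral_const_mul, ← h.tsum_eq, ← tsum_mul_left]
    congr 1; funext l
    simp only [a]
    rw [integral_const_mul, fc_eq_mul]
    field_simp
  unfold IsDelta
  have hfin : ((2 * Real.pi : ℝ) : ℂ)⁻¹ ^ (2 * r) *
      ∑' l : ℕ, ((l + (2 * r + 1)).choose (2 * r + 1) : ℂ) * fc U.1 (l + r + 1) *
        fc V.1 (-(l + r + 1 : ℤ)) = ((2 * Real.pi : ℝ) : ℂ)⁻¹ ^ (2 * (r + 1)) *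
          (2 ^ (r + 1) * ((2 * Real.pi : ℝ) : ℂ) * ∫ x, G 0 x) := by
    have : 2 ^ (r + 1) * ((2 * Real.pi : ℝ) : ℂ) * ∫ x, G 0 x =
        ((2 * Real.pi : ℝ) : ℂ) * (2 ^ (r + 1) * ∫ x, G 0 x) := by ring
    rw [this, hG0]
    have e : ∀ l : ℕ, ((l + (2 * r + 1)).choose (2 * r + 1) : ℂ) * fc U.1 (l + r + 1) *
        fc V.1 (-(l + r + 1 : ℤ)) = b l * fc U.1 (l + r + 1) := fun l => by simp only [hb]; ring
    simp_rw [e]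
    rw [show 2 * (r + 1) = 2 * r + 1 + 1 by ring, pow_succ, pow_succ]
    field_simp
  rw [hfin]
  refine ((hlim.const_mul (2 ^ (r + 1) * ((2 * Real.pi : ℝ) : ℂ))).const_mul
    (((2 * Real.pi : ℝ) : ℂ)⁻¹ ^ (2 * (r + 1)))).congr' ?_
  filter_upwards [self_mem_nhdsWithin] with ε hε
  congr 1
  rw [← integral_const_mul]
  congr 1; funext x
  have : ∀ y, (Complex.I * (((x - y : ℝ) : ℂ) - Complex.I * ε))⁻¹ ^ (2 * (r + 1)) * u x * v y =
      u x * ((Complex.I * (((x - y : ℝ) : ℂ) - Complex.I * ε))⁻¹ ^ (2 * (r + 1)) *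
        (V.1 y * (angDensity y : ℂ)⁻¹ ^ r)) := fun y => by rw [hv y]; ring
  simp_rw [this]
  rw [integral_const_mul, integral_kernel r V hε, hu x]
  simp only [hG, hb]
  rw [mul_left_comm]
  congr 3
  funext l
  ring

end Delta

end CurrentAlg
end

noncomputable section

namespace CurrentAlg

/-! ### Positivity of the dual Coxeter number -/

section Coxeter

variable {L : Type*} [LieRing L] [LieAlgebra ℝ L]

lemma exists_re_im (x : ℂ ⊗[ℝ] L) : ∃ a b : L, x = 1 ⊗ₜ[ℝ] a + Complex.I ⊗ₜ[ℝ] b := by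
  induction x with
  | zero => exact ⟨0, 0, by simp⟩
  | tmul c y =>
    refine ⟨c.re • y, c.im • y, ?_⟩
    rw [← TensorProduct.smul_tmul, ← TensorProduct.smul_tmul, ← TensorProduct.add_tmul]
    congr 1
    apply Complex.ext <;> simp
  | add x y hx hy =>
    obtain ⟨a, b, rfl⟩ := hx
    obtain ⟨a', b', rfl⟩ := hy
    refine ⟨a + a', b + b', ?_⟩
    rw [TensorProduct.tmul_add, TensorProduct.tmul_add]
    abel

variable [FiniteDimensional ℝ L]

/-- Pairing `a + ib` with real elements separates `κ(a, ·)` from `κ(b, ·)`, and definiteness of the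
real form makes both `a` and `b` vanish. -/
lemma isKilling_complexification (hL : IsCompactLie L) : LieAlgebra.IsKilling ℂ (ℂ ⊗[ℝ] L) := by
  refine ⟨?_⟩
  rw [eq_bot_iff]
  intro x hx
  rw [LieIdeal.mem_killingCompl] at hx
  obtain ⟨a, b, rfl⟩ := exists_re_im x
  have key : ∀ y : L, killingForm ℝ L a y = 0 ∧ killingForm ℝ L b y = 0 := fun y => by
    have h := hx (1 ⊗ₜ[ℝ] y) trivial
    rw [LieModule.traceForm_comm, LieModule.traceForm_baseChange] at h
    simp only [map_add, LinearMap.add_apply, LinearMap.BilinForm.baseChange_tmul] at h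
    have h1 := congrArg Complex.re h
    have h2 := congrArg Complex.im h
    simp at h1 h2
    exact ⟨h1, h2⟩
  have ha : a = 0 := by
    by_contra h
    exact (hL a h).ne (key a).1
  have hb : b = 0 := by
    by_contra h
    exact (hL b h).ne (key b).2
  simp [ha, hb]

open LieAlgebra LieAlgebra.IsKilling LieModule in
-- `κ(h, h)` is the sum of `β(h)²` over all roots `β`, which are squares of integers at a coroot
-- `h`; the root of `h` itself contributes `2² = 4`.
lemma corootKillingSquares_ge (hL : IsCompactLie L) {r : ℝ} (hr : r ∈ corootKillingSquares L) :
    4 ≤ r := by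
  have := isKilling_complexification hL
  obtain ⟨C, hC, α, h, e, f, hα, he, hf, ht, rfl⟩ := hr
  let a : Weight ℂ C (ℂ ⊗[ℝ] L) := ⟨α, by
    intro hbot
    have he' : e ∈ genWeightSpace (ℂ ⊗[ℝ] L) α := he
    rw [hbot] at he'
    exact ht.e_ne_zero (by simpa using he')⟩
  have ha : a.IsNonZero := fun h0 => hα h0
  have hh : h = coroot a := IsSl2Triple.h_eq_coroot ha ht he hf
  have hint : ∀ β : Weight ℂ C (ℂ ⊗[ℝ] L), ∃ n : ℤ, β (coroot a) = n := fun β =>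
    ⟨_, apply_coroot_eq_cast a β⟩
  choose n hn using hint
  have hsum : killingForm ℂ (ℂ ⊗[ℝ] L) h h =
      ∑ β ∈ C.root, β (coroot a) * β (coroot a) := by
    have := congrArg (fun B => B (coroot a) (coroot a))
      (restrict_killingForm_eq_sum (K := ℂ) (L := ℂ ⊗[ℝ] L) (H := C))
    simp only [LinearMap.BilinForm.restrict_apply, LinearMap.sum_apply, LinearMap.smulRight_apply,
      LinearMap.domRestrict_apply, LinearMap.smul_apply, smul_eq_mul] at this
    rw [hh]
    exact this
  have hre : (killingForm ℂ (ℂ ⊗[ℝ] L) h h).re = ∑ β ∈ C.root, (n β : ℝ) ^ 2 := by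
    rw [hsum, Complex.re_sum]
    refine Finset.sum_congr rfl fun β _ => ?_
    rw [hn]
    simp [sq]
  have h2 : (n a : ℝ) = 2 := by
    have := root_apply_coroot ha
    rw [hn] at this
    exact_mod_cast this
  rw [hre]
  have hmem : a ∈ C.root := by simpa [LieSubalgebra.root] using ha
  calc (4 : ℝ) = (n a : ℝ) ^ 2 := by rw [h2]; norm_num
    _ ≤ _ := Finset.single_le_sum (f := fun β => (n β : ℝ) ^ 2) (fun β _ => sq_nonneg _) hmem

open LieAlgebra LieAlgebra.IsKilling LieModule in
-- Needed because `sInf ∅ = 0` would destroy positivity. Without roots the complexification would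
-- equal its Cartan subalgebra and be abelian, against the definiteness of the Killing form.
lemma corootKillingSquares_nonempty (hL : IsCompactLie L) [Nontrivial L] :
    (corootKillingSquares L).Nonempty := by
  have := isKilling_complexification hL
  obtain ⟨x, hx⟩ := exists_isCartanSubalgebra_engel ℂ (ℂ ⊗[ℝ] L)
  set C := LieSubalgebra.engel ℂ x with hC
  have hex : ∃ a : Weight ℂ C (ℂ ⊗[ℝ] L), a.IsNonZero := by
    by_contra hno
    push Not at hno
    have htop := cartan_sup_iSup_rootSpace_eq_top (K := ℂ) (L := ℂ ⊗[ℝ] L) (H := C)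
    have hbot : (⨆ α : Weight ℂ C (ℂ ⊗[ℝ] L), ⨆ (_ : α.IsNonZero), rootSpace C α) = ⊥ := by
      refine iSup_eq_bot.2 fun α => iSup_eq_bot.2 fun hα => absurd hα ?_
      simpa using hno α
    rw [hbot, sup_bot_eq] at htop
    have hall : ∀ y : ℂ ⊗[ℝ] L, y ∈ C := fun y => by
      have : y ∈ C.toLieSubmodule := by rw [htop]; trivial
      simpa using this
    have hab : IsLieAbelian (ℂ ⊗[ℝ] L) := by
      have hCab : IsLieAbelian C := inferInstance
      refine ⟨fun y z => ?_⟩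
      have := hCab.trivial ⟨y, hall y⟩ ⟨z, hall z⟩
      simpa using congrArg Subtype.val this
    have hsub := (isLieAbelian_iff_subsingleton ℂ (ℂ ⊗[ℝ] L)).1 hab
    obtain ⟨y, hy⟩ := exists_ne (0 : L)
    have h1 : (1 : ℂ) ⊗ₜ[ℝ] y = 0 := Subsingleton.elim _ _
    have h2 : killingForm ℂ (ℂ ⊗[ℝ] L) ((1 : ℂ) ⊗ₜ[ℝ] y) ((1 : ℂ) ⊗ₜ[ℝ] y) = 0 := by simp [h1]
    rw [LieModule.traceForm_comm, LieModule.traceForm_baseChange] at h2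
    have h3 := congrArg Complex.re h2
    simp [LinearMap.BilinForm.baseChange_tmul] at h3
    exact (hL y hy).ne h3
  obtain ⟨a, ha⟩ := hex
  obtain ⟨h, e, f, ht, he, hf⟩ := exists_isSl2Triple_of_weight_isNonZero ha
  exact ⟨_, C, hx, a, h, e, f, ha, he, hf, ht, rfl⟩

lemma dualCoxeter_pos (hL : IsCompactLie L) [Nontrivial L] : 0 < dualCoxeter L := by
  have h : 4 ≤ sInf (corootKillingSquares L) :=
    le_csInf (corootKillingSquares_nonempty hL) fun r hr => corootKillingSquares_ge hL hr
  rw [dualCoxeter]; linarith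

end Coxeter

end CurrentAlg
end

noncomputable section

namespace CurrentAlg

open Module

/-! ### Orthonormal frames for invariant scalar products -/

/-- An orthonormal basis `u` for the scalar product that has the inverse Gram matrix `l` in the
basis `t`, in the sense that `l_{ab} t^a ⊗ t^b = ∑ u^a ⊗ u^a`. -/
def Contracts {V : Type*} [AddCommGroup V] [Module ℝ V] {n : ℕ} (l : Matrix (Fin n) (Fin n) ℝ)
    (t u : Fin n → V) : Prop :=
  ∃ M : Matrix (Fin n) (Fin n) ℝ, (∀ a, t a = ∑ c, M a c • u c) ∧ M.transpose * l * M = 1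

lemma Contracts.map {V W : Type*} [AddCommGroup V] [Module ℝ V] [AddCommGroup W] [Module ℝ W]
    {n : ℕ} {l : Matrix (Fin n) (Fin n) ℝ} {t u : Fin n → V} (h : Contracts l t u)
    (φ : V →ₗ[ℝ] W) : Contracts l (fun a => φ (t a)) (fun a => φ (u a)) := by
  obtain ⟨M, h1, h2⟩ := h
  refine ⟨M, fun a => ?_, h2⟩
  change φ (t a) = ∑ c, M a c • φ (u c)
  rw [h1 a, map_sum]; simp only [map_smul]

/-- This is the purpose of `Contracts`: any bilinear expression contracted with the inverse Gram
matrix may be computed in an orthonormal frame. -/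
lemma Contracts.sum_eq {V W : Type*} [AddCommGroup V] [Module ℝ V] [AddCommGroup W] [Module ℝ W]
    {n : ℕ} {l : Matrix (Fin n) (Fin n) ℝ} {t u : Fin n → V} (h : Contracts l t u)
    (G : V →ₗ[ℝ] V →ₗ[ℝ] W) :
    ∑ a, ∑ a', l a a' • G (t a) (t a') = ∑ c, G (u c) (u c) := by
  obtain ⟨M, h1, h2⟩ := h
  have e : ∀ a a', l a a' • G (t a) (t a') =
      ∑ c, ∑ c', (M a c * l a a' * M a' c') • G (u c) (u c') := fun a a' => by
    rw [h1 a, h1 a', map_sum G, LinearMap.sum_apply, Finset.smul_sum]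
    refine Finset.sum_congr rfl fun c _ => ?_
    rw [map_sum, Finset.smul_sum]
    refine Finset.sum_congr rfl fun c' _ => ?_
    rw [map_smul G, LinearMap.smul_apply, map_smul, smul_smul, smul_smul]
    congr 1; ring
  have e2 : ∀ c c', ∑ a, ∑ a', M a c * l a a' * M a' c' = if c = c' then 1 else 0 := fun c c' => by
    have := congrFun (congrFun h2 c) c'
    rw [Matrix.one_apply] at this
    rw [← this, Matrix.mul_apply, Finset.sum_comm]
    refine Finset.sum_congr rfl fun a' _ => ?_
    rw [Matrix.mul_apply, Finset.sum_mul]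
    rfl
  calc ∑ a, ∑ a', l a a' • G (t a) (t a')
      = ∑ a, ∑ a', ∑ c, ∑ c', (M a c * l a a' * M a' c') • G (u c) (u c') := by simp_rw [e]
    _ = ∑ c, ∑ c', ∑ a, ∑ a', (M a c * l a a' * M a' c') • G (u c) (u c') := by
        rw [Finset.sum_congr rfl fun a _ => Finset.sum_comm, Finset.sum_comm]
        refine Finset.sum_congr rfl fun c _ => ?_
        rw [Finset.sum_congr rfl fun a _ => Finset.sum_comm, Finset.sum_comm]
    _ = ∑ c, ∑ c', (if c = c' then (1 : ℝ) else 0) • G (u c) (u c') := by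
        refine Finset.sum_congr rfl fun c _ => Finset.sum_congr rfl fun c' _ => ?_
        rw [← e2, Finset.sum_smul]
        refine Finset.sum_congr rfl fun a _ => ?_
        rw [Finset.sum_smul]
    _ = _ := by simp

/-- Orthonormal bases of positive definite forms. -/
lemma exists_orthonormal {V : Type*} [AddCommGroup V] [Module ℝ V] {n : ℕ}
    (t : Basis (Fin n) ℝ V) (B : LinearMap.BilinForm ℝ V) (hs : ∀ X Y, B X Y = B Y X)
    (hp : ∀ X, X ≠ 0 → 0 < B X X) : ∃ u : Basis (Fin n) ℝ V,
      (∀ a b, B (u a) (u b) = if a = b then 1 else 0) ∧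
        Contracts (lowerMetric (fun X Y => B X Y) t) t u := by
  have hfin : FiniteDimensional ℝ V := Module.Basis.finiteDimensional_of_finite t
  have : Invertible (2 : ℝ) := invertibleOfNonzero two_ne_zero
  obtain ⟨v, hv⟩ := LinearMap.BilinForm.exists_orthogonal_basis (B := B) ⟨hs⟩
  have hn : finrank ℝ V = n := by rw [finrank_eq_card_basis t, Fintype.card_fin]
  let v' := v.reindex (finCongr hn)
  have hv' : ∀ a b, a ≠ b → B (v' a) (v' b) = 0 := fun a b hab => by
    simp only [v', Basis.reindex_apply]
    exact hv (fun h => hab ((finCongr hn).symm.injective h))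
  have hpos : ∀ a, 0 < B (v' a) (v' a) := fun a => hp _ (v'.ne_zero a)
  have hunit : ∀ a, IsUnit ((Real.sqrt (B (v' a) (v' a)))⁻¹) := fun a =>
    (isUnit_iff_ne_zero.2 (inv_ne_zero (Real.sqrt_pos.2 (hpos a)).ne'))
  let u := v'.isUnitSMul hunit
  have hu : ∀ a b, B (u a) (u b) = if a = b then 1 else 0 := fun a b => by
    simp only [u, Basis.isUnitSMul_apply, map_smul, LinearMap.smul_apply, smul_eq_mul]
    split_ifs with h
    · subst h
      have h1 := Real.mul_self_sqrt (hpos a).le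
      have h2 := (Real.sqrt_pos.2 (hpos a)).ne'
      field_simp
      nlinarith
    · rw [hv' a b h]; simp
  refine ⟨u, hu, (u.toMatrix t).transpose, fun a => ?_, ?_⟩
  · simp only [Matrix.transpose_apply]
    exact (u.sum_toMatrix_smul_self t a).symm
  · set M := (u.toMatrix t).transpose with hM
    have ht : ∀ a, t a = ∑ c, M a c • u c := fun a => (u.sum_toMatrix_smul_self t a).symm
    -- The Gram matrix of `t` is `M Mᵀ` because `u` is orthonormal, hence its inverse `l` satisfies
    -- `Mᵀ l M = 1`.
    have hG : (Matrix.of fun a b => B (t a) (t b)) = M * M.transpose := by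
      ext a b
      rw [Matrix.of_apply, ht a, ht b, Matrix.mul_apply]
      simp [hu, mul_comm]
    have hdet : IsUnit M.det := by
      have : Invertible (u.toMatrix t) := u.invertibleToMatrix t
      rw [hM, Matrix.det_transpose]
      exact (Matrix.isUnit_iff_isUnit_det _).1 (isUnit_of_invertible _)
    have hdet' : IsUnit M.transpose.det := by rwa [Matrix.det_transpose]
    rw [lowerMetric, hG, Matrix.mul_inv_rev, ← Matrix.mul_assoc, Matrix.mul_nonsing_inv _ hdet',
      Matrix.one_mul, Matrix.nonsing_inv_mul _ hdet]

/-- Invariant scalar products on a real Lie algebra. -/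
structure IsInvariantProduct {K : Type*} [LieRing K] [LieAlgebra ℝ K]
    (B : LinearMap.BilinForm ℝ K) : Prop where
  comm : ∀ X Y, B X Y = B Y X
  pos : ∀ X, X ≠ 0 → 0 < B X X
  inv : ∀ X Y Z, B ⁅X, Y⁆ Z = B X ⁅Y, Z⁆

namespace IsInvariantProduct

variable {K : Type*} [LieRing K] [LieAlgebra ℝ K] {B : LinearMap.BilinForm ℝ K}
  (hB : IsInvariantProduct B) {n : ℕ} {u : Basis (Fin n) ℝ K}
  (hu : ∀ a b, B (u a) (u b) = if a = b then 1 else 0)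

include hB

lemma skew (X Y Z : K) : B ⁅X, Y⁆ Z = -B Y ⁅X, Z⁆ := by
  rw [← lie_skew, map_neg, LinearMap.neg_apply, hB.inv]

lemma ext_right {X Y : K} (h : ∀ Z, B X Z = B Y Z) : X = Y := by
  by_contra hne
  have := hB.pos (X - Y) (sub_ne_zero.2 hne)
  rw [map_sub B, LinearMap.sub_apply, h, sub_self] at this
  exact lt_irrefl _ this

include hu

lemma repr_eq (X : K) (a : Fin n) : u.repr X a = B (u a) X := by
  conv_rhs => rw [← u.sum_repr X, map_sum]
  simp only [map_smul, hu, smul_eq_mul, mul_ite, mul_one, mul_zero, Finset.sum_ite_eq,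
    Finset.mem_univ, if_true]

lemma expand (X : K) : X = ∑ a, B (u a) X • u a := by
  conv_lhs => rw [← u.sum_repr X]
  simp_rw [hB.repr_eq hu]

lemma trace_eq (f : K →ₗ[ℝ] K) : LinearMap.trace ℝ K f = ∑ a, B (u a) (f (u a)) := by
  rw [LinearMap.trace_eq_matrix_trace ℝ u, Matrix.trace]
  refine Finset.sum_congr rfl fun a _ => ?_
  rw [Matrix.diag_apply, LinearMap.toMatrix_apply, hB.repr_eq hu]

lemma killing_eq (X Y : K) : killingForm ℝ K X Y = -∑ a, B ⁅X, u a⁆ ⁅Y, u a⁆ := by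
  rw [killingForm_apply_apply, hB.trace_eq hu, ← Finset.sum_neg_distrib]
  refine Finset.sum_congr rfl fun a _ => ?_
  rw [hB.skew, neg_neg]; rfl

/-- Moving one `ad u_a` across yields `∑ B([u_a, X], [u_a, Y])`, which is minus the trace that
defines the Killing form. -/
lemma casimir_killing (X Y : K) : B (-∑ a, ⁅u a, ⁅u a, X⁆⁆) Y = -killingForm ℝ K X Y := by
  rw [hB.killing_eq hu, neg_neg, map_neg, LinearMap.neg_apply, map_sum, LinearMap.sum_apply,
    ← Finset.sum_neg_distrib]
  refine Finset.sum_congr rfl fun a _ => ?_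
  rw [hB.skew, neg_neg, ← lie_skew X (u a), ← lie_skew Y (u a)]
  simp only [map_neg, LinearMap.neg_apply, neg_neg]

/-- `κ(X, X) = -∑ B([X, u_a], [X, u_a])` vanishes only for central `X`, and a simple algebra has no
centre. This transfers compactness to the simple ideals of `𝔥`. -/
lemma killing_neg [LieAlgebra.IsSimple ℝ K] (X : K) (hX : X ≠ 0) : killingForm ℝ K X X < 0 := by
  rw [hB.killing_eq hu, neg_lt_zero]
  have hnn : ∀ Z, 0 ≤ B Z Z := fun Z => by
    by_cases h : Z = 0
    · simp [h]
    · exact (hB.pos Z h).le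
  refine lt_of_le_of_ne (Finset.sum_nonneg fun a _ => hnn _) fun h0 => hX ?_
  have hz : ∀ a, ⁅X, u a⁆ = 0 := fun a => by
    by_contra hne
    have := (Finset.sum_eq_zero_iff_of_nonneg (fun a _ => hnn ⁅X, u a⁆)).1 h0.symm a
      (Finset.mem_univ a)
    exact (hB.pos _ hne).ne' this
  have hc : X ∈ LieAlgebra.center ℝ K := by
    rw [LieModule.mem_maxTrivSubmodule]
    intro Y
    rw [← lie_skew, ← u.sum_repr Y, lie_sum, neg_eq_zero]
    exact Finset.sum_eq_zero fun a _ => by rw [lie_smul, hz, smul_zero]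
  rcases LieAlgebra.IsSimple.eq_bot_or_eq_top (R := ℝ) (LieAlgebra.center ℝ K) with h | h
  · rw [h] at hc; simpa using hc
  · exact absurd ((LieAlgebra.isLieAbelian_iff_center_eq_top ℝ K).2 h)
      (LieAlgebra.IsSimple.non_abelian ℝ)

/-- Invariant forms on a simple Lie algebra with an invariant scalar product are proportional. -/
lemma schur [LieAlgebra.IsSimple ℝ K] {B' : LinearMap.BilinForm ℝ K}
    (hB' : IsInvariantProduct B') : ∃ c : ℝ, ∀ X Y, B' X Y = c * B X Y := by
  have hne : Nonempty (Fin n) := by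
    by_contra hemp
    rw [not_nonempty_iff] at hemp
    have hs : Subsingleton K := ⟨fun X Y => u.ext_elem fun i => hemp.elim i⟩
    exact LieAlgebra.IsSimple.non_abelian ℝ (L := K) ⟨fun X Y => Subsingleton.elim _ _⟩
  -- The Gram matrix of `B'` in a `B`-orthonormal basis is symmetric and therefore has a real
  -- eigenvector. The eigenspace, described without a basis as `I` below, is an ideal by invariance,
  -- hence everything.
  let A : Matrix (Fin n) (Fin n) ℝ := Matrix.of fun a b => B' (u a) (u b)
  have hA : A.IsHermitian := by
    ext a b
    simp [A, hB'.comm (u b) (u a)]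
  obtain ⟨i⟩ := hne
  set w : Fin n → ℝ := ⇑(hA.eigenvectorBasis i) with hw
  have hw0 : w ≠ 0 := by
    intro h
    have h1 := (hA.eigenvectorBasis.orthonormal.1 i)
    have : hA.eigenvectorBasis i = 0 := by ext j; exact congrFun h j
    rw [this] at h1; simp at h1
  have heig := hA.mulVec_eigenvectorBasis i
  rw [← hw] at heig
  set c := hA.eigenvalues i
  let I : LieIdeal ℝ K :=
    { carrier := {X | ∀ Y, B' X Y = c * B X Y}
      add_mem' := fun {X Y} hX hY Z => by
        rw [map_add, map_add, LinearMap.add_apply, LinearMap.add_apply, hX Z, hY Z, mul_add]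
      zero_mem' := fun Z => by simp
      smul_mem' := fun r X hX Z => by
        rw [map_smul, map_smul, LinearMap.smul_apply, LinearMap.smul_apply, hX Z]
        simp only [smul_eq_mul]; ring
      lie_mem := fun {Z X} hX Y => by
        rw [hB.skew, hB'.skew, hX ⁅Z, Y⁆]; ring }
  have hX : ∑ a, w a • u a ∈ I := by
    intro Y
    have hbas : ∀ b, B' (∑ a, w a • u a) (u b) = c * B (∑ a, w a • u a) (u b) := fun b => by
      have h1 := congrFun heig b
      simp only [Matrix.mulVec, dotProduct, A, Matrix.of_apply, Pi.smul_apply, smul_eq_mul] at h1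
      simp only [map_sum, LinearMap.sum_apply, map_smul, LinearMap.smul_apply, smul_eq_mul, hu]
      simp only [mul_ite, mul_one, mul_zero, Finset.sum_ite_eq', Finset.mem_univ, if_true]
      rw [← h1]
      refine Finset.sum_congr rfl fun a _ => ?_
      rw [hB'.comm (u a)]; ring
    rw [← u.sum_repr Y]
    simp only [map_sum (B' _), map_sum (B _), map_smul (B' _), map_smul (B _), smul_eq_mul, hbas,
      Finset.mul_sum]
    refine Finset.sum_congr rfl fun a _ => by ring
  have hX0 : ∑ a, w a • u a ≠ 0 := fun h => hw0 <| by
    have := Fintype.linearIndependent_iff.1 u.linearIndependent w h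
    funext a; exact this a
  rcases LieAlgebra.IsSimple.eq_bot_or_eq_top (R := ℝ) I with h | h
  · rw [h] at hX; exact absurd (by simpa using hX) hX0
  · refine ⟨c, fun X Y => ?_⟩
    have : X ∈ I := by rw [h]; trivial
    exact this Y

end IsInvariantProduct

end CurrentAlg
end

noncomputable section

namespace CurrentAlg

open Module

/-! ### The normalized metric and frames of the ideals -/

section Metric

variable {L : Type*} [LieRing L] [LieAlgebra ℝ L]

/-- The normalized metric as a bilinear form. -/
def metricForm (L : Type*) [LieRing L] [LieAlgebra ℝ L] : LinearMap.BilinForm ℝ L :=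
  (-(2 * dualCoxeter L)⁻¹) • killingForm ℝ L

lemma metricForm_apply (X Y : L) : metricForm L X Y = metric L X Y := by
  rw [metricForm, metric, LinearMap.smul_apply, LinearMap.smul_apply, smul_eq_mul,
    div_eq_mul_inv]
  ring

lemma metric_eq_form : (metric L : L → L → ℝ) = fun X Y => metricForm L X Y := by
  funext X Y; exact (metricForm_apply X Y).symm

lemma metric_comm (X Y : L) : metric L X Y = metric L Y X := by
  rw [metric, metric, LieModule.traceForm_comm]

lemma metric_inv (X Y Z : L) : metric L ⁅X, Y⁆ Z = metric L X ⁅Y, Z⁆ := by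
  rw [metric, metric, LieModule.traceForm_apply_lie_apply]

lemma metric_skew (X Y Z : L) : metric L ⁅X, Y⁆ Z = -metric L Y ⁅X, Z⁆ := by
  rw [metric, metric, LieModule.traceForm_apply_lie_apply']; ring

lemma metric_add_left (X Y Z : L) : metric L (X + Y) Z = metric L X Z + metric L Y Z := by
  simp only [metric_eq_form, map_add, LinearMap.add_apply]

lemma metric_add_right (X Y Z : L) : metric L X (Y + Z) = metric L X Y + metric L X Z := by
  simp only [metric_eq_form, map_add]

lemma metric_sub_left (X Y Z : L) : metric L (X - Y) Z = metric L X Z - metric L Y Z := by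
  simp only [metric_eq_form, map_sub, LinearMap.sub_apply]

lemma metric_sub_right (X Y Z : L) : metric L X (Y - Z) = metric L X Y - metric L X Z := by
  simp only [metric_eq_form, map_sub]

lemma metric_smul_left (c : ℝ) (X Y : L) : metric L (c • X) Y = c * metric L X Y := by
  simp only [metric_eq_form, map_smul, LinearMap.smul_apply, smul_eq_mul]

lemma metric_smul_right (c : ℝ) (X Y : L) : metric L X (c • Y) = c * metric L X Y := by
  simp only [metric_eq_form, map_smul, smul_eq_mul]

lemma metric_neg_left (X Y : L) : metric L (-X) Y = -metric L X Y := by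
  simp only [metric_eq_form, map_neg, LinearMap.neg_apply]

lemma metric_zero_right (X : L) : metric L X 0 = 0 := by
  simp only [metric_eq_form, map_zero]

lemma metric_sum_left {α : Type*} (S : Finset α) (X : α → L) (Y : L) :
    metric L (∑ a ∈ S, X a) Y = ∑ a ∈ S, metric L (X a) Y := by
  simp only [metric_eq_form, map_sum, LinearMap.sum_apply]

lemma metric_sum_right {α : Type*} (S : Finset α) (X : α → L) (Y : L) :
    metric L Y (∑ a ∈ S, X a) = ∑ a ∈ S, metric L Y (X a) := by
  simp only [metric_eq_form, map_sum]

lemma isInvariantProduct_metricForm [FiniteDimensional ℝ L] [Nontrivial L] (hL : IsCompactLie L) :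
    IsInvariantProduct (metricForm L) where
  comm X Y := by rw [metricForm_apply, metricForm_apply, metric_comm]
  pos X hX := by
    have h1 := hL X hX
    have h2 := dualCoxeter_pos hL
    rw [metricForm_apply, metric]
    exact div_pos (by linarith) (by linarith)
  inv X Y Z := by rw [metricForm_apply, metricForm_apply, metric_inv]

/-- The Casimir operator of the adjoint representation is twice the dual Coxeter number. -/
lemma casimir_adjoint [FiniteDimensional ℝ L] [Nontrivial L] (hL : IsCompactLie L) {n : ℕ}
    (u : Basis (Fin n) ℝ L) (hu : ∀ a b, metricForm L (u a) (u b) = if a = b then 1 else 0)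
    (X : L) : -∑ a, ⁅u a, ⁅u a, X⁆⁆ = (2 * dualCoxeter L) • X := by
  have hB := isInvariantProduct_metricForm hL
  refine hB.ext_right fun Z => ?_
  rw [hB.casimir_killing hu, map_smul, LinearMap.smul_apply, metricForm_apply, metric, smul_eq_mul]
  have := dualCoxeter_pos hL
  field_simp

lemma IsInvariantProduct.comp {K : Type*} [LieRing K] [LieAlgebra ℝ K]
    {B : LinearMap.BilinForm ℝ L} (hB : IsInvariantProduct B) (φ : K →ₗ⁅ℝ⁆ L)
    (hφ : Function.Injective φ) :
    IsInvariantProduct (B.comp (φ : K →ₗ[ℝ] L) (φ : K →ₗ[ℝ] L)) where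
  comm X Y := hB.comm _ _
  pos X hX := hB.pos _ fun h => hX (hφ (by rw [map_zero]; exact h))
  inv X Y Z := by
    simp only [LinearMap.BilinForm.comp_apply, LieHom.coe_toLinearMap, LieHom.map_lie, hB.inv]

end Metric

/-- Mutually commuting and orthogonal families of colours that are, for each `o`, orthogonal frames
of a Lie algebra: `I` are the squared lengths and `2 v` the eigenvalues of the Casimir operators. -/
structure IsFrameSystem {𝔤 : Type*} [LieRing 𝔤] [LieAlgebra ℝ 𝔤] {O : Type*} {d : O → ℕ}
    (u : ∀ o, Fin (d o) → 𝔤) (I v : O → ℝ) : Prop where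
  index_pos : ∀ o, 0 < I o
  coxeter_nonneg : ∀ o, 0 ≤ v o
  gram : ∀ o a b, metric 𝔤 (u o a) (u o b) = if a = b then I o else 0
  orth : ∀ o o', o ≠ o' → ∀ a b, metric 𝔤 (u o a) (u o' b) = 0
  comm : ∀ o o', o ≠ o' → ∀ a b, ⁅u o a, u o' b⁆ = 0
  skew : ∀ o c, ∃ M : Fin (d o) → Fin (d o) → ℝ, (∀ a b, M a b = -M b a) ∧
    ∀ a, ⁅u o c, u o a⁆ = ∑ b, M a b • u o b
  cas : ∀ o b, -∑ a, ⁅u o a, ⁅u o a, u o b⁆⁆ = (2 * v o) • u o b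

lemma IsInvariantProduct.skew_matrix {K : Type*} [LieRing K] [LieAlgebra ℝ K]
    {B : LinearMap.BilinForm ℝ K} (hB : IsInvariantProduct B) {n : ℕ} {u : Basis (Fin n) ℝ K}
    (hu : ∀ a b, B (u a) (u b) = if a = b then 1 else 0) (X : K) :
    ∃ M : Fin n → Fin n → ℝ, (∀ a b, M a b = -M b a) ∧ ∀ a, ⁅X, u a⁆ = ∑ b, M a b • u b := by
  refine ⟨fun a b => B (u b) ⁅X, u a⁆, fun a b => ?_, fun a => hB.expand hu _⟩
  beta_reduce
  rw [hB.comm, hB.skew]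

section Parts

variable {𝔤 𝔥 A : Type*} [LieRing 𝔤] [LieAlgebra ℝ 𝔤] [FiniteDimensional ℝ 𝔤]
  [LieAlgebra.IsSimple ℝ 𝔤] [LieRing 𝔥] [LieAlgebra ℝ 𝔥]

lemma nontrivial_of_isSimple (L : Type*) [LieRing L] [LieAlgebra ℝ L] [LieAlgebra.IsSimple ℝ L] :
    Nontrivial L := by
  by_contra h
  rw [not_nontrivial_iff_subsingleton] at h
  exact LieAlgebra.IsSimple.non_abelian ℝ (L := L) ⟨fun X Y => Subsingleton.elim _ _⟩

lemma exists_frame_adjoint (hcompact : IsCompactLie 𝔤) {m : ℕ} (e : Basis (Fin m) ℝ 𝔤) :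
    ∃ u : Basis (Fin m) ℝ 𝔤, Contracts (lowerMetric (metric 𝔤) e) e u ∧
      IsFrameSystem (O := Unit) (fun _ => u) (fun _ => 1) (fun _ => dualCoxeter 𝔤) := by
  have := nontrivial_of_isSimple 𝔤
  have hB := isInvariantProduct_metricForm hcompact
  obtain ⟨u, hu, hc⟩ := exists_orthonormal e (metricForm 𝔤) hB.comm hB.pos
  refine ⟨u, by rwa [metric_eq_form], fun _ => one_pos, fun _ => (dualCoxeter_pos hcompact).le,
    fun _ a b => by rw [← metricForm_apply, hu], fun o o' h => (h rfl).elim,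
    fun o o' h => (h rfl).elim, fun _ c => hB.skew_matrix hu _,
    fun _ b => casimir_adjoint hcompact u hu _⟩

variable (hcompact : IsCompactLie 𝔤) (ι : 𝔥 →ₗ⁅ℝ⁆ 𝔤) (hι : Function.Injective ι)
  (s : A → LieIdeal ℝ 𝔥) (z : LieIdeal ℝ 𝔥) (hsz : IsReductiveDecomposition s z)

include hcompact hι hsz

/-- The invariant scalar products on the ideals, the Dynkin indices and the Casimir eigenvalues. -/
lemma exists_partForm (o : Option A) : ∃ B : LinearMap.BilinForm ℝ (part s z o),
    (∀ X Y, partMetric ι s z o X Y = B X Y) ∧ IsInvariantProduct B ∧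
    (∀ X Y : part s z o, metric 𝔤 (ι X) (ι Y) = partIndex ι s o * B X Y) ∧
    0 < partIndex ι s o ∧ 0 ≤ partCoxeter s o ∧ (o ≠ none → 0 < partCoxeter s o) ∧
    ∀ {n : ℕ} (u : Basis (Fin n) ℝ (part s z o)),
      (∀ a b, B (u a) (u b) = if a = b then 1 else 0) →
        ∀ X : part s z o, -∑ a, ⁅u a, ⁅u a, X⁆⁆ = (2 * partCoxeter s o) • X := by
  have := nontrivial_of_isSimple 𝔤
  have hg := isInvariantProduct_metricForm hcompact
  have hfin : FiniteDimensional ℝ 𝔥 :=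
    FiniteDimensional.of_injective (ι : 𝔥 →ₗ[ℝ] 𝔤) hι
  cases o with
  | none =>
    let φ : z →ₗ⁅ℝ⁆ 𝔤 := ι.comp z.incl
    have hφ : Function.Injective φ := hι.comp Subtype.val_injective
    have h0 := hg.comp φ hφ
    refine ⟨(metricForm 𝔤).comp (φ : z →ₗ[ℝ] 𝔤) (φ : z →ₗ[ℝ] 𝔤), fun X Y => ?_, h0, fun X Y => ?_,
      one_pos, le_rfl, fun h => (h rfl).elim, fun u hu X => ?_⟩
    · exact (metricForm_apply _ _).symm
    · rw [partIndex, one_mul]; exact (metricForm_apply _ _).symm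
    · have hab : IsLieAbelian z := hsz.abelian
      have h1 : ∀ Y W : part s z none, ⁅Y, W⁆ = 0 := fun Y W => hab.trivial Y W
      simp [partCoxeter, h1]
  | some α =>
    have hsimple : LieAlgebra.IsSimple ℝ (s α) := hsz.simple α
    have hnt := nontrivial_of_isSimple (s α)
    let φ : s α →ₗ⁅ℝ⁆ 𝔤 := ι.comp (s α).incl
    have hφ : Function.Injective φ := hι.comp Subtype.val_injective
    have h0 := hg.comp φ hφ
    obtain ⟨w, hw, -⟩ := exists_orthonormal (finBasis ℝ (s α)) _ h0.comm h0.pos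
    -- The metric of `𝔤`, restricted to the ideal, is an invariant scalar product, so the Killing
    -- form of the ideal is negative definite.
    have hc : IsCompactLie (s α) := fun X hX => h0.killing_neg hw X hX
    have hm := isInvariantProduct_metricForm hc
    obtain ⟨w', hw', -⟩ := exists_orthonormal (finBasis ℝ (s α)) _ hm.comm hm.pos
    -- This existence is what excludes the default value `0` in the definition of `dynkinIndex`.
    have hex : ∃ I : ℝ, ∀ X Y : s α, metric 𝔤 (ι X) (ι Y) = I * metric (s α) X Y := by
      obtain ⟨c, hc⟩ := hm.schur hw' h0
      refine ⟨c, fun X Y => ?_⟩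
      rw [← metricForm_apply, ← metricForm_apply, ← hc]
      rfl
    have hidx : ∀ X Y : s α, metric 𝔤 (ι X) (ι Y) = partIndex ι s (some α) * metric (s α) X Y := by
      have : partIndex ι s (some α) = hex.choose := by
        rw [partIndex, dynkinIndex, dif_pos hex]
      rw [this]; exact hex.choose_spec
    refine ⟨metricForm (s α), fun X Y => (metricForm_apply _ _).symm, hm, fun X Y => ?_, ?_,
      (dualCoxeter_pos hc).le, fun _ => dualCoxeter_pos hc, fun u hu X => ?_⟩
    · exact (hidx X Y).trans (congrArg _ (metricForm_apply (L := s α) X Y).symm)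
    · obtain ⟨X, hX⟩ := exists_ne (0 : s α)
      have h1 := h0.pos X hX
      have h2 := hm.pos X hX
      have h3 := hidx X X
      rw [metricForm_apply] at h2
      have h4 : 0 < metric 𝔤 (ι X) (ι X) := by rw [← metricForm_apply]; exact h1
      rw [h3] at h4
      exact pos_of_mul_pos_left h4 h2.le
    · exact casimir_adjoint hc u hu X

/-- Orthonormal frames of the ideals `𝔥_α`. -/
lemma exists_frameSystem {d : Option A → ℕ} (b : ∀ o, Basis (Fin (d o)) ℝ (part s z o)) :
    ∃ u : ∀ o, Fin (d o) → 𝔤, IsFrameSystem u (partIndex ι s) (partCoxeter s) ∧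
      (∀ o, Contracts (partLower ι b o) (colour ι b o) (u o)) ∧
      ∀ o T, proj ι b o T = (partIndex ι s o)⁻¹ • ∑ a, metric 𝔤 (u o a) T • u o a := by
  choose B hBm hB hBI hI hv hv' hcas using exists_partForm hcompact ι hι s z hsz
  have hw : ∀ o, ∃ w : Basis (Fin (d o)) ℝ (part s z o),
      (∀ a c, B o (w a) (w c) = if a = c then 1 else 0) ∧
        Contracts (lowerMetric (fun X Y => B o X Y) (b o)) (b o) w :=
    fun o => exists_orthonormal (b o) (B o) (hB o).comm (hB o).pos
  choose w hw hcon using hw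
  let φ : ∀ o, part s z o →ₗ⁅ℝ⁆ 𝔤 := fun o => ι.comp (part s z o).incl
  have hφ : ∀ o (X : part s z o), φ o X = ι X := fun o X => rfl
  have hlow : ∀ o, partLower ι b o = lowerMetric (fun X Y => B o X Y) (b o) := fun o => by
    rw [partLower]; congr 1; funext X Y; exact hBm o X Y
  have hC : ∀ o, Contracts (partLower ι b o) (colour ι b o) (fun a => φ o (w o a)) := fun o => by
    rw [hlow]; exact (hcon o).map (φ o : part s z o →ₗ[ℝ] 𝔤)
  have hcomm : ∀ o o', o ≠ o' → ∀ a c, ⁅φ o (w o a), φ o' (w o' c)⁆ = 0 := fun o o' hne a c => by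
    have hdis : Disjoint (part s z o).toSubmodule (part s z o').toSubmodule :=
      hsz.indep.pairwiseDisjoint hne
    have h1 : ⁅(w o a : 𝔥), (w o' c : 𝔥)⁆ ∈ (part s z o').toSubmodule :=
      LieSubmodule.lie_mem _ (w o' c).2
    have h2 : ⁅(w o a : 𝔥), (w o' c : 𝔥)⁆ ∈ (part s z o).toSubmodule := by
      rw [← lie_skew]
      exact Submodule.neg_mem _ (LieSubmodule.lie_mem _ (w o a).2)
    have h3 := (Submodule.disjoint_def.1 hdis) _ h2 h1
    rw [hφ, hφ, ← LieHom.map_lie, h3, map_zero]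
  have hcasg : ∀ o c, -∑ a, ⁅φ o (w o a), ⁅φ o (w o a), φ o (w o c)⁆⁆ =
      (2 * partCoxeter s o) • φ o (w o c) := fun o c => by
    have := congrArg (φ o) (hcas o (w o) (hw o) (w o c))
    simpa only [map_neg, map_sum, LieHom.map_lie, map_smul] using this
  -- The Casimir operator of a simple ideal is the nonzero multiple `2 v` on it; shifted to the
  -- other argument of the metric it vanishes, since the ideals commute. The abelian ideal has `v =
  -- 0` and is covered by symmetry.
  have horth' : ∀ o o', o ≠ o' → o ≠ none → ∀ a c, metric 𝔤 (φ o (w o a)) (φ o' (w o' c)) = 0 := by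
    intro o o' hne hnone a c
    have hpos := hv' o hnone
    have h1 : (2 * partCoxeter s o) * metric 𝔤 (φ o (w o a)) (φ o' (w o' c)) = 0 := by
      rw [← metric_smul_left, ← hcasg, metric_neg_left, metric_sum_left, neg_eq_zero]
      refine Finset.sum_eq_zero fun a' _ => ?_
      rw [metric_skew, hcomm o o' hne, metric_zero_right, neg_zero]
    rcases mul_eq_zero.1 h1 with h | h
    · linarith
    · exact h
  refine ⟨fun o a => φ o (w o a), ⟨hI, hv, fun o a c => ?_, fun o o' hne a c => ?_, hcomm,
    fun o c => ?_, hcasg⟩, hC, fun o T => ?_⟩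
  · rw [hφ, hφ, hBI, hw]; split_ifs <;> simp
  · by_cases h : o = none
    · rw [metric_comm]
      exact horth' o' o hne.symm (fun h' => hne (h.trans h'.symm)) c a
    · exact horth' o o' hne h a c
  · obtain ⟨M, hM, hM'⟩ := (hB o).skew_matrix (hw o) (w o c)
    refine ⟨M, hM, fun a => ?_⟩
    rw [← LieHom.map_lie, hM', map_sum]
    simp only [map_smul]
  · have hdet : IsUnit (Matrix.of fun a c => B o (b o a) (b o c)).det := by
      obtain ⟨M, -, hM⟩ := hcon o
      have h1 := congrArg Matrix.det hM
      rw [Matrix.det_mul, Matrix.det_mul, Matrix.det_one] at h1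
      have h2 : IsUnit (lowerMetric (fun X Y => B o X Y) (b o)).det := by
        rw [isUnit_iff_ne_zero]; rintro h; rw [h] at h1; simp at h1
      exact Matrix.isUnit_nonsing_inv_det_iff.1 h2
    have hlg : lowerMetric (metric 𝔤) (colour ι b o) = (partIndex ι s o)⁻¹ • partLower ι b o := by
      have : Invertible (partIndex ι s o) := invertibleOfNonzero (hI o).ne'
      rw [hlow, lowerMetric, lowerMetric, ← invOf_eq_inv, ← Matrix.inv_smul _ _ hdet]
      congr 1
      ext a c
      simp only [Matrix.of_apply, Matrix.smul_apply, smul_eq_mul, colour, hBI]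
    let G : 𝔤 →ₗ[ℝ] 𝔤 →ₗ[ℝ] 𝔤 := LinearMap.mk₂ ℝ (fun X Y => metric 𝔤 Y T • X)
      (fun X X' Y => smul_add _ _ _) (fun c X Y => smul_comm _ _ _)
      (fun X Y Y' => by rw [metric_add_left, add_smul])
      (fun c X Y => by rw [metric_smul_left, mul_smul])
    have h := (hC o).sum_eq G
    simp only [G, LinearMap.mk₂_apply] at h
    rw [← h, proj, Finset.smul_sum]
    refine Finset.sum_congr rfl fun a _ => ?_
    rw [Finset.smul_sum]
    refine Finset.sum_congr rfl fun a' _ => ?_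
    rw [hlg, Matrix.smul_apply, smul_eq_mul, smul_smul, smul_smul]

end Parts

end CurrentAlg
end

noncomputable section

namespace CurrentAlg

namespace Currents

open TestFun MeasureTheory

variable {𝔤 : Type*} [LieRing 𝔤] [LieAlgebra ℝ 𝔤] {k : ℕ} {H : Type*}
  [NormedAddCommGroup H] [InnerProductSpace ℂ H] (𝒥 : Currents 𝔤 k H)

/-! ### Mode algebra -/

lemma real_smul_eq (c : ℝ) (ψ : 𝒥.D) : c • ψ = (c : ℂ) • ψ := by
  rw [← Complex.coe_algebraMap, algebraMap_smul]

lemma J_add (X Y : 𝔤) (n : ℤ) (ψ : 𝒥.D) : 𝒥.J (X + Y) n ψ = 𝒥.J X n ψ + 𝒥.J Y n ψ := by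
  simp only [J, map_add, LinearMap.add_apply]

lemma J_sub (X Y : 𝔤) (n : ℤ) (ψ : 𝒥.D) : 𝒥.J (X - Y) n ψ = 𝒥.J X n ψ - 𝒥.J Y n ψ := by
  simp only [J, map_sub, LinearMap.sub_apply]

lemma J_smul (c : ℝ) (X : 𝔤) (n : ℤ) (ψ : 𝒥.D) : 𝒥.J (c • X) n ψ = (c : ℂ) • 𝒥.J X n ψ := by
  rw [← real_smul_eq]
  simp only [J, map_smul, LinearMap.smul_apply]

lemma J_neg (X : 𝔤) (n : ℤ) (ψ : 𝒥.D) : 𝒥.J (-X) n ψ = -𝒥.J X n ψ := by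
  simp only [J, map_neg, LinearMap.neg_apply]

lemma J_zero (n : ℤ) (ψ : 𝒥.D) : 𝒥.J 0 n ψ = 0 := by
  simp only [J, map_zero, LinearMap.zero_apply]

lemma J_sum {α : Type*} (S : Finset α) (X : α → 𝔤) (n : ℤ) (ψ : 𝒥.D) :
    𝒥.J (∑ a ∈ S, X a) n ψ = ∑ a ∈ S, 𝒥.J (X a) n ψ := by
  simp only [J, map_sum, LinearMap.sum_apply]

lemma integral_mode_deriv (n m : ℤ) : ∫ x : ℝ, (mode n).1 x * deriv (mode m).1 x =
    if n + m = 0 then Complex.I * m * ((2 * Real.pi : ℝ) : ℂ) else 0 := by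
  have h : ∀ x, (mode n).1 x * deriv (mode m).1 x =
      Complex.I * m * ((mode (n + m)).1 x * (angDensity x : ℂ)) := fun x => by
    rw [deriv_mode, ← mode_mul_apply]; ring
  simp_rw [h]
  rw [integral_const_mul, integral_mode]
  split_ifs <;> simp

/-- The commutation relations of the modes. -/
lemma J_comm (X Y : 𝔤) (n m : ℤ) (ψ : 𝒥.D) : 𝒥.J X n (𝒥.J Y m ψ) =
    𝒥.J Y m (𝒥.J X n ψ) + Complex.I • 𝒥.J ⁅X, Y⁆ (n + m) ψ +
      (if n + m = 0 then (k * n * metric 𝔤 X Y : ℂ) else 0) • ψ := by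
  have h := 𝒥.commutator X Y (mode n) (mode m) ψ
  rw [mode_mul, integral_mode_deriv] at h
  rw [add_assoc, ← sub_eq_iff_eq_add']
  simp only [J]
  rw [h]
  congr 2
  split_ifs with h0
  · have hpi : (Real.pi : ℂ) ≠ 0 := by exact_mod_cast Real.pi_ne_zero
    have hm : (m : ℂ) = -n := by
      have : (n + m : ℂ) = 0 := by exact_mod_cast h0
      linear_combination this
    push_cast
    rw [hm]
    field_simp
    rw [Complex.I_sq]; ring
  · simp

lemma J_adjoint (X : 𝔤) (n : ℤ) (φ ψ : 𝒥.D) :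
    inner ℂ φ (𝒥.J X n ψ) = inner ℂ (𝒥.J X (-n) φ) ψ := by
  rw [J, 𝒥.symmetric, conj_mode]; rfl

lemma L₀_J (X : 𝔤) (n : ℤ) (ψ : 𝒥.D) :
    𝒥.L₀ (𝒥.J X n ψ) = 𝒥.J X n (𝒥.L₀ ψ) - (n : ℂ) • 𝒥.J X n ψ := by
  have h := 𝒥.L₀_covariant X (mode n) ψ
  rw [l₀_mode, map_smul, LinearMap.smul_apply, smul_smul, ← mul_assoc, Complex.I_mul_I,
    neg_one_mul, neg_smul] at h
  rw [sub_eq_add_neg, ← sub_eq_iff_eq_add']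
  exact h

lemma L₀_vacuum : 𝒥.L₀ 𝒥.Ω = 0 := (𝒥.vacuum_unique _).2 ⟨1, (one_smul _ _).symm⟩

/-- Positivity of the energy: `⟨ψ, L₀ ψ⟩ = E ‖ψ‖²` cannot be negative. -/
lemma eq_zero_of_neg_energy {ψ : 𝒥.D} {E : ℤ} (h : 𝒥.L₀ ψ = (E : ℂ) • ψ) (hE : E < 0) : ψ = 0 := by
  have h1 := 𝒥.L₀_nonneg ψ
  rw [h, inner_smul_right, inner_self_eq_norm_sq_to_K] at h1
  have h2 : (((E : ℂ) * ((‖ψ‖ : ℝ) : ℂ) ^ 2)).re = E * ‖ψ‖ ^ 2 := by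
    rw [show ((E : ℂ) * ((‖ψ‖ : ℝ) : ℂ) ^ 2) = ((E * ‖ψ‖ ^ 2 : ℝ) : ℂ) by push_cast; ring,
      Complex.ofReal_re]
  have h3 : (0 : ℝ) ≤ E * ‖ψ‖ ^ 2 := by rw [← h2]; exact h1
  have hE' : (E : ℝ) < 0 := by exact_mod_cast hE
  have h4 : ‖ψ‖ ^ 2 = 0 := by nlinarith [sq_nonneg ‖ψ‖]
  exact norm_eq_zero.1 (pow_eq_zero_iff (two_ne_zero) |>.1 h4)

lemma L₀_J_energy {ψ : 𝒥.D} {E : ℤ} (h : 𝒥.L₀ ψ = (E : ℂ) • ψ) (X : 𝔤) (n : ℤ) :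
    𝒥.L₀ (𝒥.J X n ψ) = ((E - n : ℤ) : ℂ) • 𝒥.J X n ψ := by
  rw [L₀_J, h, map_smul, ← sub_smul]; push_cast; rfl

lemma J_eq_zero {ψ : 𝒥.D} {E : ℤ} (h : 𝒥.L₀ ψ = (E : ℂ) • ψ) (X : 𝔤) {n : ℤ} (hn : E < n) :
    𝒥.J X n ψ = 0 :=
  𝒥.eq_zero_of_neg_energy (𝒥.L₀_J_energy h X n) (by omega)

/-- Vectors of different energies are orthogonal. -/
lemma inner_eq_zero_of_energy {φ ψ : 𝒥.D} {E E' : ℤ} (hφ : 𝒥.L₀ φ = (E : ℂ) • φ)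
    (hψ : 𝒥.L₀ ψ = (E' : ℂ) • ψ) (hne : E ≠ E') : inner ℂ φ ψ = 0 := by
  have h := 𝒥.L₀_symmetric φ ψ
  rw [hφ, hψ, inner_smul_right, inner_smul_left] at h
  have hc : starRingEnd ℂ (E : ℂ) = E := by simp
  rw [hc, ← sub_eq_zero, ← sub_mul] at h
  rcases mul_eq_zero.1 h with h | h
  · exact absurd (by exact_mod_cast (sub_eq_zero.1 h).symm) hne
  · exact h

/-- The currents annihilate the vacuum, zero modes included. -/
lemma J_vacuum [FiniteDimensional ℝ 𝔤] [LieAlgebra.IsSimple ℝ 𝔤] (hcompact : IsCompactLie 𝔤)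
    (X : 𝔤) {n : ℤ} (hn : 0 ≤ n) : 𝒥.J X n 𝒥.Ω = 0 := by
  have hL : 𝒥.L₀ 𝒥.Ω = ((0 : ℤ) : ℂ) • 𝒥.Ω := by simp [L₀_vacuum]
  rcases hn.lt_or_eq with h | rfl
  · exact 𝒥.J_eq_zero hL X h
  -- Zero modes preserve the energy, so uniqueness of the vacuum makes `J^Y_0 Ω` a multiple of `Ω`.
  -- These scalars commute and the central term is absent at mode zero, so brackets annihilate `Ω`.
  have h0 : ∀ Y, ∃ c : ℂ, 𝒥.J Y 0 𝒥.Ω = c • 𝒥.Ω := fun Y =>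
    (𝒥.vacuum_unique _).1 (by rw [L₀_J, L₀_vacuum]; simp)
  have hbr : ∀ Y Z, 𝒥.J ⁅Y, Z⁆ 0 𝒥.Ω = 0 := fun Y Z => by
    obtain ⟨c, hc⟩ := h0 Y
    obtain ⟨c', hc'⟩ := h0 Z
    have h := 𝒥.J_comm Y Z 0 0 𝒥.Ω
    rw [hc', hc, map_smul, map_smul, hc, hc', smul_comm] at h
    simpa using h
  have := nontrivial_of_isSimple 𝔤
  have hB := isInvariantProduct_metricForm hcompact
  obtain ⟨u, hu, -⟩ := exists_orthonormal (Module.finBasis ℝ 𝔤) _ hB.comm hB.pos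
  -- As the adjoint Casimir operator is a nonzero scalar, every colour is a combination of brackets.
  have hcas := casimir_adjoint hcompact u hu X
  have hv := dualCoxeter_pos hcompact
  have h1 : 𝒥.J ((2 * dualCoxeter 𝔤) • X) 0 𝒥.Ω = 0 := by
    rw [← hcas, J_neg, J_sum, neg_eq_zero]
    exact Finset.sum_eq_zero fun a _ => hbr _ _
  rw [J_smul] at h1
  refine (smul_eq_zero.1 h1).resolve_left ?_
  exact_mod_cast (by positivity : (2 * dualCoxeter 𝔤) ≠ 0)

/-! ### Words in the modes -/

/-- Products of modes. -/
def word : List (𝔤 × ℤ) → 𝒥.D →ₗ[ℂ] 𝒥.D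
  | [] => LinearMap.id
  | p :: l => (𝒥.J p.1 p.2).comp (word l)

@[simp] lemma word_nil (ψ : 𝒥.D) : 𝒥.word [] ψ = ψ := rfl

@[simp] lemma word_cons (p : 𝔤 × ℤ) (l : List (𝔤 × ℤ)) (ψ : 𝒥.D) :
    𝒥.word (p :: l) ψ = 𝒥.J p.1 p.2 (𝒥.word l ψ) := rfl

lemma word_append (l l' : List (𝔤 × ℤ)) (ψ : 𝒥.D) :
    𝒥.word (l ++ l') ψ = 𝒥.word l (𝒥.word l' ψ) := by
  induction l with
  | nil => rfl
  | cons p l ih => simp [ih]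

/-- A weight that controls the growth of words in the mode numbers. -/
def wordWeight {V : Type*} (l : List (V × ℤ)) : ℝ := (l.map fun p => 1 + |(p.2 : ℝ)|).prod

@[simp] lemma wordWeight_nil {V : Type*} : wordWeight ([] : List (V × ℤ)) = 1 := rfl

@[simp] lemma wordWeight_cons {V : Type*} (p : V × ℤ) (l : List (V × ℤ)) :
    wordWeight (p :: l) = (1 + |(p.2 : ℝ)|) * wordWeight l := by
  simp [wordWeight]

@[simp] lemma wordWeight_append {V : Type*} (l l' : List (V × ℤ)) :
    wordWeight (l ++ l') = wordWeight l * wordWeight l' := by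
  simp [wordWeight]

lemma one_le_wordWeight {V : Type*} (l : List (V × ℤ)) : 1 ≤ wordWeight l := by
  induction l with
  | nil => simp
  | cons p l ih =>
    rw [wordWeight_cons]
    nlinarith [abs_nonneg (p.2 : ℝ)]

/-- The formal adjoint of a word. -/
def adjWord {V : Type*} (l : List (V × ℤ)) : List (V × ℤ) := (l.map fun p => (p.1, -p.2)).reverse

lemma wordWeight_adjWord {V : Type*} (l : List (V × ℤ)) : wordWeight (adjWord l) = wordWeight l := by
  induction l with
  | nil => rfl
  | cons p l ih =>
    simp only [adjWord, List.map_cons, List.reverse_cons, wordWeight_append, wordWeight_cons,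
      wordWeight_nil] at ih ⊢
    rw [ih]; simp [mul_comm]

lemma inner_word (l : List (𝔤 × ℤ)) (φ ψ : 𝒥.D) :
    inner ℂ (𝒥.word l φ) ψ = inner ℂ φ (𝒥.word (adjWord l) ψ) := by
  induction l generalizing ψ with
  | nil => rfl
  | cons p l ih =>
    have h : 𝒥.word (adjWord (p :: l)) ψ = 𝒥.word (adjWord l) (𝒥.J p.1 (-p.2) ψ) := by
      simp [adjWord, word_append]
    rw [h, ← ih, J_adjoint, neg_neg, word_cons]

lemma one_add_abs_add_le (n m : ℤ) :
    1 + |((n + m : ℤ) : ℝ)| ≤ (1 + |(n : ℝ)|) * (1 + |(m : ℝ)|) := by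
  push_cast
  have := abs_add_le (n : ℝ) m
  nlinarith [mul_nonneg (abs_nonneg (n : ℝ)) (abs_nonneg (m : ℝ))]

/-! ### Polynomial bounds on vacuum expectation values -/

section Bounds

variable (hΩ : ∀ X n, 0 ≤ n → 𝒥.J X n 𝒥.Ω = 0)

include hΩ

/-- A mode with `n ≥ 0` is moved to the right until it annihilates the vacuum. Each exchange
produces a word shorter by one (bracket) and one shorter by two (central term), both covered by
`ih`; the inner induction runs over the letters still to be passed. The submultiplicative weight
accommodates the merged mode `n + m`. -/
lemma vev_bound_insert (N : ℕ)
    (ih : ∀ Xs : List 𝔤, Xs.length < N → ∃ C : ℝ, 0 ≤ C ∧ ∀ l : List (𝔤 × ℤ), l.map Prod.fst = Xs →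
      ‖inner ℂ 𝒥.Ω (𝒥.word l 𝒥.Ω)‖ ≤ C * wordWeight l) (X : 𝔤) (post : List 𝔤) :
    ∀ pre : List 𝔤, pre.length + post.length < N → ∃ C : ℝ, 0 ≤ C ∧
      ∀ (l l' : List (𝔤 × ℤ)) (n : ℤ), l.map Prod.fst = pre → l'.map Prod.fst = post → 0 ≤ n →
        ‖inner ℂ 𝒥.Ω (𝒥.word l (𝒥.J X n (𝒥.word l' 𝒥.Ω)))‖ ≤
          C * (wordWeight l * (1 + |(n : ℝ)|) * wordWeight l') := by
  induction post with
  | nil =>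
    intro pre _
    refine ⟨0, le_rfl, fun l l' n _ hl' hn => ?_⟩
    have : l' = [] := by simpa using hl'
    subst this
    simp [hΩ X n hn]
  | cons Y post ihp =>
    intro pre hlen
    simp only [List.length_cons] at hlen
    obtain ⟨C₁, hC₁, h₁⟩ := ihp (pre ++ [Y]) (by simp; omega)
    obtain ⟨C₂, hC₂, h₂⟩ := ih (pre ++ ⁅X, Y⁆ :: post) (by simp; omega)
    obtain ⟨C₃, hC₃, h₃⟩ := ih (pre ++ post) (by simp; omega)
    refine ⟨C₁ + C₂ + C₃ * (k * |metric 𝔤 X Y|), by positivity, fun l l'' n hl hl'' hn => ?_⟩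
    obtain ⟨⟨Y', m⟩, l', rfl, hY, hl'⟩ := List.map_eq_cons_iff.1 hl''
    simp only at hY
    subst hY
    have hW := one_le_wordWeight l
    have hW' := one_le_wordWeight l'
    have hn1 : 0 ≤ |(n : ℝ)| := abs_nonneg _
    have hm1 : 0 ≤ |(m : ℝ)| := abs_nonneg _
    have e₁ := h₁ (l ++ [(Y', m)]) l' n (by simp [hl]) hl' hn
    have e₂ := h₂ (l ++ (⁅X, Y'⁆, n + m) :: l') (by simp [hl, hl'])
    have e₃ := h₃ (l ++ l') (by simp [hl, hl'])
    simp only [word_append, word_cons, word_nil, wordWeight_append, wordWeight_cons,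
      wordWeight_nil, mul_one] at e₁ e₂ e₃ ⊢
    rw [J_comm, map_add, map_add, map_smul, map_smul, inner_add_right, inner_add_right,
      inner_smul_right, inner_smul_right]
    have hc : ‖(if n + m = 0 then (k * n * metric 𝔤 X Y' : ℂ) else 0)‖ ≤
        k * |metric 𝔤 X Y'| * |(n : ℝ)| := by
      split_ifs
      · rw [norm_mul, norm_mul, Complex.norm_natCast, Complex.norm_intCast, Complex.norm_real,
          Real.norm_eq_abs]
        exact le_of_eq (by ring)
      · rw [norm_zero]; positivity
    set w := wordWeight l
    set w' := wordWeight l'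
    have hnm := one_add_abs_add_le n m
    have f₂ : C₂ * (w * ((1 + |((n + m : ℤ) : ℝ)|) * w')) ≤
        C₂ * (w * (1 + |(n : ℝ)|) * ((1 + |(m : ℝ)|) * w')) := by
      have : w * ((1 + |((n + m : ℤ) : ℝ)|) * w') ≤
          w * (((1 + |(n : ℝ)|) * (1 + |(m : ℝ)|)) * w') := by gcongr
      calc _ ≤ C₂ * (w * (((1 + |(n : ℝ)|) * (1 + |(m : ℝ)|)) * w')) := by gcongr
        _ = _ := by ring
    have f₃ : k * |metric 𝔤 X Y'| * |(n : ℝ)| * (C₃ * (w * w')) ≤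
        C₃ * (k * |metric 𝔤 X Y'|) * (w * (1 + |(n : ℝ)|) * ((1 + |(m : ℝ)|) * w')) := by
      have h1 : |(n : ℝ)| * 1 ≤ (1 + |(n : ℝ)|) * (1 + |(m : ℝ)|) := by
        gcongr <;> linarith
      calc _ = C₃ * (k * |metric 𝔤 X Y'|) * (w * w') * (|(n : ℝ)| * 1) := by ring
        _ ≤ C₃ * (k * |metric 𝔤 X Y'|) * (w * w') * ((1 + |(n : ℝ)|) * (1 + |(m : ℝ)|)) := by
          gcongr
        _ = _ := by ring
    refine (norm_add_le _ _).trans ((add_le_add (norm_add_le _ _) le_rfl).trans ?_)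
    rw [norm_mul, norm_mul, Complex.norm_I, one_mul]
    have e₃' : ‖(if n + m = 0 then (k * n * metric 𝔤 X Y' : ℂ) else 0)‖ *
        ‖inner ℂ 𝒥.Ω (𝒥.word l (𝒥.word l' 𝒥.Ω))‖ ≤
          k * |metric 𝔤 X Y'| * |(n : ℝ)| * (C₃ * (w * w')) := by gcongr
    have e₁' : C₁ * (w * (1 + |(m : ℝ)|) * (1 + |(n : ℝ)|) * w') =
      C₁ * (w * (1 + |(n : ℝ)|) * ((1 + |(m : ℝ)|) * w')) := by ring
    rw [e₁'] at e₁
    calc _ ≤ C₁ * (w * (1 + |(n : ℝ)|) * ((1 + |(m : ℝ)|) * w')) +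
          C₂ * (w * (1 + |(n : ℝ)|) * ((1 + |(m : ℝ)|) * w')) +
          C₃ * (k * |metric 𝔤 X Y'|) * (w * (1 + |(n : ℝ)|) * ((1 + |(m : ℝ)|) * w')) :=
          add_le_add (add_le_add e₁ (e₂.trans f₂)) (e₃'.trans f₃)
      _ = _ := by ring

/-- Polynomial bounds on vacuum expectation values. -/
lemma vev_bound (Xs : List 𝔤) : ∃ C : ℝ, 0 ≤ C ∧ ∀ l : List (𝔤 × ℤ), l.map Prod.fst = Xs →
    ‖inner ℂ 𝒥.Ω (𝒥.word l 𝒥.Ω)‖ ≤ C * wordWeight l := by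
  suffices h : ∀ N, ∀ Xs : List 𝔤, Xs.length < N → ∃ C : ℝ, 0 ≤ C ∧ ∀ l : List (𝔤 × ℤ),
      l.map Prod.fst = Xs → ‖inner ℂ 𝒥.Ω (𝒥.word l 𝒥.Ω)‖ ≤ C * wordWeight l from
    h _ Xs (Nat.lt_succ_self _)
  intro N
  induction N with
  | zero => intro Xs h; simp at h
  | succ N ih =>
    intro Xs hlen
    cases Xs with
    | nil =>
      refine ⟨‖inner ℂ 𝒥.Ω 𝒥.Ω‖, norm_nonneg _, fun l hl => ?_⟩
      have : l = [] := by simpa using hl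
      subst this; simp
    | cons X Xs =>
      obtain ⟨C, hC, h⟩ := 𝒥.vev_bound_insert hΩ N ih X Xs [] (by simpa using hlen)
      refine ⟨C, hC, fun l hl => ?_⟩
      obtain ⟨⟨X', n⟩, l', rfl, hX, hl'⟩ := List.map_eq_cons_iff.1 hl
      simp only at hX
      subst hX
      by_cases hn : 0 ≤ n
      · have := h [] l' n rfl hl' hn
        simpa using this
      -- A leading creation mode annihilates the vacuum on its left.
      · rw [word_cons, J_adjoint, hΩ _ _ (by simp only; omega), inner_zero_left, norm_zero]
        have := one_le_wordWeight ((X', n) :: l')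
        positivity

/-- Polynomial bounds on the norms of words applied to the vacuum. -/
lemma word_bound (Xs : List 𝔤) : ∃ C : ℝ, 0 ≤ C ∧ ∀ l : List (𝔤 × ℤ), l.map Prod.fst = Xs →
    ‖𝒥.word l 𝒥.Ω‖ ≤ C * wordWeight l := by
  obtain ⟨C, hC, h⟩ := 𝒥.vev_bound hΩ (Xs.reverse ++ Xs)
  refine ⟨Real.sqrt C, Real.sqrt_nonneg _, fun l hl => ?_⟩
  -- The squared norm is a vacuum expectation value of twice the length, with weight `wordWeight l ^
  -- 2`.
  have h1 := h (adjWord l ++ l) (by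
    simp only [adjWord, List.map_append, List.map_reverse, List.map_map, hl]
    rw [← hl]
    congr 1)
  rw [word_append, ← inner_word, wordWeight_append, wordWeight_adjWord,
    inner_self_eq_norm_sq_to_K] at h1
  have hw := one_le_wordWeight l
  refine le_of_sq_le_sq ?_ (by positivity)
  rw [mul_pow, Real.sq_sqrt hC]
  have h2 : ‖((‖𝒥.word l 𝒥.Ω‖ : ℝ) : ℂ) ^ 2‖ = ‖𝒥.word l 𝒥.Ω‖ ^ 2 := by
    rw [norm_pow, Complex.norm_real, norm_norm]
  calc _ = _ := h2.symm
    _ ≤ C * (wordWeight l * wordWeight l) := h1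
    _ = _ := by ring

end Bounds

end Currents

end CurrentAlg
end

noncomputable section

namespace CurrentAlg

namespace Currents

open TestFun MeasureTheory

variable {𝔤 : Type*} [LieRing 𝔤] [LieAlgebra ℝ 𝔤] {k : ℕ} {H : Type*}
  [NormedAddCommGroup H] [InnerProductSpace ℂ H] (𝒥 : Currents 𝔤 k H)

/-! ### Normal ordered products -/

/-- `ψ` is annihilated by all modes with mode number above `E`. -/
def Annih (E : ℤ) (ψ : 𝒥.D) : Prop := ∀ X n, E < n → 𝒥.J X n ψ = 0

/-- The terms of the sum that defines the modes of a normal ordered product. -/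
def normalTerm (X Y : 𝔤) (n m : ℤ) (ψ : 𝒥.D) : 𝒥.D :=
  if m < 0 then 𝒥.J X m (𝒥.J Y (n - m) ψ) else 𝒥.J Y (n - m) (𝒥.J X m ψ)

variable {𝒥}

lemma Annih.mono {E E' : ℤ} {ψ : 𝒥.D} (h : 𝒥.Annih E ψ) (hE : E ≤ E') : 𝒥.Annih E' ψ :=
  fun X n hn => h X n (by omega)

lemma Annih.add {E : ℤ} {φ ψ : 𝒥.D} (hφ : 𝒥.Annih E φ) (hψ : 𝒥.Annih E ψ) :
    𝒥.Annih E (φ + ψ) := fun X n hn => by rw [map_add, hφ X n hn, hψ X n hn, add_zero]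

lemma Annih.smul {E : ℤ} {ψ : 𝒥.D} (hψ : 𝒥.Annih E ψ) (c : ℂ) : 𝒥.Annih E (c • ψ) :=
  fun X n hn => by rw [map_smul, hψ X n hn, smul_zero]

lemma Annih.J {E : ℤ} {ψ : 𝒥.D} (h : 𝒥.Annih E ψ) (X : 𝔤) (n : ℤ) :
    𝒥.Annih (|E| + |n|) (𝒥.J X n ψ) := fun Y m hm => by
  have h1 := abs_nonneg E
  have h2 := abs_nonneg n
  have h3 := neg_abs_le n
  have h4 := le_abs_self E
  rw [J_comm, h Y m (by omega), h _ (m + n) (by omega), if_neg (by omega)]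
  simp

lemma normalTerm_eq_zero {E n m a b : ℤ} {ψ : 𝒥.D} (h : 𝒥.Annih E ψ) (X Y : 𝔤) (ha : a ≤ 0)
    (ha' : a ≤ n - E) (hb : 0 ≤ b) (hb' : E ≤ b) (hm : m ∉ Finset.Icc a b) :
    𝒥.normalTerm X Y n m ψ = 0 := by
  rw [Finset.mem_Icc, not_and_or] at hm
  unfold normalTerm
  split_ifs with h0
  · rw [h Y _ (by omega), map_zero]
  · rw [h X _ (by omega), map_zero]

/-- Any sufficiently large window may be used; sums for different vectors or shifted indices can
thus be compared term by term. -/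
lemma normalMode_eq_sum {E n a b : ℤ} {ψ : 𝒥.D} (h : 𝒥.Annih E ψ) (X Y : 𝔤) (ha : a ≤ 0)
    (ha' : a ≤ n - E) (hb : 0 ≤ b) (hb' : E ≤ b) :
    𝒥.normalMode X Y n ψ = ∑ m ∈ Finset.Icc a b, 𝒥.normalTerm X Y n m ψ := by
  refine finsum_eq_sum_of_support_subset _ fun m hm => ?_
  by_contra hm'
  exact hm (normalTerm_eq_zero h X Y ha ha' hb hb' (by simpa using hm'))

/-- A `finsum` is additive only for finite supports, so a common annihilation bound `E` provides one
window for all three sums. -/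
lemma normalMode_add {E : ℤ} {φ ψ : 𝒥.D} (hφ : 𝒥.Annih E φ) (hψ : 𝒥.Annih E ψ) (X Y : 𝔤) (n : ℤ) :
    𝒥.normalMode X Y n (φ + ψ) = 𝒥.normalMode X Y n φ + 𝒥.normalMode X Y n ψ := by
  have ha : min 0 (n - E) ≤ 0 := min_le_left _ _
  have ha' : min 0 (n - E) ≤ n - E := min_le_right _ _
  have hb : 0 ≤ max 0 E := le_max_left _ _
  have hb' : E ≤ max 0 E := le_max_right _ _
  rw [normalMode_eq_sum (hφ.add hψ) X Y ha ha' hb hb', normalMode_eq_sum hφ X Y ha ha' hb hb',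
    normalMode_eq_sum hψ X Y ha ha' hb hb', ← Finset.sum_add_distrib]
  refine Finset.sum_congr rfl fun m _ => ?_
  unfold normalTerm
  split_ifs <;> simp only [map_add]

lemma normalMode_smul {E : ℤ} {ψ : 𝒥.D} (hψ : 𝒥.Annih E ψ) (c : ℂ) (X Y : 𝔤) (n : ℤ) :
    𝒥.normalMode X Y n (c • ψ) = c • 𝒥.normalMode X Y n ψ := by
  have ha : min 0 (n - E) ≤ 0 := min_le_left _ _
  have ha' : min 0 (n - E) ≤ n - E := min_le_right _ _
  have hb : 0 ≤ max 0 E := le_max_left _ _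
  have hb' : E ≤ max 0 E := le_max_right _ _
  rw [normalMode_eq_sum (hψ.smul c) X Y ha ha' hb hb', normalMode_eq_sum hψ X Y ha ha' hb hb',
    Finset.smul_sum]
  refine Finset.sum_congr rfl fun m _ => ?_
  unfold normalTerm
  split_ifs <;> simp only [map_smul]

lemma normalTerm_add_left (X X' Y : 𝔤) (n m : ℤ) (ψ : 𝒥.D) : 𝒥.normalTerm (X + X') Y n m ψ =
    𝒥.normalTerm X Y n m ψ + 𝒥.normalTerm X' Y n m ψ := by
  unfold normalTerm
  split_ifs <;> simp only [J_add, map_add]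

lemma normalTerm_add_right (X Y Y' : 𝔤) (n m : ℤ) (ψ : 𝒥.D) : 𝒥.normalTerm X (Y + Y') n m ψ =
    𝒥.normalTerm X Y n m ψ + 𝒥.normalTerm X Y' n m ψ := by
  unfold normalTerm
  split_ifs <;> simp only [J_add, map_add]

lemma normalTerm_smul_left (c : ℝ) (X Y : 𝔤) (n m : ℤ) (ψ : 𝒥.D) :
    𝒥.normalTerm (c • X) Y n m ψ = c • 𝒥.normalTerm X Y n m ψ := by
  unfold normalTerm
  split_ifs <;> simp only [J_smul, map_smul, real_smul_eq]

lemma normalTerm_smul_right (c : ℝ) (X Y : 𝔤) (n m : ℤ) (ψ : 𝒥.D) :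
    𝒥.normalTerm X (c • Y) n m ψ = c • 𝒥.normalTerm X Y n m ψ := by
  unfold normalTerm
  split_ifs <;> simp only [J_smul, map_smul, real_smul_eq]

/-- The modes of normal ordered products as a bilinear map of the colours. -/
def normalBilin {E : ℤ} {ψ : 𝒥.D} (h : 𝒥.Annih E ψ) (n : ℤ) : 𝔤 →ₗ[ℝ] 𝔤 →ₗ[ℝ] 𝒥.D :=
  LinearMap.mk₂ ℝ (fun X Y => 𝒥.normalMode X Y n ψ)
    (fun X X' Y => by
      simp only [normalMode_eq_sum h _ _ (min_le_left 0 (n - E)) (min_le_right 0 (n - E))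
        (le_max_left 0 E) (le_max_right 0 E), normalTerm_add_left, Finset.sum_add_distrib])
    (fun c X Y => by
      simp only [normalMode_eq_sum h _ _ (min_le_left 0 (n - E)) (min_le_right 0 (n - E))
        (le_max_left 0 E) (le_max_right 0 E), normalTerm_smul_left, Finset.smul_sum])
    (fun X Y Y' => by
      simp only [normalMode_eq_sum h _ _ (min_le_left 0 (n - E)) (min_le_right 0 (n - E))
        (le_max_left 0 E) (le_max_right 0 E), normalTerm_add_right, Finset.sum_add_distrib])
    (fun c X Y => by
      simp only [normalMode_eq_sum h _ _ (min_le_left 0 (n - E)) (min_le_right 0 (n - E))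
        (le_max_left 0 E) (le_max_right 0 E), normalTerm_smul_right, Finset.smul_sum])

lemma normalBilin_apply {E : ℤ} {ψ : 𝒥.D} (h : 𝒥.Annih E ψ) (n : ℤ) (X Y : 𝔤) :
    normalBilin h n X Y = 𝒥.normalMode X Y n ψ := rfl

/-! ### Families of polynomial growth -/

/-- A family of energy eigenvectors on which words in the modes have polynomial bounds. -/
structure Tame {I : Type*} (σ : I → ℝ) (E : I → ℤ) (f : I → 𝒥.D) : Prop where
  one_le : ∀ i, 1 ≤ σ i
  energy : ∀ i, 𝒥.L₀ (f i) = (E i : ℂ) • f i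
  energy_le : ∀ i, |(E i : ℝ)| ≤ σ i
  bound : ∀ Xs : List 𝔤, ∃ (C : ℝ) (N : ℕ), 0 ≤ C ∧ ∀ l : List (𝔤 × ℤ), l.map Prod.fst = Xs →
    ∀ i, ‖𝒥.word l (f i)‖ ≤ C * (wordWeight l * σ i) ^ N

namespace Tame

variable {I : Type*} {σ : I → ℝ} {E : I → ℤ} {f g : I → 𝒥.D}

lemma annih (h : Tame σ E f) (i : I) : 𝒥.Annih (E i) (f i) :=
  fun X _ hn => 𝒥.J_eq_zero (h.energy i) X hn

lemma norm_le (h : Tame σ E f) : ∃ (C : ℝ) (N : ℕ), 0 ≤ C ∧ ∀ i, ‖f i‖ ≤ C * σ i ^ N := by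
  obtain ⟨C, N, hC, hb⟩ := h.bound []
  exact ⟨C, N, hC, fun i => by simpa using hb [] rfl i⟩

lemma add (hf : Tame σ E f) (hg : Tame σ E g) : Tame σ E fun i => f i + g i where
  one_le := hf.one_le
  energy i := by rw [map_add, hf.energy, hg.energy, smul_add]
  energy_le := hf.energy_le
  bound Xs := by
    obtain ⟨C, N, hC, hb⟩ := hf.bound Xs
    obtain ⟨C', N', hC', hb'⟩ := hg.bound Xs
    refine ⟨C + C', N + N', by positivity, fun l hl i => ?_⟩
    have h1 : 1 ≤ wordWeight l * σ i :=
      one_le_mul_of_one_le_of_one_le (one_le_wordWeight l) (hf.one_le i)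
    rw [map_add, add_mul]
    refine (norm_add_le _ _).trans (add_le_add ((hb l hl i).trans ?_) ((hb' l hl i).trans ?_))
    · exact mul_le_mul_of_nonneg_left (pow_le_pow_right₀ h1 (by omega)) hC
    · exact mul_le_mul_of_nonneg_left (pow_le_pow_right₀ h1 (by omega)) hC'

lemma smul (hf : Tame σ E f) (c : ℂ) : Tame σ E fun i => c • f i where
  one_le := hf.one_le
  energy i := by rw [map_smul, hf.energy, smul_comm]
  energy_le := hf.energy_le
  bound Xs := by
    obtain ⟨C, N, hC, hb⟩ := hf.bound Xs
    refine ⟨‖c‖ * C, N, by positivity, fun l hl i => ?_⟩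
    rw [map_smul, norm_smul, mul_assoc]
    exact mul_le_mul_of_nonneg_left (hb l hl i) (norm_nonneg c)

lemma real_smul (hf : Tame σ E f) (c : ℝ) : Tame σ E fun i => c • f i := by
  simpa only [real_smul_eq] using hf.smul c

lemma sub (hf : Tame σ E f) (hg : Tame σ E g) : Tame σ E fun i => f i - g i := by
  simpa only [sub_eq_add_neg, neg_one_smul] using hf.add (hg.smul (-1))

lemma zero (hf : Tame σ E f) : Tame σ E fun _ => (0 : 𝒥.D) := by
  simpa using hf.smul 0

lemma sum {α : Type*} (S : Finset α) {F : α → I → 𝒥.D} (h0 : Tame σ E f)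
    (h : ∀ a ∈ S, Tame σ E (F a)) : Tame σ E fun i => ∑ a ∈ S, F a i := by
  classical
  induction S using Finset.induction_on with
  | empty => simpa using h0.zero
  | insert a S ha ih =>
    simp only [Finset.sum_insert ha]
    exact (h a (by simp)).add (ih fun b hb => h b (by simp [hb]))

lemma comp (h : Tame σ E f) {I' : Type*} (φ : I' → I) :
    Tame (fun i => σ (φ i)) (fun i => E (φ i)) fun i => f (φ i) where
  one_le i := h.one_le _
  energy i := h.energy _
  energy_le i := h.energy_le _
  bound Xs := by
    obtain ⟨C, N, hC, hb⟩ := h.bound Xs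
    exact ⟨C, N, hC, fun l hl i => hb l hl _⟩

lemma energy_sub_le (h : Tame σ E f) (i : I) (n : ℤ) :
    |((E i - n : ℤ) : ℝ)| ≤ σ i * (1 + |(n : ℝ)|) := by
  have h1 := h.one_le i
  have h2 := h.energy_le i
  have h3 := abs_nonneg (n : ℝ)
  push_cast
  calc |(E i : ℝ) - n| ≤ |(E i : ℝ)| + |(n : ℝ)| := abs_sub _ _
    _ ≤ _ := by nlinarith

lemma one_le_mul (h : Tame σ E f) (i : I) (n : ℤ) : 1 ≤ σ i * (1 + |(n : ℝ)|) :=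
  one_le_mul_of_one_le_of_one_le (h.one_le i) (by linarith [abs_nonneg (n : ℝ)])

/-- Tame families remain tame when a mode is applied. -/
lemma J (h : Tame σ E f) (X : 𝔤) : Tame (fun p : I × ℤ => σ p.1 * (1 + |(p.2 : ℝ)|))
    (fun p => E p.1 - p.2) fun p => 𝒥.J X p.2 (f p.1) where
  one_le p := h.one_le_mul _ _
  energy p := 𝒥.L₀_J_energy (h.energy _) X _
  energy_le p := h.energy_sub_le _ _
  bound Xs := by
    obtain ⟨C, N, hC, hb⟩ := h.bound (Xs ++ [X])
    refine ⟨C, N, hC, fun l hl p => ?_⟩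
    have := hb (l ++ [(X, p.2)]) (by simp [hl]) p.1
    rw [word_append, wordWeight_append] at this
    simp only [word_cons, word_nil, wordWeight_cons, wordWeight_nil, mul_one] at this
    calc _ ≤ _ := this
      _ = _ := by ring

lemma L₀_normalTerm (h : Tame σ E f) (X Y : 𝔤) (n m : ℤ) (i : I) :
    𝒥.L₀ (𝒥.normalTerm X Y n m (f i)) = ((E i - n : ℤ) : ℂ) • 𝒥.normalTerm X Y n m (f i) := by
  unfold normalTerm
  split_ifs
  · rw [𝒥.L₀_J_energy (𝒥.L₀_J_energy (h.energy i) Y _) X]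
    congr 2; ring
  · rw [𝒥.L₀_J_energy (𝒥.L₀_J_energy (h.energy i) X _) Y]
    congr 2; ring

/-- Tame families remain tame when a mode of a normal ordered product is applied. -/
lemma normal (h : Tame σ E f) (X Y : 𝔤) : Tame (fun p : I × ℤ => σ p.1 * (1 + |(p.2 : ℝ)|))
    (fun p => E p.1 - p.2) fun p => 𝒥.normalMode X Y p.2 (f p.1) := by
  have hsum : ∀ i n, 𝒥.normalMode X Y n (f i) =
      ∑ m ∈ Finset.Icc (-(|n| + |E i|)) (|n| + |E i|), 𝒥.normalTerm X Y n m (f i) := fun i n => by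
    have h1 := abs_nonneg (E i)
    have h2 := abs_nonneg n
    have h3 := neg_abs_le n
    have h4 := le_abs_self (E i)
    exact normalMode_eq_sum (h.annih i) X Y (by omega) (by omega) (by omega) (by omega)
  refine ⟨fun p => h.one_le_mul _ _, fun p => ?_, fun p => h.energy_sub_le _ _, fun Xs => ?_⟩
  · rw [hsum, map_sum, Finset.smul_sum]
    exact Finset.sum_congr rfl fun m _ => h.L₀_normalTerm X Y _ _ _
  · obtain ⟨C, N, hC, hb⟩ := h.bound (Xs ++ [X, Y])
    obtain ⟨C', N', hC', hb'⟩ := h.bound (Xs ++ [Y, X])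
    -- With `s = σ (1 + |n|)` there are at most `3 s` nonzero terms. In each of them the two mode
    -- factors and `σ` are bounded by `2 s`, `3 s` and `s`, which explains the `6` and the cube.
    refine ⟨3 * ((C + C') * 6 ^ (N + N')), 1 + 3 * (N + N'), by positivity, fun l hl p => ?_⟩
    obtain ⟨i, n⟩ := p
    simp only
    have hσ := h.one_le i
    have hE := h.energy_le i
    have hn := abs_nonneg (n : ℝ)
    set s := σ i * (1 + |(n : ℝ)|) with hs
    have hs1 : 1 ≤ s := h.one_le_mul i n
    have hw := one_le_wordWeight l
    have hns : |(n : ℝ)| + |(E i : ℝ)| ≤ s := by nlinarith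
    have hns' : |(n : ℝ)| ≤ s := by nlinarith
    have hσs : σ i ≤ s := by nlinarith
    have hterm : ∀ m ∈ Finset.Icc (-(|n| + |E i|)) (|n| + |E i|),
        ‖𝒥.word l (𝒥.normalTerm X Y n m (f i))‖ ≤
          (C + C') * (6 * (wordWeight l * s ^ 3)) ^ (N + N') := by
      intro m hm
      have hm1 : |m| ≤ |n| + |E i| := abs_le.2 (Finset.mem_Icc.1 hm)
      have hm2 : |(m : ℝ)| ≤ s := by
        have : ((|m| : ℤ) : ℝ) ≤ ((|n| + |E i| : ℤ) : ℝ) := by exact_mod_cast hm1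
        push_cast at this
        linarith
      have hnm : |((n - m : ℤ) : ℝ)| ≤ 2 * s := by
        push_cast
        linarith [abs_sub (n : ℝ) m]
      have hx : wordWeight l * ((1 + |(m : ℝ)|) * (1 + |((n - m : ℤ) : ℝ)|)) * σ i ≤
          6 * (wordWeight l * s ^ 3) := by
        calc _ ≤ wordWeight l * ((s + s) * (s + 2 * s)) * s := by gcongr
          _ = _ := by ring
      have hx1 : 1 ≤ 6 * (wordWeight l * s ^ 3) := by
        have : 1 ≤ wordWeight l * s ^ 3 := one_le_mul_of_one_le_of_one_le hw (one_le_pow₀ hs1)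
        linarith
      have key : ∀ (c : ℝ) (M : ℕ), 0 ≤ c → c ≤ C + C' → M ≤ N + N' →
          c * (wordWeight l * ((1 + |(m : ℝ)|) * (1 + |((n - m : ℤ) : ℝ)|)) * σ i) ^ M ≤
            (C + C') * (6 * (wordWeight l * s ^ 3)) ^ (N + N') := by
        intro c M hc hcC hM
        calc _ ≤ c * (6 * (wordWeight l * s ^ 3)) ^ M := by gcongr
          _ ≤ (C + C') * (6 * (wordWeight l * s ^ 3)) ^ (N + N') := by gcongr
      unfold normalTerm
      split_ifs
      · have := hb (l ++ [(X, m), (Y, n - m)]) (by simp [hl]) i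
        rw [word_append, wordWeight_append] at this
        simp only [word_cons, word_nil, wordWeight_cons, wordWeight_nil, mul_one] at this
        exact this.trans (key C N hC (by linarith) (by omega))
      · have := hb' (l ++ [(Y, n - m), (X, m)]) (by simp [hl]) i
        rw [word_append, wordWeight_append] at this
        simp only [word_cons, word_nil, wordWeight_cons, wordWeight_nil, mul_one] at this
        rw [mul_comm (1 + |((n - m : ℤ) : ℝ)|)] at this
        exact this.trans (key C' N' hC' (by linarith) (by omega))
    rw [hsum, map_sum]
    have hcard : ((Finset.Icc (-(|n| + |E i|)) (|n| + |E i|)).card : ℝ) ≤ 3 * s := by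
      rw [Int.card_Icc]
      have h1 := abs_nonneg (E i)
      have h2 := abs_nonneg n
      have : (((|n| + |E i| + 1 - -(|n| + |E i|)).toNat : ℤ) : ℝ) =
          ((|n| + |E i| + 1 - -(|n| + |E i|) : ℤ) : ℝ) := by
        rw [Int.toNat_of_nonneg (by omega)]
      rw [Int.cast_natCast] at this
      rw [this]
      push_cast
      linarith
    have hws : s ≤ wordWeight l * s := le_mul_of_one_le_left (by linarith) hw
    have hws3 : wordWeight l * s ^ 3 ≤ (wordWeight l * s) ^ 3 := by
      rw [mul_pow (wordWeight l) s 3]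
      exact mul_le_mul_of_nonneg_right (le_self_pow₀ hw three_ne_zero) (by positivity)
    refine (norm_sum_le_of_le _ hterm).trans ?_
    rw [Finset.sum_const, nsmul_eq_mul]
    calc _ ≤ 3 * s * ((C + C') * (6 * (wordWeight l * s ^ 3)) ^ (N + N')) := by gcongr
      _ ≤ 3 * (wordWeight l * s) * ((C + C') * (6 * (wordWeight l * s) ^ 3) ^ (N + N')) := by
        gcongr
      _ = _ := by rw [mul_pow, ← pow_mul]; ring

end Tame

lemma tame_vacuum (hΩ : ∀ X n, 0 ≤ n → 𝒥.J X n 𝒥.Ω = 0) :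
    Tame (fun _ : Unit => 1) (fun _ => 0) fun _ => 𝒥.Ω where
  one_le _ := le_rfl
  energy _ := by simp [L₀_vacuum]
  energy_le _ := by simp
  bound Xs := by
    obtain ⟨C, hC, h⟩ := 𝒥.word_bound hΩ Xs
    exact ⟨C, 1, hC, fun l hl _ => by simpa using h l hl⟩

end Currents

end CurrentAlg
end

noncomputable section

namespace CurrentAlg

namespace Currents

variable {𝔤 : Type*} [LieRing 𝔤] [LieAlgebra ℝ 𝔤] {k : ℕ} {H : Type*}
  [NormedAddCommGroup H] [InnerProductSpace ℂ H] {𝒥 : Currents 𝔤 k H}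

/-! ### Commutators of currents and normal ordered products -/

/-- Counts, with sign, the indices that change sides when the normal ordering threshold moves from
`l < 0` to `l + m < 0`. -/
lemma sum_ite_neg_sub (B m : ℤ) (hB : |m| ≤ B) :
    ∑ l ∈ Finset.Icc (-B) B, ((if l < 0 then (1 : ℂ) else 0) - if l + m < 0 then 1 else 0) = m := by
  have h1 := neg_abs_le m
  have h2 := le_abs_self m
  rw [Finset.sum_sub_distrib, Finset.sum_boole, Finset.sum_boole]
  have e1 : (Finset.Icc (-B) B).filter (fun l => l < 0) = Finset.Icc (-B) (-1) := by
    ext l; simp only [Finset.mem_filter, Finset.mem_Icc]; omega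
  have e2 : (Finset.Icc (-B) B).filter (fun l => l + m < 0) = Finset.Icc (-B) (-m - 1) := by
    ext l; simp only [Finset.mem_filter, Finset.mem_Icc]; omega
  rw [e1, e2, Int.card_Icc, Int.card_Icc]
  have f1 : (((-1 + 1 - -B).toNat : ℤ) : ℂ) = B := by
    rw [Int.toNat_of_nonneg (by omega)]; push_cast; ring
  have f2 : (((-m - 1 + 1 - -B).toNat : ℤ) : ℂ) = B - m := by
    rw [Int.toNat_of_nonneg (by omega)]; push_cast; ring
  rw [Int.cast_natCast] at f1 f2
  rw [f1, f2]; ring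

lemma metric_lie_self (u T : 𝔤) : metric 𝔤 ⁅u, T⁆ u = 0 := by
  rw [metric_skew, lie_self, metric_zero_right, neg_zero]

/-- Commuting `T` through one factor raises its index from `l` to `l + m`, but the order of the
factors is still decided by `l < 0`. Restoring normal order yields the double bracket, without a
central term because `⟨[u,T],u⟩ = 0`. The central terms of the commutators with `T` survive at a
single index each. -/
lemma normalTerm_comm (u T : 𝔤) (n m l : ℤ) (ψ : 𝒥.D) :
    𝒥.normalTerm u u n l (𝒥.J T m ψ) = 𝒥.J T m (𝒥.normalTerm u u n l ψ) +
      (Complex.I • 𝒥.normalTerm u ⁅u, T⁆ (n + m) l ψ +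
        Complex.I • 𝒥.normalTerm ⁅u, T⁆ u (n + m) (l + m) ψ +
        ((if l < 0 then (1 : ℂ) else 0) - if l + m < 0 then 1 else 0) •
          𝒥.J ⁅u, ⁅u, T⁆⁆ (n + m) ψ +
        ((if l = n + m then (-(m * k * metric 𝔤 u T) : ℂ) • 𝒥.J u (n + m) ψ else 0) +
          if l = -m then (-(m * k * metric 𝔤 u T) : ℂ) • 𝒥.J u (n + m) ψ else 0)) := by
  have hZ : 𝒥.J ⁅⁅u, T⁆, u⁆ (n + m) ψ = -𝒥.J ⁅u, ⁅u, T⁆⁆ (n + m) ψ := by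
    rw [← lie_skew, J_neg]
  have hZu : 𝒥.J ⁅u, T⁆ (l + m) (𝒥.J u (n - l) ψ) = 𝒥.J u (n - l) (𝒥.J ⁅u, T⁆ (l + m) ψ) -
      Complex.I • 𝒥.J ⁅u, ⁅u, T⁆⁆ (n + m) ψ := by
    rw [J_comm, metric_lie_self, show l + m + (n - l) = n + m by ring, hZ]
    simp [sub_eq_add_neg]
  have e0 : n + m - (l + m) = n - l := by ring
  have e1 : n - l + m = n + m - l := by ring
  have d1 : (if n - l + m = 0 then (k * ((n - l : ℤ) : ℂ) * metric 𝔤 u T : ℂ) else 0) • 𝒥.J u l ψ =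
      if l = n + m then (-(m * k * metric 𝔤 u T) : ℂ) • 𝒥.J u (n + m) ψ else 0 := by
    by_cases h : l = n + m
    · rw [if_pos (by omega), if_pos h, h]; congr 1; push_cast; ring
    · rw [if_neg (by omega), if_neg h, zero_smul]
  have d2 : (if l + m = 0 then (k * (l : ℂ) * metric 𝔤 u T : ℂ) else 0) • 𝒥.J u (n - l) ψ =
      if l = -m then (-(m * k * metric 𝔤 u T) : ℂ) • 𝒥.J u (n + m) ψ else 0 := by
    by_cases h : l = -m
    · rw [if_pos (by omega), if_pos h, h]
      congr 1
      · push_cast; ring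
      · rw [sub_neg_eq_add]
    · rw [if_neg (by omega), if_neg h, zero_smul]
  have c1 : ∀ φ : 𝒥.D, 𝒥.J u (n - l) (𝒥.J T m φ) = 𝒥.J T m (𝒥.J u (n - l) φ) +
      Complex.I • 𝒥.J ⁅u, T⁆ (n + m - l) φ +
      (if n - l + m = 0 then (k * ((n - l : ℤ) : ℂ) * metric 𝔤 u T : ℂ) else 0) • φ := fun φ => by
    rw [J_comm, e1]
  have c2 : ∀ φ : 𝒥.D, 𝒥.J u l (𝒥.J T m φ) = 𝒥.J T m (𝒥.J u l φ) +
      Complex.I • 𝒥.J ⁅u, T⁆ (l + m) φ +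
      (if l + m = 0 then (k * (l : ℂ) * metric 𝔤 u T : ℂ) else 0) • φ := fun φ => by
    rw [J_comm]
  rw [← d1, ← d2]
  unfold normalTerm
  rw [e0]
  by_cases h1 : l < 0 <;> by_cases h2 : l + m < 0 <;>
    simp only [h1, h2, if_true, if_false] <;>
    simp only [c1, c2, map_add, map_smul, hZu] <;>
    (try simp only [smul_sub, smul_smul, Complex.I_mul_I]) <;>
    module

/-- The commutator of a current with the square of another one. -/
lemma normalMode_comm {E : ℤ} {ψ : 𝒥.D} (hψ : 𝒥.Annih E ψ) (u T : 𝔤) (n m : ℤ) :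
    𝒥.normalMode u u n (𝒥.J T m ψ) = 𝒥.J T m (𝒥.normalMode u u n ψ) +
      (Complex.I • 𝒥.normalMode u ⁅u, T⁆ (n + m) ψ +
        Complex.I • 𝒥.normalMode ⁅u, T⁆ u (n + m) ψ +
        (m : ℂ) • 𝒥.J ⁅u, ⁅u, T⁆⁆ (n + m) ψ +
        (-(2 * m * k * metric 𝔤 u T) : ℂ) • 𝒥.J u (n + m) ψ) := by
  -- A window wide enough for `ψ`, for `J T m ψ`, and for the sum shifted by `m`.
  obtain ⟨B, hB⟩ : ∃ B : ℤ, B = 2 * (|E| + |m| + |n|) := ⟨_, rfl⟩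
  have h1 := abs_nonneg E
  have h2 := abs_nonneg m
  have h3 := abs_nonneg n
  have h4 := neg_abs_le m
  have h5 := le_abs_self m
  have h6 := neg_abs_le n
  have h7 := le_abs_self n
  have h8 := le_abs_self E
  rw [normalMode_eq_sum (a := -B) (b := B) (hψ.J T m) u u (by omega) (by omega) (by omega)
      (by omega),
    normalMode_eq_sum (a := -B) (b := B) hψ u u (by omega) (by omega) (by omega) (by omega),
    normalMode_eq_sum (a := -B) (b := B) hψ u ⁅u, T⁆ (by omega) (by omega) (by omega) (by omega),
    normalMode_eq_sum (a := -B + m) (b := B + m) hψ ⁅u, T⁆ u (by omega) (by omega) (by omega)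
      (by omega),
    map_sum, Finset.smul_sum, Finset.smul_sum]
  have hshift : ∑ l ∈ Finset.Icc (-B + m) (B + m),
      Complex.I • 𝒥.normalTerm ⁅u, T⁆ u (n + m) l ψ =
      ∑ l ∈ Finset.Icc (-B) B, Complex.I • 𝒥.normalTerm ⁅u, T⁆ u (n + m) (l + m) ψ := by
    rw [← Finset.map_add_right_Icc, Finset.sum_map]
    rfl
  rw [hshift, ← sum_ite_neg_sub B m (by omega), Finset.sum_smul,
    ← Finset.sum_add_distrib, ← Finset.sum_add_distrib]
  have hd : ∀ c : ℤ, -B ≤ c → c ≤ B → ∑ l ∈ Finset.Icc (-B) B,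
      (if l = c then (-(m * k * metric 𝔤 u T) : ℂ) • 𝒥.J u (n + m) ψ else 0) =
        (-(m * k * metric 𝔤 u T) : ℂ) • 𝒥.J u (n + m) ψ := fun c hc hc' => by
    rw [Finset.sum_ite_eq', if_pos (Finset.mem_Icc.2 ⟨hc, hc'⟩)]
  have hd2 : (-(2 * m * k * metric 𝔤 u T) : ℂ) • 𝒥.J u (n + m) ψ =
      ∑ l ∈ Finset.Icc (-B) B,
        ((if l = n + m then (-(m * k * metric 𝔤 u T) : ℂ) • 𝒥.J u (n + m) ψ else 0) +
          if l = -m then (-(m * k * metric 𝔤 u T) : ℂ) • 𝒥.J u (n + m) ψ else 0) := by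
    rw [Finset.sum_add_distrib, hd _ (by omega) (by omega), hd _ (by omega) (by omega), ← add_smul]
    congr 1; ring
  -- The preceding rewriting also replaced `m` inside the central coefficient; this undoes it there.
  have hrest : (-(2 * ((∑ l ∈ Finset.Icc (-B) B,
      ((if l < 0 then (1 : ℂ) else 0) - if l + m < 0 then 1 else 0))) * k * metric 𝔤 u T) : ℂ) =
      (-(2 * m * k * metric 𝔤 u T) : ℂ) := by
    rw [sum_ite_neg_sub B m (by omega)]
  rw [hrest, hd2, ← Finset.sum_add_distrib, ← Finset.sum_add_distrib]
  exact Finset.sum_congr rfl fun l _ => normalTerm_comm u T n m l ψ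

/-- The adjoints of the modes of normal ordered products. -/
lemma inner_normalMode {E E' : ℤ} {φ ψ : 𝒥.D} (hφ : 𝒥.Annih E φ) (hψ : 𝒥.Annih E' ψ) (X Y : 𝔤)
    (n : ℤ) : inner ℂ φ (𝒥.normalMode X Y n ψ) =
      inner ℂ (𝒥.normalMode X Y (-n) φ + Complex.I • 𝒥.J ⁅X, Y⁆ (-n) φ) ψ := by
  obtain ⟨B, hB⟩ : ∃ B : ℤ, B = |E| + |E'| + |n| := ⟨_, rfl⟩
  have h1 := abs_nonneg E
  have h2 := abs_nonneg E'
  have h3 := abs_nonneg n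
  have h6 := neg_abs_le n
  have h7 := le_abs_self n
  have h8 := le_abs_self E
  have h9 := le_abs_self E'
  rw [normalMode_eq_sum (a := -B) (b := B) hψ X Y (by omega) (by omega) (by omega) (by omega),
    normalMode_eq_sum (a := -B) (b := B) hφ X Y (by omega) (by omega) (by omega) (by omega)]
  have hrefl : ∑ m ∈ Finset.Icc (-B) B, 𝒥.normalTerm X Y (-n) m φ =
      ∑ m ∈ Finset.Icc (-B) B, 𝒥.normalTerm X Y (-n) (-m) φ := by
    refine Finset.sum_nbij' (fun m => -m) (fun m => -m) ?_ ?_ ?_ ?_ ?_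
    · intro m hm; rw [Finset.mem_Icc] at hm ⊢; omega
    · intro m hm; rw [Finset.mem_Icc] at hm ⊢; omega
    · intro m _; exact neg_neg m
    · intro m _; exact neg_neg m
    · intro m _; simp only [neg_neg]
  -- Taking adjoints reflects `m` to `-m`. This respects the normal ordering except at `m = 0`,
  -- where the two factors come out in the opposite order and leave a commutator.
  have hz : Complex.I • 𝒥.J ⁅X, Y⁆ (-n) φ =
      ∑ m ∈ Finset.Icc (-B) B, if m = 0 then Complex.I • 𝒥.J ⁅X, Y⁆ (-n) φ else 0 := by
    rw [Finset.sum_ite_eq', if_pos (Finset.mem_Icc.2 ⟨by omega, by omega⟩)]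
  rw [hrefl, hz, ← Finset.sum_add_distrib, inner_sum, sum_inner]
  refine Finset.sum_congr rfl fun m _ => ?_
  unfold normalTerm
  have e : -n - -m = -(n - m) := by ring
  rcases lt_trichotomy m 0 with h | h | h
  · rw [if_pos h, if_neg (by omega), if_neg (by omega), J_adjoint, J_adjoint, add_zero, e]
  · subst h
    rw [if_neg (by omega), if_neg (by omega), if_pos rfl, J_adjoint, J_adjoint, neg_zero,
      J_comm 𝒥 X Y 0]
    simp [inner_add_left, inner_smul_left, mul_comm]
  · rw [if_neg (by omega), if_pos (by omega), if_neg (by omega), J_adjoint, J_adjoint, add_zero, e]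

end Currents

end CurrentAlg
end

noncomputable section

namespace CurrentAlg

section Frames

variable {𝔤 : Type*} [LieRing 𝔤] [LieAlgebra ℝ 𝔤] {O : Type*} {d : O → ℕ}
  {u : ∀ o, Fin (d o) → 𝔤} {I v w : O → ℝ}

/-! ### Frames and their stabilizers -/

/-- `X` acts by skew matrices on each of the families `u o`. -/
def Stabilizes (u : ∀ o, Fin (d o) → 𝔤) (X : 𝔤) : Prop :=
  ∀ o, ∃ M : Fin (d o) → Fin (d o) → ℝ, (∀ a b, M a b = -M b a) ∧
    ∀ a, ⁅X, u o a⁆ = ∑ b, M a b • u o b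

/-- Invariance of `∑ u_a ⊗ u_a` under `ad X`: a skew matrix is contracted with a symmetric
expression. -/
lemma Stabilizes.sum_eq_zero {X : 𝔤} (h : Stabilizes u X) {W : Type*} [AddCommGroup W] [Module ℝ W]
    (G : 𝔤 →ₗ[ℝ] 𝔤 →ₗ[ℝ] W) (o : O) :
    ∑ a, (G ⁅X, u o a⁆ (u o a) + G (u o a) ⁅X, u o a⁆) = 0 := by
  obtain ⟨M, hM, hX⟩ := h o
  simp only [hX, map_sum, LinearMap.sum_apply, map_smul, LinearMap.smul_apply,
    Finset.sum_add_distrib]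
  rw [Finset.sum_comm, ← Finset.sum_add_distrib]
  refine Finset.sum_eq_zero fun a _ => ?_
  rw [← Finset.sum_add_distrib]
  refine Finset.sum_eq_zero fun b _ => ?_
  rw [hM a b, neg_smul, add_neg_cancel]

lemma IsFrameSystem.stabilizes (hF : IsFrameSystem u I v) (o : O) (c : Fin (d o)) :
    Stabilizes u (u o c) := by
  classical
  intro o'
  by_cases h : o = o'
  · subst h
    exact hF.skew o c
  · exact ⟨fun _ _ => 0, fun _ _ => neg_zero.symm, fun a => by simp [hF.comm o o' h]⟩

variable [Fintype O]

/-- The weighted Casimir operator in terms of frames. -/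
def frameCasimir (u : ∀ o, Fin (d o) → 𝔤) (w : O → ℝ) (k : ℕ) (T : 𝔤) : 𝔤 :=
  ∑ o, w o • ((2 * k : ℝ) • ∑ a, metric 𝔤 (u o a) T • u o a - ∑ a, ⁅u o a, ⁅u o a, T⁆⁆)

lemma frameCasimir_add (k : ℕ) (S T : 𝔤) :
    frameCasimir u w k (S + T) = frameCasimir u w k S + frameCasimir u w k T := by
  simp only [frameCasimir, ← Finset.sum_add_distrib, ← smul_add]
  refine Finset.sum_congr rfl fun o _ => ?_
  simp only [metric_add_right, add_smul, lie_add, Finset.sum_add_distrib]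
  module

lemma frameCasimir_smul (k : ℕ) (c : ℝ) (T : 𝔤) :
    frameCasimir u w k (c • T) = c • frameCasimir u w k T := by
  simp only [frameCasimir, Finset.smul_sum]
  refine Finset.sum_congr rfl fun o _ => ?_
  simp only [metric_smul_right, mul_smul, lie_smul, ← Finset.smul_sum]
  module

/-- The projection terms are symmetric, and so is the square of the skew operator `ad u_a`. -/
lemma metric_frameCasimir (k : ℕ) (S T : 𝔤) :
    metric 𝔤 (frameCasimir u w k S) T = metric 𝔤 S (frameCasimir u w k T) := by
  simp only [frameCasimir, metric_sum_left, metric_sum_right, metric_smul_left, metric_smul_right,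
    metric_sub_left, metric_sub_right]
  refine Finset.sum_congr rfl fun o _ => ?_
  congr 2
  · congr 1
    refine Finset.sum_congr rfl fun a _ => ?_
    rw [metric_comm (u o a) S]; ring
  · refine Finset.sum_congr rfl fun a _ => ?_
    rw [metric_skew, metric_skew, neg_neg]

/-- `C` is built from the tensors `∑ u_a ⊗ u_a`, which `X` leaves invariant, so it commutes with `ad
X`. -/
lemma Stabilizes.frameCasimir_lie {X : 𝔤} (h : Stabilizes u X) (w : O → ℝ) (k : ℕ) (T : 𝔤) :
    frameCasimir u w k ⁅X, T⁆ = ⁅X, frameCasimir u w k T⁆ := by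
  simp only [frameCasimir, lie_sum, lie_smul, lie_sub]
  refine Finset.sum_congr rfl fun o _ => ?_
  congr 2
  · congr 1
    have h1 := h.sum_eq_zero (LinearMap.mk₂ ℝ (fun Y Z : 𝔤 => metric 𝔤 Y T • Z)
      (fun Y Y' Z => by rw [metric_add_left, add_smul])
      (fun c Y Z => by rw [metric_smul_left, mul_smul]) (fun Y Z Z' => by rw [smul_add])
      (fun c Y Z => by rw [smul_comm])) o
    simp only [LinearMap.mk₂_apply, metric_skew X, neg_smul, Finset.sum_add_distrib,
      Finset.sum_neg_distrib] at h1
    exact neg_add_eq_zero.1 h1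
  · have h1 := h.sum_eq_zero (LinearMap.mk₂ ℝ (fun Y Z : 𝔤 => ⁅Y, ⁅Z, T⁆⁆)
      (fun Y Y' Z => by rw [add_lie]) (fun c Y Z => by rw [smul_lie])
      (fun Y Z Z' => by rw [add_lie, lie_add]) (fun c Y Z => by rw [smul_lie, lie_smul])) o
    simp only [LinearMap.mk₂_apply] at h1
    rw [← sub_eq_zero, ← neg_zero, ← h1, ← Finset.sum_sub_distrib, ← Finset.sum_neg_distrib]
    refine Finset.sum_congr rfl fun a _ => ?_
    rw [leibniz_lie X (u o a) ⁅u o a, T⁆, leibniz_lie X (u o a) T, lie_add]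
    abel

/-- The weights are chosen for this: on its own ideal the operator is `w (2 k I + 2 v) = 1`, and the
other ideals contribute nothing by orthogonality and commutativity. -/
lemma IsFrameSystem.frameCasimir_self (hF : IsFrameSystem u I v) {k : ℕ}
    (hw : ∀ o, w o * (2 * (I o * k + v o)) = 1) (o : O) (c : Fin (d o)) :
    frameCasimir u w k (u o c) = u o c := by
  classical
  rw [frameCasimir, Finset.sum_eq_single o]
  · have h1 : ∑ a, metric 𝔤 (u o a) (u o c) • u o a = I o • u o c := by
      simp [hF.gram]
    rw [h1, sub_eq_add_neg, hF.cas, smul_smul, ← add_smul, smul_smul]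
    conv_rhs => rw [← one_smul ℝ (u o c), ← hw o]
    congr 1; ring
  · intro o' _ h
    simp [hF.orth o' o h, hF.comm o' o h]
  · simp

/-- `C` is symmetric and fixes the frame vectors, so `1 - C` maps into their orthogonal complement.
-/
lemma IsFrameSystem.metric_sub_frameCasimir (hF : IsFrameSystem u I v) {k : ℕ}
    (hw : ∀ o, w o * (2 * (I o * k + v o)) = 1) (o : O) (c : Fin (d o)) (T : 𝔤) :
    metric 𝔤 (T - frameCasimir u w k T) (u o c) = 0 := by
  rw [metric_sub_left, metric_frameCasimir, hF.frameCasimir_self hw, sub_self]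

/-- The contribution of the Casimir operators alone. -/
lemma IsFrameSystem.metric_casimir (hF : IsFrameSystem u I v) {k : ℕ}
    (hw : ∀ o, w o * (2 * (I o * k + v o)) = 1) (T : 𝔤) :
    ∑ o, w o * ∑ a, metric 𝔤 ⁅u o a, T - frameCasimir u w k T⁆ ⁅u o a, T⁆ =
      metric 𝔤 (T - frameCasimir u w k T) (frameCasimir u w k T) := by
  conv_rhs => rw [frameCasimir.eq_def u w k T]
  have h := hF.metric_sub_frameCasimir hw
  conv_rhs =>
    simp only [metric_sum_right, metric_smul_right, metric_sub_right]
  refine Finset.sum_congr rfl fun o _ => ?_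
  congr 1
  rw [← frameCasimir.eq_def u w k T]
  -- The projection part of `C T` drops out because `T - C T` is orthogonal to the frames.
  simp only [h, mul_zero, Finset.sum_const_zero, zero_sub, ← Finset.sum_neg_distrib]
  exact Finset.sum_congr rfl fun a _ => metric_skew _ _ _

end Frames

namespace Currents

variable {𝔤 : Type*} [LieRing 𝔤] [LieAlgebra ℝ 𝔤] {k : ℕ} {H : Type*}
  [NormedAddCommGroup H] [InnerProductSpace ℂ H] {𝒥 : Currents 𝔤 k H}
  {O : Type*} [Fintype O] {d : O → ℕ} {u : ∀ o, Fin (d o) → 𝔤} {I v w : O → ℝ}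

/-! ### Stress-energy tensors and covariance fields in terms of frames -/

/-- Modes of the stress-energy tensor `∑_o w_o ∑_a :j^{u_a} j^{u_a}:`. -/
def frameSugawara (𝒥 : Currents 𝔤 k H) (u : ∀ o, Fin (d o) → 𝔤) (w : O → ℝ) (n : ℤ) (ψ : 𝒥.D) :
    𝒥.D :=
  ∑ o, w o • ∑ a, 𝒥.normalMode (u o a) (u o a) n ψ

/-- Modes of the covariance field of the colour `T` in terms of frames. -/
def frameField (𝒥 : Currents 𝔤 k H) (u : ∀ o, Fin (d o) → 𝔤) (w : O → ℝ) (T : 𝔤) (n : ℤ)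
    (ψ : 𝒥.D) : 𝒥.D :=
  ∑ o, w o • ∑ a, (𝒥.normalMode (u o a) ⁅u o a, T⁆ n ψ + 𝒥.normalMode ⁅u o a, T⁆ (u o a) n ψ)

/-- The commutator of currents and stress-energy tensors. -/
lemma frameSugawara_comm {E : ℤ} {ψ : 𝒥.D} (hψ : 𝒥.Annih E ψ) (u : ∀ o, Fin (d o) → 𝔤) (w : O → ℝ)
    (T : 𝔤) (n m : ℤ) : 𝒥.frameSugawara u w n (𝒥.J T m ψ) = 𝒥.J T m (𝒥.frameSugawara u w n ψ) +
      (Complex.I • 𝒥.frameField u w T (n + m) ψ -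
        (m : ℂ) • 𝒥.J (frameCasimir u w k T) (n + m) ψ) := by
  simp only [frameSugawara, frameField, frameCasimir, map_sum, J_sum, Finset.smul_sum,
    ← Finset.sum_add_distrib, ← Finset.sum_sub_distrib, real_smul_eq, J_smul, J_sub, map_smul]
  refine Finset.sum_congr rfl fun o _ => ?_
  refine Finset.sum_congr rfl fun a _ => ?_
  rw [normalMode_comm hψ]
  push_cast
  module

/-- `Φ^X` is minus the variation of `∑ u_a ⊗ u_a` under `ad X`, inserted into the normal product. -/
lemma frameField_eq_zero_of_stabilizes {X : 𝔤} (h : Stabilizes u X) (w : O → ℝ) {E : ℤ} {ψ : 𝒥.D}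
    (hψ : 𝒥.Annih E ψ) (n : ℤ) : 𝒥.frameField u w X n ψ = 0 := by
  refine Finset.sum_eq_zero fun o _ => ?_
  have h1 := h.sum_eq_zero (normalBilin hψ n) o
  rw [smul_eq_zero]
  right
  rw [← neg_eq_zero, ← h1, ← Finset.sum_neg_distrib]
  refine Finset.sum_congr rfl fun a _ => ?_
  rw [← lie_skew (u o a) X]
  simp only [← normalBilin_apply hψ, map_neg, LinearMap.neg_apply]
  abel

lemma frameField_add {E : ℤ} {φ ψ : 𝒥.D} (hφ : 𝒥.Annih E φ) (hψ : 𝒥.Annih E ψ) (T : 𝔤) (n : ℤ) :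
    𝒥.frameField u w T n (φ + ψ) = 𝒥.frameField u w T n φ + 𝒥.frameField u w T n ψ := by
  simp only [frameField, normalMode_add hφ hψ, ← Finset.sum_add_distrib, ← smul_add]
  refine Finset.sum_congr rfl fun o _ => congrArg _ (Finset.sum_congr rfl fun a _ => ?_)
  abel

lemma frameSugawara_smul {E : ℤ} {ψ : 𝒥.D} (hψ : 𝒥.Annih E ψ) (c : ℂ) (n : ℤ) :
    𝒥.frameSugawara u w n (c • ψ) = c • 𝒥.frameSugawara u w n ψ := by
  simp only [frameSugawara, normalMode_smul hψ, ← Finset.smul_sum, real_smul_eq]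
  rw [Finset.smul_sum]
  exact Finset.sum_congr rfl fun o _ => smul_comm _ _ _

/-- Covariance fields are symmetric. -/
lemma inner_frameField {E E' : ℤ} {φ ψ : 𝒥.D} (hφ : 𝒥.Annih E φ) (hψ : 𝒥.Annih E' ψ) (T : 𝔤)
    (n : ℤ) : inner ℂ φ (𝒥.frameField u w T n ψ) = inner ℂ (𝒥.frameField u w T (-n) φ) ψ := by
  simp only [frameField, real_smul_eq, sum_inner, inner_sum, inner_smul_left, inner_smul_right,
    inner_add_left, inner_add_right, Complex.conj_ofReal]
  refine Finset.sum_congr rfl fun o _ => congrArg _ (Finset.sum_congr rfl fun a _ => ?_)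
  rw [inner_normalMode hφ hψ, inner_normalMode hφ hψ, ← lie_skew ⁅u o a, T⁆, J_neg]
  simp only [inner_add_left, smul_neg, inner_neg_left]
  ring

lemma inner_frameSugawara {E E' : ℤ} {φ ψ : 𝒥.D} (hφ : 𝒥.Annih E φ) (hψ : 𝒥.Annih E' ψ) (n : ℤ) :
    inner ℂ φ (𝒥.frameSugawara u w n ψ) = inner ℂ (𝒥.frameSugawara u w (-n) φ) ψ := by
  simp only [frameSugawara, real_smul_eq, sum_inner, inner_sum, inner_smul_left, inner_smul_right,
    Complex.conj_ofReal]
  refine Finset.sum_congr rfl fun o _ => congrArg _ (Finset.sum_congr rfl fun a _ => ?_)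
  rw [inner_normalMode hφ hψ, lie_self, J_zero, smul_zero, add_zero]

end Currents

end CurrentAlg
end

noncomputable section

namespace CurrentAlg

/-! ### The sum over mode numbers behind the two-point function of `Φ` -/

lemma sum_range_mul_sub (p : ℕ) :
    ∑ i ∈ Finset.range p, (i : ℂ) * (p - i) = ((p + 1).choose 3 : ℕ) := by
  induction p with
  | zero => simp [Nat.choose]
  | succ p ih =>
    have h1 : ∑ i ∈ Finset.range (p + 1), (i : ℂ) * ((p + 1 : ℕ) - i) =
        ∑ i ∈ Finset.range (p + 1), (i : ℂ) * (p - i) + ∑ i ∈ Finset.range (p + 1), (i : ℂ) := by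
      rw [← Finset.sum_add_distrib]
      refine Finset.sum_congr rfl fun i _ => ?_
      push_cast; ring
    have h2 : ∑ i ∈ Finset.range (p + 1), (i : ℂ) = ((p + 1).choose 2 : ℕ) := by
      rw [← Nat.cast_sum, Finset.sum_range_id, Nat.choose_two_right]
    rw [h1, h2, Finset.sum_range_succ, ih, Nat.choose_succ_succ' (p + 1) 2]
    push_cast; ring

lemma sum_Ioo_neg_mul_add (p : ℕ) :
    ∑ m ∈ Finset.Ioo (-(p : ℤ)) 0, (-(m : ℂ)) * (p + m) = ((p + 1).choose 3 : ℕ) := by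
  rw [← sum_range_mul_sub]
  have h : ∑ m ∈ Finset.Ioo (-(p : ℤ)) 0, (-(m : ℂ)) * (p + m) =
      ∑ m ∈ Finset.Ioc (-(p : ℤ)) 0, (-(m : ℂ)) * (p + m) := by
    refine Finset.sum_subset Finset.Ioo_subset_Ioc_self fun m hm hm' => ?_
    rw [Finset.mem_Ioc] at hm
    rw [Finset.mem_Ioo] at hm'
    have : m = 0 := by omega
    simp [this]
  rw [h]
  refine Finset.sum_nbij' (fun m => m.natAbs) (fun i => -(i : ℤ)) ?_ ?_ ?_ ?_ ?_
  · intro m hm; rw [Finset.mem_Ioc] at hm; rw [Finset.mem_range]; omega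
  · intro i hi; rw [Finset.mem_range] at hi; rw [Finset.mem_Ioc]; omega
  · intro m hm; rw [Finset.mem_Ioc] at hm; omega
  · intro i _; omega
  · intro m hm
    rw [Finset.mem_Ioc] at hm
    have : (m : ℂ) = -(m.natAbs : ℂ) := by
      have h' : m = -(m.natAbs : ℤ) := by omega
      exact_mod_cast congrArg (Int.cast : ℤ → ℂ) h'
    rw [this]; ring

namespace Currents

variable {𝔤 : Type*} [LieRing 𝔤] [LieAlgebra ℝ 𝔤] {k : ℕ} {H : Type*}
  [NormedAddCommGroup H] [InnerProductSpace ℂ H] {𝒥 : Currents 𝔤 k H}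

/-! ### The fields on the vacuum -/

section Vacuum

variable (hΩ : ∀ X n, 0 ≤ n → 𝒥.J X n 𝒥.Ω = 0)

include hΩ

lemma annih_vacuum : 𝒥.Annih (-1) 𝒥.Ω := fun X n hn => hΩ X n (by omega)

lemma normalMode_vacuum_nonneg (X Y : 𝔤) {n : ℤ} (hn : 0 ≤ n) : 𝒥.normalMode X Y n 𝒥.Ω = 0 := by
  rw [normalMode_eq_sum (a := 0) (b := 0) (annih_vacuum hΩ) X Y le_rfl (by omega) le_rfl (by omega)]
  refine Finset.sum_eq_zero fun m hm => ?_
  rw [Finset.mem_Icc] at hm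
  rw [normalTerm, if_neg (by omega), hΩ X m (by omega), map_zero]

lemma normalMode_vacuum (X Y : 𝔤) (p : ℕ) : 𝒥.normalMode X Y (-p) 𝒥.Ω =
    ∑ m ∈ Finset.Ioo (-(p : ℤ)) 0, 𝒥.J X m (𝒥.J Y (-p - m) 𝒥.Ω) := by
  rw [normalMode_eq_sum (a := -p) (b := 0) (annih_vacuum hΩ) X Y (by omega) (by omega) le_rfl
    (by omega)]
  symm
  refine (Finset.sum_congr rfl fun m hm => ?_).trans
    (Finset.sum_subset Finset.Ioo_subset_Icc_self fun m hm hm' => ?_)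
  · rw [Finset.mem_Ioo] at hm
    rw [normalTerm, if_pos hm.2]
  · rw [Finset.mem_Icc] at hm
    rw [Finset.mem_Ioo] at hm'
    rw [normalTerm]
    split_ifs with h
    · rw [hΩ Y _ (by omega), map_zero]
    · rw [hΩ X _ (by omega), map_zero]

/-- The reflection `m ↦ -p - m` exchanges the mode numbers of the two factors; exchanging the
factors themselves costs only brackets, since the total mode number `-p` is nonzero whenever the sum
is nonempty. -/
lemma normalMode_vacuum_swap (X Y : 𝔤) (p : ℕ) : ∃ c : ℂ, 𝒥.normalMode Y X (-p) 𝒥.Ω =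
    𝒥.normalMode X Y (-p) 𝒥.Ω + c • 𝒥.J ⁅Y, X⁆ (-p) 𝒥.Ω := by
  refine ⟨∑ m ∈ Finset.Ioo (-(p : ℤ)) 0, Complex.I, ?_⟩
  rw [normalMode_vacuum hΩ, normalMode_vacuum hΩ, Finset.sum_smul]
  have h : ∑ m ∈ Finset.Ioo (-(p : ℤ)) 0, 𝒥.J X m (𝒥.J Y (-p - m) 𝒥.Ω) =
      ∑ m ∈ Finset.Ioo (-(p : ℤ)) 0, 𝒥.J X (-p - m) (𝒥.J Y m 𝒥.Ω) := by
    refine Finset.sum_nbij' (fun m => -p - m) (fun m => -p - m) ?_ ?_ ?_ ?_ ?_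
    · intro m hm; rw [Finset.mem_Ioo] at hm ⊢; omega
    · intro m hm; rw [Finset.mem_Ioo] at hm ⊢; omega
    · intro m _; ring
    · intro m _; ring
    · intro m _; simp only [sub_sub_cancel]
  rw [h, ← Finset.sum_add_distrib]
  refine Finset.sum_congr rfl fun m hm => ?_
  rw [Finset.mem_Ioo] at hm
  rw [J_comm 𝒥 Y X, if_neg (by omega), zero_smul, add_zero, add_sub_cancel]

lemma J_J_vacuum (X Y : 𝔤) {p : ℤ} (hp : 0 ≤ p) :
    𝒥.J X p (𝒥.J Y (-p) 𝒥.Ω) = (k * p * metric 𝔤 X Y : ℂ) • 𝒥.Ω := by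
  rw [J_comm, hΩ X p hp, hΩ _ (p + -p) (by omega), if_pos (by omega)]
  simp

/-- The two-point function of the currents. -/
lemma inner_J_vacuum (X Y : 𝔤) {p : ℤ} (hp : 0 ≤ p) :
    inner ℂ (𝒥.J X (-p) 𝒥.Ω) (𝒥.J Y (-p) 𝒥.Ω) = (k * p * metric 𝔤 X Y : ℂ) := by
  rw [← J_adjoint, J_J_vacuum hΩ X Y hp, inner_smul_right, inner_self_eq_norm_sq_to_K,
    𝒥.norm_vacuum]
  simp

/-- `J^S_p` is moved to the right. Its commutator with `J^X_m` gives the two-point function of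
`[S,X]` and `Y`; in the other ordering `J^X_m` with `m < 0` annihilates the vacuum on the left. -/
lemma inner_J_normalMode (S X Y : 𝔤) (p : ℕ) :
    inner ℂ (𝒥.J S (-p) 𝒥.Ω) (𝒥.normalMode X Y (-p) 𝒥.Ω) =
      ∑ m ∈ Finset.Ioo (-(p : ℤ)) 0, Complex.I * (k * (p + m)) * metric 𝔤 ⁅S, X⁆ Y := by
  rw [normalMode_vacuum hΩ, inner_sum]
  refine Finset.sum_congr rfl fun m hm => ?_
  rw [Finset.mem_Ioo] at hm
  have e : (-(p : ℤ) - m) = -(p + m) := by ring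
  rw [← J_adjoint, J_comm, if_neg (by omega), e, J_J_vacuum hΩ _ _ (by omega), inner_add_right,
    inner_add_right, J_adjoint 𝒥 X, hΩ X (-m) (by omega), inner_smul_right, inner_smul_right,
    inner_self_eq_norm_sq_to_K, 𝒥.norm_vacuum]
  simp
  ring

/-- `⟨[S,X],Y⟩` changes sign under the exchange of `X` and `Y`, while the numerical coefficients do
not change. -/
lemma inner_J_normalMode_add (S X Y : 𝔤) (p : ℕ) : inner ℂ (𝒥.J S (-p) 𝒥.Ω)
    (𝒥.normalMode X Y (-p) 𝒥.Ω + 𝒥.normalMode Y X (-p) 𝒥.Ω) = 0 := by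
  rw [inner_add_right, inner_J_normalMode hΩ, inner_J_normalMode hΩ, ← Finset.sum_add_distrib]
  refine Finset.sum_eq_zero fun m _ => ?_
  rw [metric_skew S Y X, metric_comm Y]
  push_cast; ring

variable {O : Type*} [Fintype O] {d : O → ℕ} {u : ∀ o, Fin (d o) → 𝔤} {I v w : O → ℝ}

lemma frameSugawara_vacuum (u : ∀ o, Fin (d o) → 𝔤) (w : O → ℝ) {n : ℤ} (hn : 0 ≤ n) :
    𝒥.frameSugawara u w n 𝒥.Ω = 0 := by
  simp [frameSugawara, normalMode_vacuum_nonneg hΩ _ _ hn]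

lemma frameField_vacuum (u : ∀ o, Fin (d o) → 𝔤) (w : O → ℝ) (T : 𝔤) {n : ℤ} (hn : 0 ≤ n) :
    𝒥.frameField u w T n 𝒥.Ω = 0 := by
  simp [frameField, normalMode_vacuum_nonneg hΩ _ _ hn]

/-- Covariance fields and currents generate orthogonal vectors from the vacuum. -/
lemma inner_J_frameField (u : ∀ o, Fin (d o) → 𝔤) (w : O → ℝ) (S T : 𝔤) (p : ℕ) :
    inner ℂ (𝒥.J S (-p) 𝒥.Ω) (𝒥.frameField u w T (-p) 𝒥.Ω) = 0 := by
  simp only [frameField, real_smul_eq, inner_sum, inner_smul_right, inner_J_normalMode_add hΩ,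
    Finset.sum_const_zero, mul_zero]

lemma inner_frameField_J (u : ∀ o, Fin (d o) → 𝔤) (w : O → ℝ) (S T : 𝔤) (p : ℕ) :
    inner ℂ (𝒥.frameField u w T (-p) 𝒥.Ω) (𝒥.J S (-p) 𝒥.Ω) = 0 := by
  rw [← inner_conj_symm, inner_J_frameField hΩ, map_zero]

/-- The commutator formula with `L_0 Ω = 0`. Read backwards, it trades the bilinear vector `Φ_{-p}
Ω` for `L_0` acting on one-current vectors. -/
lemma frameSugawara_J_vacuum (u : ∀ o, Fin (d o) → 𝔤) (w : O → ℝ) (T : 𝔤) (p : ℤ) :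
    𝒥.frameSugawara u w 0 (𝒥.J T (-p) 𝒥.Ω) = Complex.I • 𝒥.frameField u w T (-p) 𝒥.Ω +
      (p : ℂ) • 𝒥.J (frameCasimir u w k T) (-p) 𝒥.Ω := by
  rw [frameSugawara_comm (annih_vacuum hΩ), frameSugawara_vacuum hΩ u w le_rfl, map_zero, zero_add,
    zero_add]
  push_cast
  module

omit hΩ in
-- For a frame vector the covariance field vanishes and `C` is the identity, so its modes are
-- shifted by `L_0` exactly as by a conformal Hamiltonian.
lemma frameSugawara_J_comm (hF : IsFrameSystem u I v)
    (hw : ∀ o, w o * (2 * (I o * k + v o)) = 1) (o : O) (c : Fin (d o)) {E : ℤ} {ψ : 𝒥.D}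
    (hψ : 𝒥.Annih E ψ) (m : ℤ) : 𝒥.J (u o c) m (𝒥.frameSugawara u w 0 ψ) =
      𝒥.frameSugawara u w 0 (𝒥.J (u o c) m ψ) + (m : ℂ) • 𝒥.J (u o c) m ψ := by
  rw [frameSugawara_comm hψ, frameField_eq_zero_of_stabilizes (hF.stabilizes o c) w hψ,
    hF.frameCasimir_self hw, zero_add]
  module

lemma J_J_vacuum_of_lt (X Y : 𝔤) {m p : ℤ} (hm : 0 ≤ m) (hmp : m < p) :
    𝒥.J X m (𝒥.J Y (-p) 𝒥.Ω) = Complex.I • 𝒥.J ⁅X, Y⁆ (-(p - m)) 𝒥.Ω := by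
  rw [J_comm, hΩ X m hm, if_neg (by omega), map_zero, zero_smul, zero_add, add_zero, neg_sub,
    ← sub_eq_add_neg]

/-- Annihilation parts of the frame on the covariance field. -/
lemma J_frameField_vacuum (hF : IsFrameSystem u I v)
    (hw : ∀ o, w o * (2 * (I o * k + v o)) = 1) (o : O) (c : Fin (d o)) (T : 𝔤) {m p : ℤ}
    (hm : 0 ≤ m) (hmp : m < p) : 𝒥.J (u o c) m (𝒥.frameField u w T (-p) 𝒥.Ω) =
      Complex.I • 𝒥.frameField u w ⁅u o c, T⁆ (-(p - m)) 𝒥.Ω +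
        (m : ℂ) • 𝒥.J ⁅u o c, T - frameCasimir u w k T⁆ (-(p - m)) 𝒥.Ω := by
  -- `Φ_{-p} Ω` is solved for, so that `J (u o c) m` only has to pass `L_0` and act on one-current
  -- vectors.
  have h1 : 𝒥.frameField u w T (-p) 𝒥.Ω = (-Complex.I) • 𝒥.frameSugawara u w 0 (𝒥.J T (-p) 𝒥.Ω) +
      (Complex.I * p) • 𝒥.J (frameCasimir u w k T) (-p) 𝒥.Ω := by
    rw [frameSugawara_J_vacuum hΩ, smul_add, smul_smul, smul_smul, add_assoc, ← add_smul,
      neg_mul, Complex.I_mul_I, neg_neg, one_smul, neg_mul, neg_add_cancel, zero_smul, add_zero]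
  rw [h1, map_add, map_smul, map_smul,
    frameSugawara_J_comm hF hw o c ((annih_vacuum hΩ).J T (-p)), J_J_vacuum_of_lt hΩ _ _ hm hmp,
    J_J_vacuum_of_lt hΩ _ _ hm hmp, frameSugawara_smul ((annih_vacuum hΩ).J _ _),
    frameSugawara_J_vacuum hΩ, (hF.stabilizes o c).frameCasimir_lie, lie_sub, J_sub]
  simp only [smul_add, smul_sub, smul_smul, neg_mul, mul_neg, Complex.I_mul_I,
    show ∀ c : ℂ, Complex.I * c * Complex.I = -c from fun c => by
      rw [mul_right_comm, Complex.I_mul_I, neg_one_mul],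
    show ∀ c : ℂ, Complex.I * (Complex.I * c) = -c from fun c => by
      rw [← mul_assoc, Complex.I_mul_I, neg_one_mul],
    show ∀ c : ℂ, Complex.I * (c * Complex.I) = -c from fun c => by
      rw [mul_left_comm, Complex.I_mul_I, mul_neg_one]]
  push_cast
  module

/-- The two-point function of covariance fields. -/
lemma inner_frameField_vacuum (hF : IsFrameSystem u I v)
    (hw : ∀ o, w o * (2 * (I o * k + v o)) = 1) (T : 𝔤) (p : ℕ) :
    inner ℂ (𝒥.frameField u w T (-p) 𝒥.Ω) (𝒥.frameField u w T (-p) 𝒥.Ω) =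
      2 * k * ((p + 1).choose 3 : ℕ) *
        (metric 𝔤 (T - frameCasimir u w k T) (frameCasimir u w k T) : ℂ) := by
  have key : ∀ o a, inner ℂ (𝒥.frameField u w T (-p) 𝒥.Ω)
      (𝒥.normalMode (u o a) ⁅u o a, T⁆ (-p) 𝒥.Ω) = ((p + 1).choose 3 : ℕ) *
        (k * (metric 𝔤 ⁅u o a, T - frameCasimir u w k T⁆ ⁅u o a, T⁆ : ℂ)) := fun o a => by
    rw [normalMode_vacuum hΩ, inner_sum, ← sum_Ioo_neg_mul_add, Finset.sum_mul]
    refine Finset.sum_congr rfl fun m hm => ?_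
    rw [Finset.mem_Ioo] at hm
    obtain ⟨q, hq⟩ := Int.eq_ofNat_of_zero_le (show 0 ≤ (p : ℤ) + m by omega)
    have e1 : ((p : ℤ) - -m) = q := by omega
    have e2 : -(p : ℤ) - m = -q := by omega
    -- The left factor `J^u_m` becomes `J^u_{-m}` on the other side. Of the two resulting vectors
    -- the covariance field is orthogonal to currents, which leaves a two-point function of
    -- currents.
    rw [J_adjoint, J_frameField_vacuum hΩ hF hw o a T (by omega) (by omega), e1, e2,
      inner_add_left, inner_smul_left, inner_smul_left, inner_frameField_J hΩ, mul_zero, zero_add,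
      inner_J_vacuum hΩ _ _ (by omega)]
    have e3 : (p : ℂ) + m = q := by exact_mod_cast hq
    rw [e3]
    simp
    ring
  -- The opposite order differs by a one-current vector, which is orthogonal to the covariance
  -- field; this doubling is the factor `2` in the result.
  have key' : ∀ o a, inner ℂ (𝒥.frameField u w T (-p) 𝒥.Ω)
      (𝒥.normalMode ⁅u o a, T⁆ (u o a) (-p) 𝒥.Ω) = inner ℂ (𝒥.frameField u w T (-p) 𝒥.Ω)
        (𝒥.normalMode (u o a) ⁅u o a, T⁆ (-p) 𝒥.Ω) := fun o a => by
    obtain ⟨c, hc⟩ := normalMode_vacuum_swap hΩ (u o a) ⁅u o a, T⁆ p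
    rw [hc, inner_add_right, inner_smul_right, inner_frameField_J hΩ, mul_zero, add_zero]
  have expand : ∀ φ : 𝒥.D, inner ℂ φ (𝒥.frameField u w T (-p) 𝒥.Ω) = ∑ o, (w o : ℂ) *
      ∑ a, (inner ℂ φ (𝒥.normalMode (u o a) ⁅u o a, T⁆ (-p) 𝒥.Ω) +
        inner ℂ φ (𝒥.normalMode ⁅u o a, T⁆ (u o a) (-p) 𝒥.Ω)) := fun φ => by
    simp only [frameField, real_smul_eq, inner_sum, inner_smul_right, inner_add_right]
  rw [expand, ← hF.metric_casimir hw]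
  simp only [key', key]
  push_cast
  rw [Finset.mul_sum]
  refine Finset.sum_congr rfl fun o _ => ?_
  rw [Finset.mul_sum, Finset.mul_sum, Finset.mul_sum]
  refine Finset.sum_congr rfl fun a _ => ?_
  ring

end Vacuum

end Currents

end CurrentAlg
end

noncomputable section

namespace CurrentAlg

namespace Currents

open Module

variable {𝔤 : Type*} [LieRing 𝔤] [LieAlgebra ℝ 𝔤] {k : ℕ} {H : Type*}
  [NormedAddCommGroup H] [InnerProductSpace ℂ H] {𝒥 : Currents 𝔤 k H}

/-! ### Fields bilinear in the currents -/

lemma vacuum_mem_finiteEnergy : 𝒥.Ω ∈ 𝒥.finiteEnergy := by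
  rw [finiteEnergy, Submodule.mem_sInf]
  exact fun W hW => hW.1

lemma J_mem_finiteEnergy {ψ : 𝒥.D} (h : ψ ∈ 𝒥.finiteEnergy) (X : 𝔤) (n : ℤ) :
    𝒥.J X n ψ ∈ 𝒥.finiteEnergy := by
  rw [finiteEnergy, Submodule.mem_sInf] at h ⊢
  exact fun W hW => hW.2 X n ψ (h W hW)

lemma finiteEnergy_le {W : Submodule ℂ 𝒥.D} (hΩ : 𝒥.Ω ∈ W) (hJ : ∀ X n, ∀ ψ ∈ W, 𝒥.J X n ψ ∈ W) :
    𝒥.finiteEnergy ≤ W := sInf_le ⟨hΩ, hJ⟩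

lemma normalMode_mem_finiteEnergy {E : ℤ} {ψ : 𝒥.D} (hψ : 𝒥.Annih E ψ) (h : ψ ∈ 𝒥.finiteEnergy)
    (X Y : 𝔤) (n : ℤ) : 𝒥.normalMode X Y n ψ ∈ 𝒥.finiteEnergy := by
  rw [normalMode_eq_sum hψ X Y (min_le_left 0 (n - E)) (min_le_right 0 (n - E))
    (le_max_left 0 E) (le_max_right 0 E)]
  refine Submodule.sum_mem _ fun m _ => ?_
  unfold normalTerm
  split_ifs
  · exact J_mem_finiteEnergy (J_mem_finiteEnergy h _ _) _ _
  · exact J_mem_finiteEnergy (J_mem_finiteEnergy h _ _) _ _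

/-- Modes of a symmetric field that is defined on vectors of finite energy, lowers the energy by the
mode number and preserves polynomial bounds. -/
structure IsField (F : ℤ → 𝒥.D → 𝒥.D) : Prop where
  add : ∀ {E : ℤ} {φ ψ : 𝒥.D}, 𝒥.Annih E φ → 𝒥.Annih E ψ → ∀ n, F n (φ + ψ) = F n φ + F n ψ
  smul : ∀ {E : ℤ} {ψ : 𝒥.D}, 𝒥.Annih E ψ → ∀ (c : ℂ) n, F n (c • ψ) = c • F n ψ
  symm : ∀ {E E' : ℤ} {φ ψ : 𝒥.D}, 𝒥.Annih E φ → 𝒥.Annih E' ψ →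
    ∀ n, inner ℂ φ (F n ψ) = inner ℂ (F (-n) φ) ψ
  mem : ∀ {E : ℤ} {ψ : 𝒥.D}, 𝒥.Annih E ψ → ψ ∈ 𝒥.finiteEnergy → ∀ n, F n ψ ∈ 𝒥.finiteEnergy
  tame : ∀ {I : Type} {σ : I → ℝ} {E : I → ℤ} {f : I → 𝒥.D}, Tame σ E f →
    Tame (fun p : I × ℤ => σ p.1 * (1 + |(p.2 : ℝ)|)) (fun p => E p.1 - p.2) fun p => F p.2 (f p.1)

/-- The basis and frame descriptions of a field are compared only on vectors with an annihilation
bound, where the sums over modes are finite; the field axioms involve no others. -/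
lemma IsField.congr {F G : ℤ → 𝒥.D → 𝒥.D} (hG : IsField G)
    (h : ∀ {E : ℤ} {ψ : 𝒥.D}, 𝒥.Annih E ψ → ∀ n, F n ψ = G n ψ) : IsField F where
  add hφ hψ n := by rw [h hφ, h hψ, h (hφ.add hψ), hG.add hφ hψ]
  smul hψ c n := by rw [h hψ, h (hψ.smul c), hG.smul hψ]
  symm hφ hψ n := by rw [h hφ, h hψ, hG.symm hφ hψ]
  mem hψ hm n := by rw [h hψ]; exact hG.mem hψ hm n
  tame hf := by simpa only [h (hf.annih _)] using hG.tame hf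

lemma IsField.sub {F G : ℤ → 𝒥.D → 𝒥.D} (hF : IsField F) (hG : IsField G) :
    IsField fun n ψ => F n ψ - G n ψ where
  add hφ hψ n := by rw [hF.add hφ hψ, hG.add hφ hψ]; abel
  smul hψ c n := by rw [hF.smul hψ, hG.smul hψ, smul_sub]
  symm hφ hψ n := by rw [inner_sub_left, inner_sub_right, hF.symm hφ hψ, hG.symm hφ hψ]
  mem hψ hm n := Submodule.sub_mem _ (hF.mem hψ hm n) (hG.mem hψ hm n)
  tame hf := (hF.tame hf).sub (hG.tame hf)

lemma IsField.const_smul {F : ℤ → 𝒥.D → 𝒥.D} (hF : IsField F) (c : ℝ) :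
    IsField fun n ψ => (c : ℂ) • F n ψ where
  add hφ hψ n := by rw [hF.add hφ hψ, smul_add]
  smul hψ c n := by rw [hF.smul hψ, smul_comm]
  symm hφ hψ n := by
    rw [inner_smul_left, inner_smul_right, hF.symm hφ hψ, Complex.conj_ofReal]
  mem hψ hm n := Submodule.smul_mem _ _ (hF.mem hψ hm n)
  tame hf := (hF.tame hf).smul _

lemma isField_J (X : 𝔤) : IsField fun n ψ => 𝒥.J X n ψ where
  add _ _ _ := map_add _ _ _
  smul _ _ _ := map_smul _ _ _
  symm _ _ _ := 𝒥.J_adjoint _ _ _ _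
  mem _ hm _ := J_mem_finiteEnergy hm _ _
  tame hf := hf.J X

section Frames

variable {O : Type*} [Fintype O] {d : O → ℕ}

lemma isField_frameSugawara (u : ∀ o, Fin (d o) → 𝔤) (w : O → ℝ) :
    IsField (𝒥.frameSugawara u w) where
  add hφ hψ n := by
    simp only [frameSugawara, normalMode_add hφ hψ, Finset.sum_add_distrib, smul_add]
  smul hψ c n := frameSugawara_smul hψ c n
  symm hφ hψ n := inner_frameSugawara hφ hψ n
  mem hψ hm n := Submodule.sum_mem _ fun o _ => by
    rw [real_smul_eq]
    exact Submodule.smul_mem _ _ (Submodule.sum_mem _ fun a _ =>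
      normalMode_mem_finiteEnergy hψ hm _ _ _)
  tame hf := by
    refine Tame.sum _ (hf.J (0 : 𝔤)) fun o _ => Tame.real_smul (Tame.sum _ (hf.J (0 : 𝔤)) ?_) _
    exact fun a _ => hf.normal _ _

lemma isField_frameField (u : ∀ o, Fin (d o) → 𝔤) (w : O → ℝ) (T : 𝔤) :
    IsField (𝒥.frameField u w T) where
  add hφ hψ n := frameField_add hφ hψ T n
  smul hψ c n := by
    simp only [frameField, normalMode_smul hψ, ← smul_add, ← Finset.smul_sum, real_smul_eq]
    rw [Finset.smul_sum]
    exact Finset.sum_congr rfl fun o _ => smul_comm _ _ _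
  symm hφ hψ n := inner_frameField hφ hψ T n
  mem hψ hm n := Submodule.sum_mem _ fun o _ => by
    rw [real_smul_eq]
    exact Submodule.smul_mem _ _ (Submodule.sum_mem _ fun a _ => Submodule.add_mem _
      (normalMode_mem_finiteEnergy hψ hm _ _ _) (normalMode_mem_finiteEnergy hψ hm _ _ _))
  tame hf := by
    refine Tame.sum _ (hf.J (0 : 𝔤)) fun o _ => Tame.real_smul (Tame.sum _ (hf.J (0 : 𝔤)) ?_) _
    exact fun a _ => (hf.normal _ _).add (hf.normal _ _)

end Frames

/-! ### Frames for the given fields -/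

/-- The index `1` of `𝔤` in itself makes this an instance of the weights `1 / (2 (I k + v))`; the
factor `2π` comes from `π / (k + v)`. -/
lemma sugawara_eq {m : ℕ} {e u : Basis (Fin m) ℝ 𝔤}
    (h : Contracts (lowerMetric (metric 𝔤) e) e u) {E : ℤ} {ψ : 𝒥.D} (hψ : 𝒥.Annih E ψ) (n : ℤ) :
    𝒥.sugawara e n ψ = ((2 * Real.pi : ℝ) : ℂ) • 𝒥.frameSugawara (O := Unit) (fun _ => u)
      (fun _ => (2 * (1 * k + dualCoxeter 𝔤))⁻¹) n ψ := by
  have h1 := h.sum_eq (normalBilin hψ n)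
  simp only [normalBilin_apply] at h1
  rw [sugawara, frameSugawara, h1, ← real_smul_eq]
  simp only [Finset.univ_unique, Finset.sum_singleton, smul_smul]
  congr 1
  rw [one_mul, mul_inv]
  field_simp

/-- The frame spans `𝔤`, so by linearity `C = 1` and every colour stabilizes the frame, whence no
covariance field appears. -/
lemma frameSugawara_adjoint_comm {m : ℕ} {u : Basis (Fin m) ℝ 𝔤} {v : ℝ}
    (hF : IsFrameSystem (O := Unit) (fun _ => u) (fun _ => 1) (fun _ => v)) (hv : 0 < 1 * k + v)
    {E : ℤ} {ψ : 𝒥.D} (hψ : 𝒥.Annih E ψ) (T : 𝔤) (n m : ℤ) :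
    𝒥.frameSugawara (O := Unit) (fun _ => u) (fun _ => (2 * (1 * k + v))⁻¹) n (𝒥.J T m ψ) =
      𝒥.J T m (𝒥.frameSugawara (O := Unit) (fun _ => u) (fun _ => (2 * (1 * k + v))⁻¹) n ψ) -
        (m : ℂ) • 𝒥.J T (n + m) ψ := by
  have hw : ∀ o : Unit, (2 * (1 * k + v))⁻¹ * (2 * (1 * k + v)) = 1 := fun _ =>
    inv_mul_cancel₀ (by positivity)
  have hC : frameCasimir (O := Unit) (fun _ => u) (fun _ => (2 * (1 * k + v))⁻¹) k T = T := by
    have h := u.mem_span T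
    induction h using Submodule.span_induction with
    | mem x hx =>
      obtain ⟨c, rfl⟩ := hx
      exact hF.frameCasimir_self hw () c
    | zero => rw [← zero_smul ℝ (0 : 𝔤), frameCasimir_smul, zero_smul, zero_smul]
    | add x y _ _ hx hy => rw [frameCasimir_add, hx, hy]
    | smul c x _ hx => rw [frameCasimir_smul, hx]
  have hΦ : Stabilizes (O := Unit) (fun _ => u) T := by
    clear hC
    have h := u.mem_span T
    induction h using Submodule.span_induction with
    | mem x hx =>
      obtain ⟨c, rfl⟩ := hx
      exact hF.stabilizes () c
    | zero => exact fun o => ⟨fun _ _ => 0, fun _ _ => by simp, fun a => by simp⟩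
    | add x y _ _ hx hy =>
      intro o
      obtain ⟨M, hM, hM'⟩ := hx o
      obtain ⟨N, hN, hN'⟩ := hy o
      refine ⟨fun a b => M a b + N a b, fun a b => ?_, fun a => ?_⟩
      · simp only; rw [hM, hN]; ring
      · rw [add_lie, hM', hN', ← Finset.sum_add_distrib]
        simp only [add_smul]
    | smul c x _ hx =>
      intro o
      obtain ⟨M, hM, hM'⟩ := hx o
      refine ⟨fun a b => c * M a b, fun a b => ?_, fun a => ?_⟩
      · simp only; rw [hM]; ring
      · rw [smul_lie, hM', Finset.smul_sum]
        simp only [mul_smul]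
  rw [frameSugawara_comm hψ, frameField_eq_zero_of_stabilizes hΦ _ hψ, hC, smul_zero, zero_sub,
    ← sub_eq_add_neg]

section Sub

variable {𝔥 : Type*} [LieRing 𝔥] [LieAlgebra ℝ 𝔥] {A : Type*} [Fintype A] {ι : 𝔥 →ₗ⁅ℝ⁆ 𝔤}
  {s : A → LieIdeal ℝ 𝔥} {z : LieIdeal ℝ 𝔥} {d : Option A → ℕ}
  {b : ∀ o, Basis (Fin (d o)) ℝ (part s z o)} {u : ∀ o, Fin (d o) → 𝔤}
  (hu : ∀ o, Contracts (partLower ι b o) (colour ι b o) (u o))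

include hu

lemma subSugawara_eq {E : ℤ} {ψ : 𝒥.D} (hψ : 𝒥.Annih E ψ) (n : ℤ) :
    𝒥.subSugawara ι b n ψ = ((2 * Real.pi : ℝ) : ℂ) • 𝒥.frameSugawara u
      (fun o => (2 * (partIndex ι s o * k + partCoxeter s o))⁻¹) n ψ := by
  rw [subSugawara, frameSugawara, ← real_smul_eq, Finset.smul_sum]
  refine Finset.sum_congr rfl fun o _ => ?_
  have h1 := (hu o).sum_eq (normalBilin hψ n)
  simp only [normalBilin_apply] at h1
  rw [h1, smul_smul]
  congr 1
  rw [mul_inv]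
  field_simp

lemma covarianceField_eq {E : ℤ} {ψ : 𝒥.D} (hψ : 𝒥.Annih E ψ) (T : 𝔤) (n : ℤ) :
    𝒥.covarianceField ι b T n ψ = 𝒥.frameField u
      (fun o => (2 * (partIndex ι s o * k + partCoxeter s o))⁻¹) T n ψ := by
  rw [covarianceField, frameField]
  refine Finset.sum_congr rfl fun o _ => congrArg _ ?_
  have h1 := (hu o).sum_eq (LinearMap.mk₂ ℝ
    (fun X Y : 𝔤 => normalBilin hψ n X ⁅Y, T⁆ + normalBilin hψ n ⁅Y, T⁆ X)
    (fun X X' Y => by simp only [map_add, LinearMap.add_apply]; abel)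
    (fun c X Y => by simp only [map_smul, LinearMap.smul_apply, smul_add])
    (fun X Y Y' => by simp only [add_lie, map_add, LinearMap.add_apply]; abel)
    (fun c X Y => by simp only [smul_lie, map_smul, LinearMap.smul_apply, smul_add]))
  simpa only [LinearMap.mk₂_apply, normalBilin_apply] using h1

omit [Fintype A] in
lemma casimir_eq (o : Option A) (T : 𝔤) : casimir ι b o T = -∑ a, ⁅u o a, ⁅u o a, T⁆⁆ := by
  have h1 := (hu o).sum_eq (LinearMap.mk₂ ℝ (fun X Y : 𝔤 => ⁅Y, ⁅X, T⁆⁆)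
    (fun X X' Y => by rw [add_lie, lie_add]) (fun c X Y => by rw [smul_lie, lie_smul])
    (fun X Y Y' => by rw [add_lie]) (fun c X Y => by rw [smul_lie]))
  simp only [LinearMap.mk₂_apply] at h1
  rw [casimir, h1]

/-- The frame has squared length `I`, so `P_α` carries `I⁻¹`, which turns `2 I k P_α` into `2 k ∑
⟨u_a, T⟩ u_a`. -/
lemma weightedCasimir_eq (hF : IsFrameSystem u (partIndex ι s) (partCoxeter s))
    (hp : ∀ o T, proj ι b o T = (partIndex ι s o)⁻¹ • ∑ a, metric 𝔤 (u o a) T • u o a) (T : 𝔤) :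
    weightedCasimir ι b k T = frameCasimir u
      (fun o => (2 * (partIndex ι s o * k + partCoxeter s o))⁻¹) k T := by
  rw [weightedCasimir, frameCasimir]
  refine Finset.sum_congr rfl fun o _ => congrArg _ ?_
  have := (hF.index_pos o).ne'
  rw [casimir_eq hu, hp, smul_smul, ← sub_eq_add_neg]
  congr 2
  field_simp

end Sub

end Currents

end CurrentAlg
end

noncomputable section

namespace CurrentAlg

open TestFun Filter

/-! ### Fourier expansion of smeared currents -/

/-- Sequences that decay faster than every power. -/
def Rapid (a : ℤ → ℂ) : Prop := ∀ N : ℕ, Summable fun n : ℤ => ‖a n‖ * (1 + |(n : ℝ)|) ^ N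

lemma rapid_fc (f : TestFun) : Rapid (fc f.1) := summable_fc_poly f

lemma Rapid.const_mul {a : ℤ → ℂ} (ha : Rapid a) (c : ℂ) : Rapid fun n => c * a n := fun N => by
  simpa only [norm_mul, mul_assoc] using (ha N).mul_left ‖c‖

lemma rapid_coeff {h : ℝ → ℂ} (hh : IsTest 2 h) : Rapid (Currents.coeff h) := by
  have : Currents.coeff h = fun n => ((2 * Real.pi : ℝ) : ℂ)⁻¹ * fc (ofVector h hh).1 n :=
    funext fun n => coeff_eq h hh n
  rw [this]
  exact (rapid_fc _).const_mul _

lemma Rapid.summable_smul {a : ℤ → ℂ} (ha : Rapid a) {V : Type*} [NormedAddCommGroup V]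
    [NormedSpace ℂ V] [CompleteSpace V] {x : ℤ → V} {C : ℝ} {N : ℕ}
    (hx : ∀ n, ‖x n‖ ≤ C * (1 + |(n : ℝ)|) ^ N) : Summable fun n => a n • x n := by
  refine Summable.of_norm_bounded ((ha N).mul_left C) fun n => ?_
  rw [norm_smul, mul_left_comm]
  exact mul_le_mul_of_nonneg_left (hx n) (norm_nonneg _)

lemma TestFun.iterate_l₀_sub_sum (g : TestFun) (s : Finset ℤ) (r : ℕ) :
    l₀^[r] (g - ∑ n ∈ s, fc g.1 n • mode n) =
      l₀^[r] g - ∑ n ∈ s, fc (l₀^[r] g).1 n • mode n := by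
  induction r with
  | zero => rfl
  | succ r ih =>
    rw [Function.iterate_succ_apply', ih, Function.iterate_succ_apply']
    change l₀Lin _ = l₀Lin _ - _
    rw [map_sub, map_sum]
    congr 1
    refine Finset.sum_congr rfl fun n _ => ?_
    rw [map_smul]
    change _ • l₀ (mode n) = fc (l₀ _).1 n • _
    rw [l₀_mode, fc_l₀, smul_smul, mul_comm]

/-- Remainders of Fourier series. -/
lemma TestFun.norm_sub_sum_le (g : TestFun) (s : Finset ℤ) (N : ℕ) {r : ℕ} (hr : r ≤ N) (x : ℝ) :
    ‖(l₀^[r] (g - ∑ n ∈ s, fc g.1 n • mode n)).1 x‖ ≤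
      ∑' n : {n // n ∉ s}, ‖fc g.1 n‖ * (1 + |((n : ℤ) : ℝ)|) ^ N := by
  rw [iterate_l₀_sub_sum]
  have hs := hasSum_fc (l₀^[r] g) x
  have hsum : (∑ n ∈ s, fc (l₀^[r] g).1 n • mode n).1 x =
      ∑ n ∈ s, fc (l₀^[r] g).1 n * (mode n).1 x := by
    have h : ∀ f : TestFun, f.1 x = ((Pi.evalAlgHom ℂ (fun _ : ℝ => ℂ) x).comp TestFun.val) f :=
      fun _ => rfl
    rw [h, map_sum]
    refine Finset.sum_congr rfl fun n _ => ?_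
    rw [map_smul]; rfl
  have hb : ∀ n, ‖fc (l₀^[r] g).1 n * (mode n).1 x‖ ≤ ‖fc g.1 n‖ * (1 + |(n : ℝ)|) ^ N := by
    intro n
    rw [norm_mul, norm_mode, mul_one, fc_iterate_l₀, norm_mul, norm_pow, norm_mul, Complex.norm_I,
      one_mul, Complex.norm_intCast, mul_comm]
    refine mul_le_mul_of_nonneg_left ?_ (norm_nonneg _)
    have h0 := abs_nonneg (n : ℝ)
    calc |(n : ℝ)| ^ r ≤ (1 + |(n : ℝ)|) ^ r := by gcongr; linarith
      _ ≤ (1 + |(n : ℝ)|) ^ N := pow_le_pow_right₀ (by linarith) hr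
  have hS := rapid_fc g N
  have hS' : Summable fun n : {n // n ∉ s} => ‖fc g.1 n‖ * (1 + |((n : ℤ) : ℝ)|) ^ N :=
    hS.subtype _
  have e : (l₀^[r] g - ∑ n ∈ s, fc (l₀^[r] g).1 n • mode n).1 x =
      ∑' n : {n // n ∉ s}, fc (l₀^[r] g).1 n * (mode n).1 x := by
    change (l₀^[r] g).1 x - (∑ n ∈ s, fc (l₀^[r] g).1 n • mode n).1 x = _
    rw [hsum, ← hs.tsum_eq, ← hs.summable.sum_add_tsum_subtype_compl s]
    ring
  rw [e]
  exact tsum_of_norm_bounded hS'.hasSum fun n => hb n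

namespace Currents

variable {𝔤 : Type*} [LieRing 𝔤] [LieAlgebra ℝ 𝔤] {k : ℕ} {H : Type*}
  [NormedAddCommGroup H] [InnerProductSpace ℂ H] {𝒥 : Currents 𝔤 k H}

/-- The expansion of smeared currents in modes. -/
lemma hasSum_j (X : 𝔤) (g : TestFun) (ψ : 𝒥.D) :
    HasSum (fun n => fc g.1 n • (𝒥.J X n ψ : H)) (𝒥.j X g ψ : H) := by
  -- Continuity of order `N` bounds the remainder by a tail of `∑ |fc g n| (1 + |n|)^N`, which tends
  -- to zero.
  obtain ⟨C, N, hC⟩ := 𝒥.distribution X ψ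
  have hS := rapid_fc g N
  have ht := tendsto_tsum_compl_atTop_zero fun n : ℤ => ‖fc g.1 n‖ * (1 + |(n : ℝ)|) ^ N
  have hb : ∀ s : Finset ℤ, ‖(𝒥.j X g ψ : H) - ∑ n ∈ s, fc g.1 n • (𝒥.J X n ψ : H)‖ ≤
      C * ∑' n : {n // n ∉ s}, ‖fc g.1 n‖ * (1 + |((n : ℤ) : ℝ)|) ^ N := fun s => by
    have h := hC (g - ∑ n ∈ s, fc g.1 n • mode n) _ fun m hm x => norm_sub_sum_le g s N hm x
    rw [map_sub, map_sum, LinearMap.sub_apply, LinearMap.sum_apply] at h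
    simp only [map_smul, LinearMap.smul_apply] at h
    simpa [J] using h
  rw [HasSum, SummationFilter.unconditional_filter, tendsto_iff_norm_sub_tendsto_zero]
  refine squeeze_zero (fun _ => norm_nonneg _) (fun s => ?_) (by simpa using ht.const_mul C)
  rw [norm_sub_rev]
  exact hb s

/-! ### Density of the vectors of finite energy -/

/-- Cyclicity refers to arbitrary smeared currents, not only to modes. The vectors all of whose
words lie in the closure `K` form a subspace invariant under smeared currents: a word is commuted
through `j X g`, which finally acts by its mode expansion, so cyclicity applies. -/
lemma dense_finiteEnergy : Dense (𝒥.finiteEnergy.map 𝒥.D.subtype : Set H) := by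
  set K := (𝒥.finiteEnergy.map 𝒥.D.subtype).topologicalClosure with hK
  have hmem : ∀ ψ ∈ 𝒥.finiteEnergy, (ψ : H) ∈ K := fun ψ hψ =>
    Submodule.le_topologicalClosure _ ⟨ψ, hψ, rfl⟩
  let W : Submodule ℂ 𝒥.D :=
    { carrier := {ψ | ∀ l, (𝒥.word l ψ : H) ∈ K}
      zero_mem' := fun l => by rw [map_zero]; exact K.zero_mem
      add_mem' := fun {φ ψ} hφ hψ l => by rw [map_add]; exact K.add_mem (hφ l) (hψ l)
      smul_mem' := fun c ψ hψ l => by rw [map_smul]; exact K.smul_mem c (hψ l) }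
  have hWJ : ∀ X n, ∀ ψ ∈ W, 𝒥.J X n ψ ∈ W := fun X n ψ hψ l => by
    have := hψ (l ++ [(X, n)])
    rwa [word_append] at this
  have hWΩ : 𝒥.Ω ∈ W := fun l => hmem _ (by
    induction l with
    | nil => exact vacuum_mem_finiteEnergy
    | cons p l ih => exact J_mem_finiteEnergy ih _ _)
  have hWj : ∀ (l : List (𝔤 × ℤ)) X g, ∀ ψ ∈ W, (𝒥.word l (𝒥.j X g ψ) : H) ∈ K := by
    intro l
    induction l using List.reverseRecOn with
    | nil =>
      intro X g ψ hψ
      rw [word_nil]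
      refine (Submodule.isClosed_topologicalClosure _).mem_of_tendsto (hasSum_j X g ψ)
        (Eventually.of_forall fun s => ?_)
      exact K.sum_mem fun n _ => K.smul_mem _ (hWJ X n ψ hψ [])
    | append_singleton l p ih =>
      intro X g ψ hψ
      rw [word_append, word_cons, word_nil]
      have h := 𝒥.commutator p.1 X (mode p.2) g ψ
      rw [sub_eq_iff_eq_add] at h
      rw [J, h, map_add, map_add, map_smul, map_smul]
      exact K.add_mem (K.add_mem (K.smul_mem _ (ih _ _ ψ hψ)) (K.smul_mem _ (hψ l)))
        (ih _ _ _ (hWJ p.1 p.2 ψ hψ))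
  have hd := 𝒥.cyclic W hWΩ fun X g ψ hψ l => hWj l X g ψ hψ
  have hle : (W.map 𝒥.D.subtype : Set H) ⊆ K := by
    rintro _ ⟨ψ, hψ, rfl⟩
    exact hψ []
  rw [← dense_closure]
  exact hd.mono hle

/-! ### Closability -/

/-- Closures of operators with densely defined adjoints are single valued. -/
lemma closure_graph_unique {G : Set (H × H)} {S : Set H} (hS : Dense S)
    (h : ∀ φ ∈ S, ∃ φ' : H, ∀ p ∈ G, inner ℂ φ p.2 = inner ℂ φ' p.1) {v w w' : H}
    (hw : (v, w) ∈ closure G) (hw' : (v, w') ∈ closure G) : w = w' := by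
  have key : ∀ φ ∈ S, inner ℂ φ (w - w') = 0 := fun φ hφ => by
    obtain ⟨φ', hφ'⟩ := h φ hφ
    have hc : closure G ⊆ {p | inner ℂ φ p.2 = inner ℂ φ' p.1} :=
      closure_minimal hφ' (isClosed_eq (by fun_prop) (by fun_prop))
    have h1 : inner ℂ φ w = inner ℂ φ' v := hc hw
    have h2 : inner ℂ φ w' = inner ℂ φ' v := hc hw'
    rw [inner_sub_right, h1, h2, sub_self]
  have hall : ∀ φ, inner ℂ φ (w - w') = 0 := fun φ => by
    have hc : closure S ⊆ {φ : H | inner ℂ φ (w - w') = 0} :=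
      closure_minimal key (isClosed_eq (by fun_prop) (by fun_prop))
    exact hc (hS φ)
  exact sub_eq_zero.1 (inner_self_eq_zero.1 (hall _))

lemma currentGraph_unique (X : 𝔤) (g : TestFun) {v w w' : H}
    (hw : (v, w) ∈ closure (𝒥.currentGraph X g)) (hw' : (v, w') ∈ closure (𝒥.currentGraph X g)) :
    w = w' := by
  refine closure_graph_unique 𝒥.dense (fun φ hφ => ?_) hw hw'
  refine ⟨𝒥.j X (TestFun.conj g) ⟨φ, hφ⟩, ?_⟩
  rintro _ ⟨ψ, rfl⟩
  exact 𝒥.symmetric X g ⟨φ, hφ⟩ ψ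

/-- Finite energy vectors are sums of vectors that form tame families. -/
lemma finiteEnergy_le_span (hΩ : ∀ X n, 0 ≤ n → 𝒥.J X n 𝒥.Ω = 0) : 𝒥.finiteEnergy ≤
    Submodule.span ℂ {ψ | ∃ (σ : ℝ) (E : ℤ),
      Tame (fun _ : Unit => σ) (fun _ => E) fun _ => ψ} := by
  refine finiteEnergy_le (Submodule.subset_span ⟨1, 0, tame_vacuum hΩ⟩) fun X n ψ hψ => ?_
  induction hψ using Submodule.span_induction with
  | mem x hx =>
    obtain ⟨σ, E, h⟩ := hx
    exact Submodule.subset_span ⟨_, _, (h.J X).comp fun _ : Unit => ((), n)⟩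
  | zero => rw [map_zero]; exact Submodule.zero_mem _
  | add x y _ _ hx hy => rw [map_add]; exact Submodule.add_mem _ hx hy
  | smul c x _ hx => rw [map_smul]; exact Submodule.smul_mem _ _ hx

lemma annih_finiteEnergy (hΩ : ∀ X n, 0 ≤ n → 𝒥.J X n 𝒥.Ω = 0) {ψ : 𝒥.D}
    (hψ : ψ ∈ 𝒥.finiteEnergy) : ∃ E, 𝒥.Annih E ψ := by
  have h := finiteEnergy_le_span hΩ hψ
  clear hψ
  induction h using Submodule.span_induction with
  | mem x hx => obtain ⟨σ, E, h⟩ := hx; exact ⟨E, h.annih ()⟩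
  | zero => exact ⟨0, fun X n _ => map_zero _⟩
  | add x y _ _ hx hy =>
    obtain ⟨E, h⟩ := hx
    obtain ⟨E', h'⟩ := hy
    exact ⟨max E E', (h.mono (le_max_left _ _)).add (h'.mono (le_max_right _ _))⟩
  | smul c x _ hx => obtain ⟨E, h⟩ := hx; exact ⟨E, h.smul c⟩

/-- Finite energy vectors are combinations of tame ones. The annihilation bound is carried through
the induction because additivity of `F` requires it. -/
lemma IsField.norm_le {F : ℤ → 𝒥.D → 𝒥.D} (hF : IsField F)
    (hΩ : ∀ X n, 0 ≤ n → 𝒥.J X n 𝒥.Ω = 0) {ψ : 𝒥.D} (hψ : ψ ∈ 𝒥.finiteEnergy) :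
    ∃ (C : ℝ) (N : ℕ), ∀ n, ‖F n ψ‖ ≤ C * (1 + |(n : ℝ)|) ^ N := by
  have h := finiteEnergy_le_span hΩ hψ
  clear hψ
  suffices h : (∃ E, 𝒥.Annih E ψ) ∧ ∃ (C : ℝ) (N : ℕ), 0 ≤ C ∧
      ∀ n, ‖F n ψ‖ ≤ C * (1 + |(n : ℝ)|) ^ N by
    obtain ⟨-, C, N, -, h⟩ := h
    exact ⟨C, N, h⟩
  induction h using Submodule.span_induction with
  | mem x hx =>
    obtain ⟨σ, E, h⟩ := hx
    refine ⟨⟨E, h.annih ()⟩, ?_⟩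
    obtain ⟨C, N, hC, hb⟩ := (hF.tame h).norm_le
    have := h.one_le ()
    refine ⟨C * σ ^ N, N, by positivity, fun n => (hb ((), n)).trans (le_of_eq ?_)⟩
    simp only [mul_pow]; ring
  | zero =>
    refine ⟨⟨0, fun X n _ => map_zero _⟩, 0, 0, le_rfl, fun n => ?_⟩
    have := hF.smul (ψ := 0) (E := 0) (fun X n _ => map_zero _) 0 n
    rw [zero_smul, zero_smul] at this
    simp [this]
  | add x y _ _ hx hy =>
    obtain ⟨⟨E, h⟩, C, N, hC, hb⟩ := hx
    obtain ⟨⟨E', h'⟩, C', N', hC', hb'⟩ := hy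
    have h1 := h.mono (le_max_left E E')
    have h2 := h'.mono (le_max_right E E')
    refine ⟨⟨_, h1.add h2⟩, C + C', N + N', by positivity, fun n => ?_⟩
    have h3 : 1 ≤ 1 + |(n : ℝ)| := by linarith [abs_nonneg (n : ℝ)]
    rw [hF.add h1 h2, add_mul]
    refine (norm_add_le _ _).trans (add_le_add ((hb n).trans ?_) ((hb' n).trans ?_))
    · exact mul_le_mul_of_nonneg_left (pow_le_pow_right₀ h3 (by omega)) hC
    · exact mul_le_mul_of_nonneg_left (pow_le_pow_right₀ h3 (by omega)) hC'
  | smul c x _ hx =>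
    obtain ⟨⟨E, h⟩, C, N, hC, hb⟩ := hx
    refine ⟨⟨E, h.smul c⟩, ‖c‖ * C, N, by positivity, fun n => ?_⟩
    rw [hF.smul h, norm_smul, mul_assoc]
    exact mul_le_mul_of_nonneg_left (hb n) (norm_nonneg c)

/-- The graph, over the vectors of finite energy, of `∑ a_n F_n`. -/
def modeGraph (F : ℤ → 𝒥.D → 𝒥.D) (a : ℤ → ℂ) : Set (H × H) :=
  {p | ∃ ψ ∈ 𝒥.finiteEnergy, p.1 = ↑ψ ∧ HasSum (fun n : ℤ => a n • (F n ψ : H)) p.2}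

/-- Symmetry of the modes gives the formal adjoint `∑ conj (a_n) F_{-n}`, which converges on the
dense set of finite energy vectors; hence the operator is closable. -/
lemma IsField.modeGraph_unique [CompleteSpace H] {F : ℤ → 𝒥.D → 𝒥.D} (hF : IsField F)
    (hΩ : ∀ X n, 0 ≤ n → 𝒥.J X n 𝒥.Ω = 0) {a : ℤ → ℂ} (ha : Rapid a) {v w w' : H}
    (hw : (v, w) ∈ closure (modeGraph F a)) (hw' : (v, w') ∈ closure (modeGraph F a)) : w = w' := by
  refine closure_graph_unique (dense_finiteEnergy (𝒥 := 𝒥)) (fun φ hφ => ?_) hw hw'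
  obtain ⟨φ, hφ, rfl⟩ := hφ
  obtain ⟨C, N, hb⟩ := hF.norm_le hΩ hφ
  have hs : Summable fun n => starRingEnd ℂ (a n) • (F (-n) φ : H) := by
    have h1 : Rapid fun n => starRingEnd ℂ (a n) := fun M => by
      simpa only [RCLike.norm_conj] using ha M
    refine h1.summable_smul (C := C) (N := N) fun n => ?_
    have := hb (-n)
    rw [Int.cast_neg, abs_neg] at this
    exact this
  refine ⟨∑' n, starRingEnd ℂ (a n) • (F (-n) φ : H), ?_⟩
  rintro ⟨v, w⟩ ⟨ψ, hψ, rfl, hw⟩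
  obtain ⟨E, hE⟩ := annih_finiteEnergy hΩ hφ
  obtain ⟨E', hE'⟩ := annih_finiteEnergy hΩ hψ
  have h1 := hw.mapL (innerSL ℂ (φ : H))
  have h2 := (hs.hasSum.mapL (innerSL ℂ (ψ : H))).star
  simp only [innerSL_apply_apply, inner_smul_right] at h1 h2
  have h3 : (fun n => star (starRingEnd ℂ (a n) * inner ℂ (ψ : H) (F (-n) φ : H))) =
      fun n => a n * inner ℂ (φ : H) (F n ψ : H) := by
    funext n
    rw [star_mul', ← starRingEnd_apply, ← starRingEnd_apply, Complex.conj_conj, inner_conj_symm]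
    congr 1
    exact (hF.symm hE hE' n).symm
  rw [h3] at h2
  have h4 := h1.unique h2
  rw [← starRingEnd_apply, inner_conj_symm] at h4
  exact h4

end Currents

end CurrentAlg
end

noncomputable section

namespace CurrentAlg

open TestFun Filter

namespace Currents

variable {𝔤 : Type*} [LieRing 𝔤] [LieAlgebra ℝ 𝔤] {k : ℕ} {H : Type*}
  [NormedAddCommGroup H] [InnerProductSpace ℂ H] {𝒥 : Currents 𝔤 k H}

/-! ### Products of smeared fields on the vacuum -/

/-- Lets smeared currents be treated like the other fields, by restriction to finite energy vectors.
-/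
lemma modeGraph_J_subset (X : 𝔤) (g : TestFun) :
    modeGraph (fun n ψ => 𝒥.J X n ψ) (fc g.1) ⊆ 𝒥.currentGraph X g := by
  rintro ⟨v, w⟩ ⟨ψ, -, rfl, hw⟩
  exact ⟨ψ, Prod.ext rfl (hw.unique (hasSum_j X g ψ))⟩

lemma IsField.sum_smul {F : ℤ → 𝒥.D → 𝒥.D} (hF : IsField F) {α : Type*} (s : Finset α)
    (c : α → ℂ) {x : α → 𝒥.D} {E : α → ℤ} (hx : ∀ i, 𝒥.Annih (E i) (x i)) (n : ℤ) :
    F n (∑ i ∈ s, c i • x i) = ∑ i ∈ s, c i • F n (x i) := by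
  classical
  suffices h : (∃ E', 𝒥.Annih E' (∑ i ∈ s, c i • x i)) ∧
      F n (∑ i ∈ s, c i • x i) = ∑ i ∈ s, c i • F n (x i) from h.2
  induction s using Finset.induction_on with
  | empty =>
    refine ⟨⟨0, fun X n _ => by simp⟩, ?_⟩
    have := hF.smul (ψ := 0) (E := 0) (fun X n _ => map_zero _) 0 n
    rw [zero_smul, zero_smul] at this
    simpa using this
  | insert i s hi ih =>
    obtain ⟨⟨E', hE'⟩, ih⟩ := ih
    have h1 := (((hx i).smul (c i)).mono (le_max_left (E i) E'))
    have h2 := hE'.mono (le_max_right (E i) E')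
    rw [Finset.sum_insert hi, Finset.sum_insert hi]
    exact ⟨⟨_, h1.add h2⟩, by rw [hF.add h1 h2, hF.smul (hx i), ih]⟩

section Vacuum

variable (hΩ : ∀ X n, 0 ≤ n → 𝒥.J X n 𝒥.Ω = 0)

include hΩ

lemma IsField.tame_vacuum {G : ℤ → 𝒥.D → 𝒥.D} (hG : IsField G) :
    Tame (fun m : ℤ => 1 + |(m : ℝ)|) (fun m => -m) fun m => G m 𝒥.Ω := by
  simpa using (hG.tame (Currents.tame_vacuum hΩ)).comp fun m : ℤ => ((), m)

lemma IsField.norm_vacuum_le {G : ℤ → 𝒥.D → 𝒥.D} (hG : IsField G) :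
    ∃ (C : ℝ) (N : ℕ), ∀ m, ‖G m 𝒥.Ω‖ ≤ C * (1 + |(m : ℝ)|) ^ N := by
  obtain ⟨C, N, -, h⟩ := (hG.tame_vacuum hΩ).norm_le
  exact ⟨C, N, h⟩

/-- Tameness of the two-index family `F_n G_m Ω` bounds its norm polynomially in `n` and `m`
jointly, and rapid decay does the rest. -/
lemma IsField.summable_product [CompleteSpace H] {F G : ℤ → 𝒥.D → 𝒥.D} (hF : IsField F)
    (hG : IsField G) {a c : ℤ → ℂ} (ha : Rapid a) (hc : Rapid c) :
    Summable fun p : ℤ × ℤ => (a p.1 * c p.2) • (F p.1 (G p.2 𝒥.Ω) : H) := by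
  obtain ⟨C, N, hC, hb⟩ := (hF.tame (hG.tame_vacuum hΩ)).norm_le
  have hs := ((ha N).mul_of_nonneg (hc N) (fun _ => by positivity) fun _ => by positivity).mul_left C
  refine Summable.of_norm_bounded hs fun p => ?_
  have h := hb (p.2, p.1)
  rw [norm_smul, norm_mul]
  calc _ ≤ ‖a p.1‖ * ‖c p.2‖ * (C * ((1 + |(p.2 : ℝ)|) * (1 + |(p.1 : ℝ)|)) ^ N) :=
        mul_le_mul_of_nonneg_left h (by positivity)
    _ = _ := by rw [mul_pow]; ring

/-- The vacuum is in the domain of products of smeared fields. -/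
lemma IsField.exists_product [CompleteSpace H] {F G : ℤ → 𝒥.D → 𝒥.D} (hF : IsField F)
    (hG : IsField G) {a c : ℤ → ℂ} (ha : Rapid a) (hc : Rapid c) :
    ∃ v, ((𝒥.Ω : H), v) ∈ modeGraph G c ∧
      (v, ∑' p : ℤ × ℤ, (a p.1 * c p.2) • (F p.1 (G p.2 𝒥.Ω) : H)) ∈ closure (modeGraph F a) := by
  obtain ⟨C, N, hb⟩ := hG.norm_vacuum_le hΩ
  have hv := (hc.summable_smul (x := fun m => (G m 𝒥.Ω : H)) hb).hasSum
  refine ⟨_, ⟨𝒥.Ω, vacuum_mem_finiteEnergy, rfl, hv⟩, ?_⟩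
  have hs := hF.summable_product hΩ hG ha hc
  have hw := (Equiv.prodComm ℤ ℤ).hasSum_iff.2 hs.hasSum
  have hw' := hw.prod_fiberwise fun m => (hw.summable.prod_factor m).hasSum
  have hann : ∀ m, 𝒥.Annih (-m) (G m 𝒥.Ω) := (hG.tame_vacuum hΩ).annih
  -- The vector `∑ c_m G_m Ω` need not have finite energy. Its partial sums do, and their images
  -- converge because the double series may be summed over `n` within each `m`.
  refine mem_closure_of_tendsto (Tendsto.prodMk_nhds hv hw') (Eventually.of_forall fun s => ?_)
  refine ⟨∑ m ∈ s, c m • G m 𝒥.Ω, Submodule.sum_mem _ fun m _ => Submodule.smul_mem _ _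
    (hG.mem (annih_vacuum hΩ) vacuum_mem_finiteEnergy m), by simp, ?_⟩
  have h := hasSum_sum (s := s) fun m _ => (hw.summable.prod_factor m).hasSum
  convert h using 1
  funext n
  rw [hF.sum_smul s c hann]
  simp only [Function.comp_apply, Equiv.prodComm_apply, Prod.swap_prod_mk, mul_smul,
    ← Finset.smul_sum]
  simp

end Vacuum

/-! ### Regrouping double series -/

lemma summable_regroup [CompleteSpace H] {a c : ℤ → ℂ} (ha : Rapid a) (hc : Rapid c) {x : ℤ → H}
    {C : ℝ} {N : ℕ} (hx : ∀ n, ‖x n‖ ≤ C * (1 + |(n : ℝ)|) ^ N) :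
    Summable fun p : ℤ × ℤ => (a p.1 * c p.2) • x (p.1 + p.2) := by
  have hs := ((ha N).mul_of_nonneg (hc N) (fun _ => by positivity)
    fun _ => by positivity).mul_left |C|
  refine Summable.of_norm_bounded hs fun p => ?_
  rw [norm_smul, norm_mul]
  have h1 := one_add_abs_add_le p.1 p.2
  have h2 : ‖x (p.1 + p.2)‖ ≤ |C| * ((1 + |(p.1 : ℝ)|) * (1 + |(p.2 : ℝ)|)) ^ N :=
    (hx _).trans (by
      calc _ ≤ |C| * (1 + |((p.1 + p.2 : ℤ) : ℝ)|) ^ N := by gcongr; exact le_abs_self C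
        _ ≤ _ := by gcongr)
  calc _ ≤ ‖a p.1‖ * ‖c p.2‖ * (|C| * ((1 + |(p.1 : ℝ)|) * (1 + |(p.2 : ℝ)|)) ^ N) :=
        mul_le_mul_of_nonneg_left h2 (by positivity)
    _ = _ := by rw [mul_pow]; ring

lemma hasSum_regroup [CompleteSpace H] (f g : TestFun) {x : ℤ → H}
    {C : ℝ} {N : ℕ} (hx : ∀ n, ‖x n‖ ≤ C * (1 + |(n : ℝ)|) ^ N) :
    HasSum (fun p => fc (f * g).1 p • x p)
      (∑' p : ℤ × ℤ, (fc f.1 p.1 * fc g.1 p.2) • x (p.1 + p.2)) := by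
  have hs := summable_regroup (rapid_fc f) (rapid_fc g) hx
  -- The new coordinates are the total mode number and the first mode number, so the fibre sums are
  -- convolutions.
  let e : ℤ × ℤ ≃ ℤ × ℤ :=
    { toFun := fun q => (q.2, q.1 - q.2)
      invFun := fun p => (p.1 + p.2, p.1)
      left_inv := fun q => by ext <;> simp
      right_inv := fun p => by ext <;> simp }
  have h := e.hasSum_iff.2 hs.hasSum
  refine h.prod_fiberwise fun p => ?_
  have h1 := (hasSum_fc_mul f g p).smul_const (x p)
  simpa [e, Function.comp_def] using h1

/-- The norm of a series of orthogonal vectors. -/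
lemma hasSum_inner_of_orthogonal {x : ℤ → H} {y : H} (hx : HasSum x y)
    (ho : ∀ n m, n ≠ m → inner ℂ (x n) (x m) = 0) :
    HasSum (fun n => inner ℂ (x n) (x n)) (inner ℂ y y) := by
  have h1 : ∀ n, inner ℂ (x n) y = inner ℂ (x n) (x n) := fun n => by
    have h := hx.mapL (innerSL ℂ (x n))
    simp only [innerSL_apply_apply] at h
    exact h.unique (hasSum_single n fun m hm => ho n m hm.symm)
  have h2 := (hx.mapL (innerSL ℂ y)).star
  simp only [innerSL_apply_apply, ← starRingEnd_apply, inner_conj_symm, h1] at h2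
  exact h2

end Currents

end CurrentAlg
end

noncomputable section

namespace CurrentAlg

open TestFun Filter

namespace Currents

variable {𝔤 : Type*} [LieRing 𝔤] [LieAlgebra ℝ 𝔤] {k : ℕ} {H : Type*}
  [NormedAddCommGroup H] [InnerProductSpace ℂ H] {𝒥 : Currents 𝔤 k H}

/-! ### Two-point functions of smeared fields -/

/-- The modes of `G` generate from the vacuum vectors with the norms that belong to the two-point
function `κ Δ^{2r+2}`. -/
structure HasTwoPoint (G : ℤ → 𝒥.D → 𝒥.D) (r : ℕ) (κ : ℂ) : Prop where
  inner_self : ∀ l : ℕ, inner ℂ (G (-(l + r + 1 : ℤ)) 𝒥.Ω) (G (-(l + r + 1 : ℤ)) 𝒥.Ω) =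
    ((l + (2 * r + 1)).choose (2 * r + 1) : ℂ) * κ
  eq_zero : ∀ n : ℤ, -(r + 1 : ℤ) < n → G n 𝒥.Ω = 0

section Vacuum

variable (hΩ : ∀ X n, 0 ≤ n → 𝒥.J X n 𝒥.Ω = 0)

include hΩ

lemma IsField.inner_vacuum_eq_zero {F G : ℤ → 𝒥.D → 𝒥.D} (hF : IsField F) (hG : IsField G)
    {n m : ℤ} (h : n ≠ m) : inner ℂ (F n 𝒥.Ω) (G m 𝒥.Ω) = 0 :=
  𝒥.inner_eq_zero_of_energy ((hF.tame_vacuum hΩ).energy n) ((hG.tame_vacuum hΩ).energy m)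
    (by omega)

/-- The norm of smeared fields on the vacuum. -/
lemma IsField.inner_self_eq {G : ℤ → 𝒥.D → 𝒥.D} (hG : IsField G) {r : ℕ} {κ : ℂ}
    (hr : HasTwoPoint G r κ) (f : TestFun) {y : H}
    (hy : HasSum (fun n => fc f.1 n • (G n 𝒥.Ω : H)) y) :
    inner ℂ y y = κ * ∑' l : ℕ, ((l + (2 * r + 1)).choose (2 * r + 1) : ℂ) *
      fc (TestFun.conj f).1 (l + r + 1) * fc f.1 (-(l + r + 1 : ℤ)) := by
  have h := hasSum_inner_of_orthogonal hy fun n m hnm => by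
    rw [inner_smul_left, inner_smul_right]
    have h0 : inner ℂ (G n 𝒥.Ω : H) (G m 𝒥.Ω : H) = 0 := hG.inner_vacuum_eq_zero hΩ hG hnm
    rw [h0, mul_zero, mul_zero]
  have hinj : Function.Injective fun l : ℕ => -(l + r + 1 : ℤ) := fun l l' h => by
    simp only at h; omega
  rw [← hinj.hasSum_iff] at h
  · rw [← h.tsum_eq, ← tsum_mul_left]
    refine tsum_congr fun l => ?_
    have h1 : fc (TestFun.conj f).1 (l + r + 1) = starRingEnd ℂ (fc f.1 (-(l + r + 1 : ℤ))) :=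
      fc_conj f.1 _
    have h2 : inner ℂ (G (-(l + r + 1 : ℤ)) 𝒥.Ω : H) (G (-(l + r + 1 : ℤ)) 𝒥.Ω : H) = _ :=
      hr.inner_self l
    rw [Function.comp_apply, inner_smul_left, inner_smul_right, h2, h1]
    ring
  · intro n hn
    have : -(r + 1 : ℤ) < n := by
      by_contra hlt
      exact hn ⟨(-n - r - 1).toNat, by simp only; omega⟩
    rw [hr.eq_zero n this]
    simp

/-- Vacuum expectation values of products of smeared fields. -/
lemma IsField.inner_product_eq [CompleteSpace H] {G : ℤ → 𝒥.D → 𝒥.D} (hG : IsField G) {r : ℕ}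
    {κ : ℂ} (hr : HasTwoPoint G r κ) {a c : ℤ → ℂ} (ha : Rapid a) (hc : Rapid c) :
    inner ℂ (𝒥.Ω : H) (∑' p : ℤ × ℤ, (a p.1 * c p.2) • (G p.1 (G p.2 𝒥.Ω) : H)) =
      κ * ∑' l : ℕ, ((l + (2 * r + 1)).choose (2 * r + 1) : ℂ) * a (l + r + 1) *
        c (-(l + r + 1 : ℤ)) := by
  have hs := (hG.summable_product hΩ hG ha hc).hasSum.mapL (innerSL ℂ (𝒥.Ω : H))
  simp only [innerSL_apply_apply, inner_smul_right] at hs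
  have hadj : ∀ n m, inner ℂ (𝒥.Ω : H) (G n (G m 𝒥.Ω) : H) = inner ℂ (G (-n) 𝒥.Ω) (G m 𝒥.Ω) :=
    fun n m => hG.symm (annih_vacuum hΩ) ((hG.tame_vacuum hΩ).annih m) n
  simp only [hadj] at hs
  have hinj : Function.Injective fun l : ℕ => ((l + r + 1 : ℤ), -(l + r + 1 : ℤ)) :=
    fun l l' h => by simp only [Prod.mk.injEq] at h; omega
  rw [← hinj.hasSum_iff] at hs
  · rw [← hs.tsum_eq, ← tsum_mul_left]
    refine tsum_congr fun l => ?_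
    rw [Function.comp_apply, hr.inner_self l]
    ring
  · rintro ⟨n, m⟩ hn
    by_cases h : -n = m
    · have : -(r + 1 : ℤ) < m := by
        by_contra hlt
        exact hn ⟨(-m - r - 1).toNat, by ext <;> simp only <;> omega⟩
      simp only
      rw [hr.eq_zero m this, inner_zero_right, mul_zero]
    · simp only
      rw [hG.inner_vacuum_eq_zero hΩ hG h, mul_zero]

lemma hasTwoPoint_J (S : 𝔤) : HasTwoPoint (fun n ψ => 𝒥.J S n ψ) 0 (k * metric 𝔤 S S) where
  inner_self l := by
    rw [inner_J_vacuum hΩ S S (by positivity)]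
    simp
    ring
  eq_zero n hn := hΩ S n (by push_cast at hn; omega)

variable {O : Type*} [Fintype O] {d : O → ℕ} {u : ∀ o, Fin (d o) → 𝔤} {I v w : O → ℝ}

/-- Mode number `p = l + 2` turns `binom(p+1, 3)` into `binom(l+3, 3)`. The mode `-1` also vanishes
on the vacuum, because two creation modes have total at most `-2`. -/
lemma hasTwoPoint_frameField (hF : IsFrameSystem u I v)
    (hw : ∀ o, w o * (2 * (I o * k + v o)) = 1) (T : 𝔤) :
    HasTwoPoint (𝒥.frameField u w T) 1
      (2 * k * (metric 𝔤 (T - frameCasimir u w k T) (frameCasimir u w k T) : ℂ)) where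
  inner_self l := by
    have h := inner_frameField_vacuum hΩ hF hw T (l + 2)
    have e : (-((l + 2 : ℕ) : ℤ)) = -(l + (1 : ℕ) + 1 : ℤ) := by push_cast; ring
    rw [e] at h
    rw [h]
    ring
  eq_zero n hn := by
    by_cases h0 : 0 ≤ n
    · exact frameField_vacuum hΩ u w T h0
    · have h1 : n = -((1 : ℕ) : ℤ) := by push_cast at hn ⊢; omega
      have h2 : Finset.Ioo (-((1 : ℕ) : ℤ)) 0 = ∅ := by decide
      rw [h1]
      simp only [frameField, normalMode_vacuum hΩ, h2, Finset.sum_empty, add_zero,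
        Finset.sum_const_zero, smul_zero]

lemma inner_J_frameField_eq_zero (S T : 𝔤) (n m : ℤ) :
    inner ℂ (𝒥.J S n 𝒥.Ω) (𝒥.frameField u w T m 𝒥.Ω) = 0 := by
  by_cases h : n = m
  · subst h
    by_cases hn : 0 ≤ n
    · rw [hΩ S n hn, inner_zero_left]
    · obtain ⟨p, hp⟩ := Int.eq_ofNat_of_zero_le (show 0 ≤ -n by omega)
      have : n = -(p : ℤ) := by omega
      rw [this]
      exact inner_J_frameField hΩ u w S T p
  · exact (isField_J S).inner_vacuum_eq_zero hΩ (isField_frameField u w T) h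

/-! ### The commutator of the coset stress-energy tensor and a current -/

/-- The commutator on the vacuum, and its uniqueness. -/
lemma IsField.exists_commutator [CompleteSpace H] {K : ℤ → 𝒥.D → 𝒥.D} (hK : IsField K) (T : 𝔤)
    {f : ℝ → ℂ} (hf : IsTest 2 f) (g : TestFun) :
    ∃ χ, HasSum (fun p : ℤ × ℤ => (coeff f p.1 * fc g.1 p.2) •
        ((K p.1 (𝒥.J T p.2 𝒥.Ω) - 𝒥.J T p.2 (K p.1 𝒥.Ω) : 𝒥.D) : H)) χ ∧
      IsCommutator (𝒥.fieldGraph K f) (𝒥.currentGraph T g) (𝒥.Ω : H) χ ∧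
      ∀ χ', IsCommutator (𝒥.fieldGraph K f) (𝒥.currentGraph T g) (𝒥.Ω : H) χ' → χ' = χ := by
  have ha := rapid_coeff hf
  have hc := rapid_fc g
  have hJ := isField_J (𝒥 := 𝒥) T
  obtain ⟨v₁, hv₁, hw₁⟩ := hK.exists_product hΩ hJ ha hc
  obtain ⟨v₂, hv₂, hw₂⟩ := hJ.exists_product hΩ hK hc ha
  have hsub := modeGraph_J_subset (𝒥 := 𝒥) T g
  have hs₁ := (hK.summable_product hΩ hJ ha hc).hasSum
  have hs₂ := (Equiv.prodComm ℤ ℤ).hasSum_iff.2 (hJ.summable_product hΩ hK hc ha).hasSum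
  refine ⟨_, ?_, ⟨_, _, ⟨v₁, subset_closure (hsub hv₁), hw₁⟩,
    ⟨v₂, subset_closure hv₂, closure_mono hsub hw₂⟩, rfl⟩, ?_⟩
  · convert hs₁.sub hs₂ using 1
    funext p
    simp only [Function.comp_apply, Equiv.prodComm_apply, Prod.fst_swap, Prod.snd_swap,
      AddSubgroupClass.coe_sub, smul_sub, mul_comm (fc g.1 p.2)]
  · rintro χ' ⟨w₁, w₂, ⟨v₁', h₁, h₁'⟩, ⟨v₂', h₂, h₂'⟩, rfl⟩
    have e₁ : v₁' = v₁ := currentGraph_unique T g h₁ (subset_closure (hsub hv₁))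
    have e₂ : v₂' = v₂ := hK.modeGraph_unique hΩ ha h₂ (subset_closure hv₂)
    subst e₁ e₂
    rw [hK.modeGraph_unique hΩ ha h₁' hw₁,
      currentGraph_unique T g h₂' (closure_mono hsub hw₂)]

/-- The norm of a commutator that is a sum of a current and a covariance field. -/
lemma norm_commutator [CompleteSpace H] (hF : IsFrameSystem u I v)
    (hw : ∀ o, w o * (2 * (I o * k + v o)) = 1) (T : 𝔤) {f : ℝ → ℂ} (hf : IsTest 2 f) (g : TestFun)
    {χ : H} (hχ : HasSum (fun p : ℤ × ℤ => (coeff f p.1 * fc g.1 p.2) •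
      ((((2 * Real.pi : ℝ) : ℂ) • (-((p.2 : ℂ) •
          𝒥.J (T - frameCasimir u w k T) (p.1 + p.2) 𝒥.Ω) -
        Complex.I • 𝒥.frameField u w T (p.1 + p.2) 𝒥.Ω) : 𝒥.D) : H)) χ) :
    ((‖χ‖ ^ 2 : ℝ) : ℂ) =
      2 * k * (metric 𝔤 (T - frameCasimir u w k T) (frameCasimir u w k T) : ℂ) *
        (∑' l : ℕ, ((l + (2 * 1 + 1)).choose (2 * 1 + 1) : ℂ) *
          fc (TestFun.conj (ofVector f hf * g)).1 (l + (1 : ℕ) + 1) *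
            fc (ofVector f hf * g).1 (-(l + (1 : ℕ) + 1 : ℤ))) +
      k * (metric 𝔤 (T - frameCasimir u w k T) (T - frameCasimir u w k T) : ℂ) *
        ∑' l : ℕ, ((l + (2 * 0 + 1)).choose (2 * 0 + 1) : ℂ) *
          fc (TestFun.conj (ofVector f hf * l₀ g)).1 (l + (0 : ℕ) + 1) *
            fc (ofVector f hf * l₀ g).1 (-(l + (0 : ℕ) + 1 : ℤ)) := by
  set S := T - frameCasimir u w k T
  set U := ofVector f hf
  have hJ := isField_J (𝒥 := 𝒥) S
  have hΦ := isField_frameField (𝒥 := 𝒥) u w T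
  obtain ⟨C₁, N₁, hb₁⟩ := hJ.norm_vacuum_le hΩ
  obtain ⟨C₂, N₂, hb₂⟩ := hΦ.norm_vacuum_le hΩ
  have s₁ := summable_regroup (rapid_fc U) (rapid_fc (l₀ g)) (x := fun n => (𝒥.J S n 𝒥.Ω : H)) hb₁
  have s₂ := summable_regroup (rapid_fc U) (rapid_fc g)
    (x := fun n => (𝒥.frameField u w T n 𝒥.Ω : H)) hb₂
  have r₁ := hasSum_regroup U (l₀ g) (x := fun n => (𝒥.J S n 𝒥.Ω : H)) hb₁
  have r₂ := hasSum_regroup U g (x := fun n => (𝒥.frameField u w T n 𝒥.Ω : H)) hb₂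
  set y₁ := ∑' p : ℤ × ℤ, (fc U.1 p.1 * fc (l₀ g).1 p.2) • (𝒥.J S (p.1 + p.2) 𝒥.Ω : H)
  set y₂ := ∑' p : ℤ × ℤ, (fc U.1 p.1 * fc g.1 p.2) • (𝒥.frameField u w T (p.1 + p.2) 𝒥.Ω : H)
  -- The factor `p.2` is absorbed into `l₀ g`, whose coefficients are `i n fc g n`, and `2π coeff f`
  -- is the Fourier coefficient of `f θ'`.
  have hy : χ = Complex.I • y₁ - Complex.I • y₂ := by
    refine hχ.unique ?_
    convert (s₁.hasSum.const_smul Complex.I).sub (s₂.hasSum.const_smul Complex.I) using 1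
    funext p
    have hpi : ((2 * Real.pi : ℝ) : ℂ) ≠ 0 := by
      exact_mod_cast (by positivity : (2 * Real.pi : ℝ) ≠ 0)
    have hc : coeff f p.1 * ((2 * Real.pi : ℝ) : ℂ) = fc U.1 p.1 := by
      rw [coeff_eq f hf, mul_right_comm, inv_mul_cancel₀ hpi, one_mul]
    rw [← hc, fc_l₀]
    simp only [Submodule.coe_smul, AddSubgroupClass.coe_sub, NegMemClass.coe_neg]
    simp only [smul_sub, smul_neg, smul_smul]
    congr 1
    · rw [← neg_smul]
      congr 1
      linear_combination (-(coeff f p.1 * ((2 * Real.pi : ℝ) : ℂ) * p.2 * fc g.1 p.2)) *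
        Complex.I_mul_I
    · congr 1
      ring
  have hort : inner ℂ y₁ y₂ = 0 := by
    have h1 : ∀ n, inner ℂ (𝒥.J S n 𝒥.Ω : H) y₂ = 0 := fun n => by
      have h := r₂.mapL (innerSL ℂ (𝒥.J S n 𝒥.Ω : H))
      simp only [innerSL_apply_apply, inner_smul_right] at h
      have h0 : ∀ m, inner ℂ (𝒥.J S n 𝒥.Ω : H) (𝒥.frameField u w T m 𝒥.Ω : H) = 0 :=
        inner_J_frameField_eq_zero hΩ S T n
      simp only [h0, mul_zero] at h
      exact h.unique hasSum_zero
    have h := r₁.mapL (innerSL ℂ y₂)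
    have h1' : ∀ n, inner ℂ y₂ (𝒥.J S n 𝒥.Ω : H) = 0 := fun n => by
      rw [← inner_conj_symm, h1, map_zero]
    simp only [innerSL_apply_apply, inner_smul_right, h1', mul_zero] at h
    rw [← inner_conj_symm, h.unique hasSum_zero, map_zero]
  have hort' : inner ℂ y₂ y₁ = 0 := by rw [← inner_conj_symm, hort, map_zero]
  have hn : ((‖χ‖ ^ 2 : ℝ) : ℂ) = inner ℂ y₂ y₂ + inner ℂ y₁ y₁ := by
    have h := inner_self_eq_norm_sq_to_K (𝕜 := ℂ) χ
    push_cast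
    refine h.symm.trans ?_
    rw [hy]
    simp only [inner_sub_left, inner_sub_right, inner_smul_left, inner_smul_right, hort, hort',
      Complex.conj_I]
    linear_combination (-(inner ℂ y₁ y₁ + inner ℂ y₂ y₂ : ℂ)) * Complex.I_mul_I
  rw [hn, hΦ.inner_self_eq hΩ (hasTwoPoint_frameField hΩ hF hw T) _ r₂,
    hJ.inner_self_eq hΩ (hasTwoPoint_J hΩ S) _ r₁]

end Vacuum

end Currents

end CurrentAlg
end

/-! ### Derivation of both formulas -/

open CurrentAlg in
theorem mainTheorem2
    {𝔤 𝔥 A H : Type*} [LieRing 𝔤] [LieAlgebra ℝ 𝔤] [FiniteDimensional ℝ 𝔤]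
    [LieAlgebra.IsSimple ℝ 𝔤] (hcompact : IsCompactLie 𝔤)
    [LieRing 𝔥] [LieAlgebra ℝ 𝔥] (ι : 𝔥 →ₗ⁅ℝ⁆ 𝔤) (hι : Function.Injective ι)
    [Fintype A] (s : A → LieIdeal ℝ 𝔥) (z : LieIdeal ℝ 𝔥) (hsz : IsReductiveDecomposition s z)
    {m : ℕ} (e : Module.Basis (Fin m) ℝ 𝔤)
    {d : Option A → ℕ} (b : ∀ o, Module.Basis (Fin (d o)) ℝ (part s z o))
    (k : ℕ) (hk : 0 < k)
    [NormedAddCommGroup H] [InnerProductSpace ℂ H] [CompleteSpace H]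
    (𝒥 : Currents 𝔤 k H) (T : 𝔤) :
    let C : 𝔤 → 𝔤 := weightedCasimir ι b k
    -- the norm of the commutator with the coset stress-energy tensor
    (∀ (f : ℝ → ℂ) (g : TestFun), IsTest 2 f →
      let Θ : Set (H × H) := 𝒥.fieldGraph (fun n ψ => 𝒥.sugawara e n ψ - 𝒥.subSugawara ι b n ψ) f
      let jg : Set (H × H) := 𝒥.currentGraph T g
      let fg : ℝ → ℂ := fun x => f x * g.1 x
      let fg' : ℝ → ℂ := fun x => f x * deriv g.1 x
      ∃ Δ₄ Δ₂ : ℂ,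
        IsDelta 4 (fun x => starRingEnd ℂ (fg x)) fg Δ₄ ∧
        IsDelta 2 (fun x => starRingEnd ℂ (fg' x)) fg' Δ₂ ∧
        (∃ χ, IsCommutator Θ jg (𝒥.Ω : H) χ) ∧
        ∀ χ, IsCommutator Θ jg (𝒥.Ω : H) χ →
          ((‖χ‖ ^ 2 : ℝ) : ℂ) =
            8 * k * (Real.pi : ℂ) ^ 2 * (metric 𝔤 (T - C T) (C T) : ℂ) * Δ₄ +
              k * (metric 𝔤 (T - C T) (T - C T) : ℂ) * Δ₂) ∧
    -- the two-point function of the covariance field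
    (∀ u v : ℝ → ℂ, IsTest 2 u → IsTest 2 v →
      let Φ : (ℝ → ℂ) → Set (H × H) := 𝒥.fieldGraph (𝒥.covarianceField ι b T)
      ∃ Δ₄ : ℂ, IsDelta 4 u v Δ₄ ∧
        (∃ w, IsProduct (Φ u) (Φ v) (𝒥.Ω : H) w) ∧
        ∀ w, IsProduct (Φ u) (Φ v) (𝒥.Ω : H) w →
          inner ℂ (𝒥.Ω : H) w = 2 * k * Δ₄ * (metric 𝔤 (T - C T) (C T) : ℂ)) := by
  intro C
  have hΩ : ∀ X n, 0 ≤ n → 𝒥.J X n 𝒥.Ω = 0 := fun X n hn => 𝒥.J_vacuum hcompact X hn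
  have := nontrivial_of_isSimple 𝔤
  have hv := dualCoxeter_pos hcompact
  obtain ⟨t, ht, htF⟩ := exists_frame_adjoint hcompact e
  obtain ⟨u, hF, hu, hproj⟩ := exists_frameSystem hcompact ι hι s z hsz b
  obtain ⟨w, hwdef⟩ : ∃ w : Option A → ℝ,
    w = fun o => (2 * (partIndex ι s o * k + partCoxeter s o))⁻¹ := ⟨_, rfl⟩
  -- The abelian ideal has `v = 0`, so here `k > 0` is essential.
  have hw : ∀ o, w o * (2 * (partIndex ι s o * k + partCoxeter s o)) = 1 := fun o => by
    have h1 := hF.index_pos o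
    have h2 := hF.coxeter_nonneg o
    have h3 : (0 : ℝ) < k := by exact_mod_cast hk
    rw [hwdef]
    exact inv_mul_cancel₀ (by positivity)
  have hC : C T = frameCasimir u w k T := by
    rw [hwdef]; exact Currents.weightedCasimir_eq hu hF hproj T
  have hpi : (Real.pi : ℂ) ≠ 0 := by exact_mod_cast Real.pi_ne_zero
  have hang : ∀ x, (angDensity x : ℂ) ≠ 0 := fun x => by exact_mod_cast (angDensity_pos x).ne'
  refine ⟨fun f g hf => ?_, fun h₁ h₂ hh₁ hh₂ => ?_⟩
  · intro Θ jg fg fg'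
    have hfield : ∀ {E : ℤ} {ψ : 𝒥.D}, 𝒥.Annih E ψ → ∀ n,
        𝒥.sugawara e n ψ - 𝒥.subSugawara ι b n ψ =
          ((2 * Real.pi : ℝ) : ℂ) • (𝒥.frameSugawara (O := Unit) (fun _ => t)
            (fun _ => (2 * (1 * k + dualCoxeter 𝔤))⁻¹) n ψ - 𝒥.frameSugawara u w n ψ) := by
      intro E ψ hψ n
      rw [Currents.sugawara_eq ht hψ, Currents.subSugawara_eq hu hψ, ← smul_sub, hwdef]
    have hK : Currents.IsField fun n ψ => 𝒥.sugawara e n ψ - 𝒥.subSugawara ι b n ψ :=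
      (((Currents.isField_frameSugawara _ _).sub
        (Currents.isField_frameSugawara u w)).const_smul (2 * Real.pi)).congr hfield
    obtain ⟨χ, hχ, hcomm, huniq⟩ := hK.exists_commutator hΩ T hf g
    have hδ₄ := isDelta_fc 1 (TestFun.conj (TestFun.ofVector f hf * g))
      (TestFun.ofVector f hf * g) (fun x => starRingEnd ℂ (fg x)) fg
      (fun x => by
        change starRingEnd ℂ (f x * g.1 x) = starRingEnd ℂ (f x * (angDensity x : ℂ) * g.1 x) * _
        have := hang x
        simp only [map_mul, Complex.conj_ofReal]
        field_simp)
      (fun x => by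
        change f x * g.1 x = f x * (angDensity x : ℂ) * g.1 x * _
        have := hang x
        field_simp)
    have hfg' : ∀ x, fg' x = (TestFun.ofVector f hf * TestFun.l₀ g).1 x := fun x => by
      change f x * deriv g.1 x = f x * (angDensity x : ℂ) * (TestFun.l₀ g).1 x
      rw [mul_assoc, TestFun.angDensity_mul_l₀]
    have hδ₂ := isDelta_fc 0 (TestFun.conj (TestFun.ofVector f hf * TestFun.l₀ g))
      (TestFun.ofVector f hf * TestFun.l₀ g) (fun x => starRingEnd ℂ (fg' x)) fg'
      (fun x => by rw [hfg', pow_zero, mul_one]; rfl) (fun x => by rw [hfg', pow_zero, mul_one])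
    refine ⟨_, _, hδ₄, hδ₂, ⟨χ, hcomm⟩, fun χ' hχ' => ?_⟩
    rw [huniq χ' hχ', hC]
    -- The difference of the commutators for `𝔤` (where `C = 1`, `Φ = 0`) and for `𝔥`.
    have hterm : ∀ n l, 𝒥.sugawara e n (𝒥.J T l 𝒥.Ω) - 𝒥.subSugawara ι b n (𝒥.J T l 𝒥.Ω) -
        𝒥.J T l (𝒥.sugawara e n 𝒥.Ω - 𝒥.subSugawara ι b n 𝒥.Ω) = ((2 * Real.pi : ℝ) : ℂ) •
          (-((l : ℂ) • 𝒥.J (T - frameCasimir u w k T) (n + l) 𝒥.Ω) -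
            Complex.I • 𝒥.frameField u w T (n + l) 𝒥.Ω) := fun n l => by
      have hA := Currents.annih_vacuum hΩ
      rw [hfield hA, hfield (hA.J T l), map_smul, ← smul_sub, map_sub,
        Currents.frameSugawara_adjoint_comm htF (by positivity) hA,
        Currents.frameSugawara_comm hA u w, Currents.J_sub]
      congr 1
      module
    simp only [hterm] at hχ
    rw [Currents.norm_commutator hΩ hF hw T hf g hχ]
    -- `Δ₄` contains `(2π)^{-2}` relative to the sum over Fourier coefficients, so `8 k π² Δ₄`
    -- matches the coefficient `2 k`; for `Δ₂` there is no such factor.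
    push_cast
    field_simp
    ring
  · intro Φ
    have hfield : ∀ {E : ℤ} {ψ : 𝒥.D}, 𝒥.Annih E ψ → ∀ n,
        𝒥.covarianceField ι b T n ψ = 𝒥.frameField u w T n ψ := by
      intro E ψ hψ n
      rw [Currents.covarianceField_eq hu hψ, hwdef]
    have hA := Currents.annih_vacuum hΩ
    have hK : Currents.IsField (𝒥.covarianceField ι b T) :=
      (Currents.isField_frameField u w T).congr hfield
    have htwo := Currents.hasTwoPoint_frameField hΩ hF hw T
    have htwo' : Currents.HasTwoPoint (𝒥.covarianceField ι b T) 1 _ :=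
      ⟨fun l => by rw [hfield hA]; exact htwo.inner_self l,
        fun n hn => by rw [hfield hA]; exact htwo.eq_zero n hn⟩
    have ha := rapid_coeff hh₁
    have hc := rapid_coeff hh₂
    obtain ⟨v₁, hv₁, hw₁⟩ := hK.exists_product hΩ hK ha hc
    have hδ₄ := isDelta_fc 1 (TestFun.ofVector h₁ hh₁) (TestFun.ofVector h₂ hh₂) h₁ h₂
      (fun x => by
        have := hang x
        rw [TestFun.ofVector_apply]
        field_simp)
      (fun x => by
        have := hang x
        rw [TestFun.ofVector_apply]
        field_simp)
    refine ⟨_, hδ₄, ⟨_, v₁, subset_closure hv₁, hw₁⟩, ?_⟩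
    rintro w' ⟨v', hv', hw'⟩
    have e₁ : v' = v₁ := hK.modeGraph_unique hΩ hc hv' (subset_closure hv₁)
    subst e₁
    rw [hK.modeGraph_unique hΩ ha hw' hw₁, hK.inner_product_eq hΩ htwo' ha hc, hC]
    -- The two factors `(2π)⁻¹` in the coefficients of the smeared fields are exactly the
    -- `(2π)^{-2}` in `Δ₄`.
    have hsum : ∑' l : ℕ, ((l + (2 * 1 + 1)).choose (2 * 1 + 1) : ℂ) *
        Currents.coeff h₁ (l + (1 : ℕ) + 1) * Currents.coeff h₂ (-(l + (1 : ℕ) + 1 : ℤ)) =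
        ((2 * Real.pi : ℝ) : ℂ)⁻¹ ^ (2 * 1) *
          ∑' l : ℕ, ((l + (2 * 1 + 1)).choose (2 * 1 + 1) : ℂ) *
            fc (TestFun.ofVector h₁ hh₁).1 (l + (1 : ℕ) + 1) *
              fc (TestFun.ofVector h₂ hh₂).1 (-(l + (1 : ℕ) + 1 : ℤ)) := by
      rw [← tsum_mul_left]
      refine tsum_congr fun l => ?_
      rw [coeff_eq h₁ hh₁, coeff_eq h₂ hh₂]
      ring
    rw [hsum]
    ring
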